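/- **Conventions.** For $D\subseteq\mathbb R^d$ let $\mathrm{Simp}^k(D)$ be the set of tuples $S=[p_0\dots p_k]$ with $\mathrm{conv}\{p_0,\dots,p_k\}\subseteq D$. A $k$-germ in $D$ is a function $\omega:\mathrm{Simp}^k(D)\to\mathbb R$, written $\omega_S$ or $\langle S,\omega\rangle$; a function $f:D\to\mathbb R$ is a $0$-germ. Set $\langle S,\delta\omega\rangle=\langle\partial S,\omega\rangle=\sum_i(-1)^i\omega_{[p_0\dots\hat p_i\dots p_{k+1}]}$ for $S\in\mathrm{Simp}^{k+1}(D)$ and $(\omega\cup\omega')_{[p_0\dots p_{k+h}]}=\omega_{[p_0\dots p_k]}\,\omega'_{[p_k\dots p_{k+h}]}$. For a nonnegative germ (gauge) $v$, $[\omega]_v\in[0,\infty]$ is the infimum of the $c\ge 0$ with $|\omega|\le c\,v$ on all simplices; $\omega\approx_v\omega'$ means $[\omega-\omega']_v<\infty$; for $v=\mathrm{diam}^\gamma$ write $[\cdot]_\gamma$, $\approx_\gamma$. A gauge $u$ is $r$-Dini if it takes equal values on simplices that are mapped to each other, vertex by vertex, by an isometry of $\mathbb R^d$, and $2^{nr}\langle(2^{-n})_\natural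 S,u\rangle\to0$ for all $S$, where $(2^{-n})_\natural S$ stands for a copy of $S$ scaled by $2^{-n}$ and contained in $D$. A $k$-germ is regular if it vanishes on $k$-simplices of zero $k$-volume and its pull-back by every affine map from a subset of $\mathbb R^k$ to $D$ is $\delta$-closed. A $k$-germ $\omega$ is sewable if there is a regular $k$-germ $\mathrm{sew}\,\omega$ (then unique, for $k\in\{1,2\}$) with $\omega\approx_v\mathrm{sew}\,\omega$ for some $k$-Dini gauge $v$. Put $g^1\,dg^2=\mathrm{sew}(g^1\cup\delta g^2)$ (Young) and $f\,dg^1\wedge dg^2=\mathrm{sew}(f\cup\delta(g^1\,dg^2))$ (Züst), and write $\int_S f\,dg^1\wedge dg^2=\langle S,f\,dg^1\wedge dg^2\rangle$. A side compensator of a $2$-germ $\omega$ is a $1$-germ $\eta$ with $\eta\approx_u0$ for some $1$-Dini gauge $u$ and $\langle[prq],\omega-\delta\eta\rangle=0$ for every $[prq]$ with $r=\frac{p+q}2$. **Statement.** Let $\sigma\in(0,1]$, $\alpha>0$, $\beta>1$, $\gamma:=\alpha+\beta>2/\sigma$ and $\beta\sigma>1$ (the last condition is automatic if $\alpha\le1$).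 Let $D\subseteq\mathbb R^d$, let $f,g^1,g^2:D\to\mathbb R$ be continuous with $[\delta f]_\alpha<\infty$ and $[\delta g^1\cup\delta g^2]_\beta<\infty$, let $I\subseteq\mathbb R^2$ and let $\varphi:I\to D$ satisfy $[\delta\varphi]_\sigma<\infty$, i.e. $|\varphi(q)-\varphi(p)|\le C|q-p|^\sigma$ for all $[pq]\in\mathrm{Simp}^1(I)$. Assume that $\varphi_\natural S:=[\varphi(p_0)\varphi(p_1)\varphi(p_2)]\in\mathrm{Simp}^2(D)$ for every $S=[p_0p_1p_2]\in\mathrm{Simp}^2(I)$ (for instance $\mathrm{conv}\,\varphi(I)\subseteq D$). Then $g^1\cup\delta g^2$ and $f\cup\delta(g^1\,dg^2)$ are sewable in $D$, and the same holds in $I$ for $f\circ\varphi,g^1\circ\varphi,g^2\circ\varphi$. Hence the $2$-germs in $I$ $$\langle S,\varphi^\natural(f\,dg^1\wedge dg^2)\rangle:=\int_{\varphi_\natural S}f\,dg^1\wedge dg^2,\qquad \varphi^*(f\,dg^1\wedge dg^2):=(f\circ\varphi)\,d(g^1\circ\varphi)\wedge d(g^2\circ\varphi)$$ are well defined, and: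 1. If $f\circ\varphi$ is bounded on $I$, then $\varphi^\natural(f\,dg^1\wedge dg^2)$ has exactly one side compensator. 2. If $\eta$ is a side compensator of $\varphi^\natural(f\,dg^1\wedge dg^2)$, then $$\varphi^\natural(f\,dg^1\wedge dg^2)-\varphi^*(f\,dg^1\wedge dg^2)\approx_{\gamma\sigma}\delta\eta .$$ 3. If $d=2$ and $\eta$ is a side compensator of $\varphi^\natural(f\,dg^1\wedge dg^2)$, then for every $S=[p_0p_1p_2]\in\mathrm{Simp}^2(I)$ $$\int_{\varphi_\natural S}f\,dg^1\wedge dg^2=\int_S(f\circ\varphi)\,d(g^1\circ\varphi)\wedge d(g^2\circ\varphi)+\langle\partial S,\eta\rangle ,$$ and if $\varphi(\mathrm{conv}\{p_i,p_j\})\subseteq\mathrm{conv}\{\varphi(p_i),\varphi(p_j)\}$ for all $i,j\in\{0,1,2\}$, then $\langle[p_ip_j],\eta\rangle=0$ for all $i,j$. 4. If $d=2$ and $S=[p_0p_1p_2]\in\mathrm{Simp}^2(I)$ satisfies $\varphi(\mathrm{conv}\{p_i,p_j\})\subseteq\mathrm{conv}\{\varphi(p_i),\varphi(p_j)\}$ for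 all $i,j\in\{0,1,2\}$, then (whether or not $f\circ\varphi$ is bounded) $$\int_{\varphi_\natural S}f\,dg^1\wedge dg^2=\int_S(f\circ\varphi)\,d(g^1\circ\varphi)\wedge d(g^2\circ\varphi).$$ -/

import Mathlib

open scoped ENNReal NNReal Topology

noncomputable section

namespace RoughForms

/-- The Euclidean space of dimension `d`. -/
abbrev Euc (d : ℕ) : Type := EuclideanSpace ℝ (Fin d)

/-- `k`-simplices `[p₀ … p_k]` in `D`: ordered tuples of points whose convex hull is inside `D`. -/
abbrev Simp (k : ℕ) {d : ℕ} (D : Set (Euc d)) : Type :=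
  {p : Fin (k + 1) → Euc d // convexHull ℝ (Set.range p) ⊆ D}

/-- Real-valued `k`-germs in `D`: arbitrary functions on the `k`-simplices in `D`. -/
abbrev Germ (k : ℕ) {d : ℕ} (D : Set (Euc d)) : Type := Simp k D → ℝ

section Simplices

variable {d e k h : ℕ} {D : Set (Euc d)}

/-- The simplex `[p_{s 0} … p_{s h}]` made of some of the vertices of `[p₀ … p_k]`. -/
def Simp.reindex (S : Simp k D) (s : Fin (h + 1) → Fin (k + 1)) : Simp h D :=
  ⟨fun i => S.1 (s i),
    (convexHull_mono (by rintro _ ⟨i, rfl⟩; exact ⟨s i, rfl⟩)).trans S.2⟩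

/-- The oriented edge `[p_i p_j]` of `[p₀ … p_k]`. -/
def Simp.edge (S : Simp k D) (i j : Fin (k + 1)) : Simp 1 D := S.reindex ![i, j]

/-- The copy of `(2⁻ⁿ)_♮ S` inside `D` which has the same base point `p₀` as `S`. -/
def Simp.shrink (S : Simp k D) (n : ℕ) : Simp k D :=
  ⟨fun i => AffineMap.homothety (S.1 0) (((2 : ℝ) ^ n)⁻¹) (S.1 i), by
    refine (convexHull_min ?_ (convex_convexHull ℝ (Set.range S.1))).trans S.2
    rintro _ ⟨i, rfl⟩
    have h2 : (1 : ℝ) ≤ 2 ^ n := one_le_pow₀ (by norm_num)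
    have hx : ∀ j, S.1 j ∈ convexHull ℝ (Set.range S.1) := fun j =>
      subset_convexHull ℝ _ ⟨j, rfl⟩
    show AffineMap.homothety (S.1 0) (((2 : ℝ) ^ n)⁻¹) (S.1 i) ∈ _
    rw [AffineMap.homothety_eq_lineMap]
    exact (convex_convexHull ℝ (Set.range S.1)).lineMap_mem (hx 0) (hx i)
      ⟨by positivity, inv_le_one_of_one_le₀ h2⟩⟩

/-- The diameter `max |p_i - p_j|` of a simplex. -/
def Simp.diam (S : Simp k D) : ℝ := Metric.diam (Set.range S.1)

/-- The `k`-volume `(1 / k!) √(det (P Pᵀ))` of a `k`-simplex, where the rows of `P` are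
`p_i - p₀`, `i = 1, …, k`. -/
def Simp.vol (S : Simp k D) : ℝ :=
  let P : Matrix (Fin k) (Fin d) ℝ := Matrix.of fun i j => (S.1 i.succ - S.1 0) j
  Real.sqrt ((P * P.transpose).det) / (k.factorial : ℝ)

/-- Two simplices (in the same Euclidean space) are isometric if an isometry of the space maps the
vertices of the first to those of the second, in the given order. -/
def Simp.Isometric (S T : Simp k D) : Prop :=
  ∃ i : Euc d → Euc d, Isometry i ∧ ∀ j, i (S.1 j) = T.1 j

/-- The map `φ` sends the vertices of every `k`-simplex in `I` to the vertices of a `k`-simplex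
in `D`, i.e. the push-forward `φ_♮` maps `k`-simplices in `I` to `k`-simplices in `D`. -/
def MapsSimp (k : ℕ) (φ : Euc e → Euc d) (I : Set (Euc e)) (D : Set (Euc d)) : Prop :=
  ∀ S : Simp k I, convexHull ℝ (Set.range fun i => φ (S.1 i)) ⊆ D

/-- The push-forward `φ_♮ [p₀ … p_k] = [φ(p₀) … φ(p_k)]`. -/
def Simp.push {I : Set (Euc e)} (φ : Euc e → Euc d) (hφ : MapsSimp k φ I D) (S : Simp k I) :
    Simp k D :=
  ⟨fun i => φ (S.1 i), hφ S⟩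

theorem mapsSimp_of_affine {I : Set (Euc e)} (A : Euc e →ᵃ[ℝ] Euc d) (hA : Set.MapsTo A I D) :
    MapsSimp k A I D := by
  intro S
  have h1 : (Set.range fun i => A (S.1 i)) = A '' Set.range S.1 := by
    rw [← Set.range_comp]; rfl
  rw [h1, ← AffineMap.image_convexHull]
  rintro _ ⟨x, hx, rfl⟩
  exact hA (S.2 hx)

end Simplices

section Germs

variable {d e k h : ℕ} {D : Set (Euc d)}

/-- The `0`-germ given by (the restriction to `D` of) a function. -/
def germ0 (D : Set (Euc d)) (f : Euc d → ℝ) : Germ 0 D := fun S => f (S.1 0)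

/-- The exterior derivative
`(δ ω)_S = ⟨∂S, ω⟩ = ∑ i, (-1)ⁱ ω_{[p₀ … p̂_i … p_{k+1}]}`. -/
def extd (ω : Germ k D) : Germ (k + 1) D :=
  fun S => ∑ i : Fin (k + 2), (-1 : ℝ) ^ (i : ℕ) * ω (S.reindex i.succAbove)

/-- The cup product `(ω ∪ ω')_{p₀ … p_{k+h}} = ω_{p₀ … p_k} ω'_{p_k … p_{k+h}}`. -/
def cup (ω : Germ k D) (ω' : Germ h D) : Germ (k + h) D :=
  fun S => ω (S.reindex fun i => ⟨i.1, by omega⟩) * ω' (S.reindex fun i => ⟨k + i.1, by omega⟩)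

/-- The algebraic pull-back `⟨S, φ^♮ ω⟩ = ⟨φ_♮ S, ω⟩`. -/
def pullback {I : Set (Euc e)} (φ : Euc e → Euc d) (hφ : MapsSimp k φ I D) (ω : Germ k D) :
    Germ k I :=
  fun S => ω (S.push φ hφ)

/-- The germ `diam ^ γ`. -/
def diamPow (γ : ℝ) : Germ k D := fun S => S.diam ^ γ

/-- The size `[ω]_v ∈ [0, ∞]`: the infimum of the constants `c` with `|ω_S| ≤ c v_S` for all
simplices `S` in `D`. -/
def gaugeSize (ω v : Germ k D) : ℝ≥0∞ :=
  ⨅ (c : ℝ≥0) (_ : ∀ S, |ω S| ≤ (c : ℝ) * v S), (c : ℝ≥0∞)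

theorem gaugeSize_lt_top_iff (ω v : Germ k D) :
    gaugeSize ω v < ⊤ ↔ ∃ c : ℝ≥0, ∀ S, |ω S| ≤ (c : ℝ) * v S := by
  simp only [gaugeSize, iInf_lt_iff]
  exact ⟨fun ⟨c, hc, _⟩ => ⟨c, hc⟩, fun ⟨c, hc⟩ => ⟨c, hc, ENNReal.coe_lt_top⟩⟩

/-- The relation `ω ≈_v ω'`. -/
def Near (v ω ω' : Germ k D) : Prop := gaugeSize (ω - ω') v < ⊤

/-- `r`-Dini gauges: nonnegative germs, equal on isometric simplices, with
`2^{nr} u((2⁻ⁿ)_♮ S) → 0` for every simplex `S`. -/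
structure IsDini (r : ℝ) (u : Germ k D) : Prop where
  nonneg : ∀ S, 0 ≤ u S
  uniform : ∀ S T, S.Isometric T → u S = u T
  tendsto : ∀ S : Simp k D,
    Filter.Tendsto (fun n : ℕ => (2 : ℝ) ^ ((n : ℝ) * r) * u (S.shrink n)) Filter.atTop (𝓝 0)

/-- Nonatomic germs vanish on simplices of zero volume. -/
def IsNonatomic (ω : Germ k D) : Prop := ∀ S : Simp k D, S.vol = 0 → ω S = 0

/-- A `k`-germ in `D` is closed on `k`-planes if its pull-back by every affine map
`A : J ⊆ ℝᵏ → D` is closed. -/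
def ClosedOnPlanes (ω : Germ k D) : Prop :=
  ∀ (J : Set (Euc k)) (A : Euc k →ᵃ[ℝ] Euc d) (hA : Set.MapsTo A J D),
    extd (pullback A (mapsSimp_of_affine A hA) ω) = 0

/-- Regular germs: nonatomic and closed on `k`-planes. -/
def IsRegular (ω : Germ k D) : Prop := IsNonatomic ω ∧ ClosedOnPlanes ω

/-- `ω'` is a regular germ with `ω ≈_v ω'` for some `k`-Dini gauge `v`. -/
def IsSew (ω ω' : Germ k D) : Prop :=
  IsRegular ω' ∧ ∃ v : Germ k D, IsDini (k : ℝ) v ∧ Near v ω ω'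

/-- Sewable germs. -/
def Sewable (ω : Germ k D) : Prop := ∃ ω', IsSew ω ω'

open Classical in
/-- The regular germ `sew ω` of a sewable germ `ω` (and, by convention, `0` if `ω` is not
sewable). -/
def sew (ω : Germ k D) : Germ k D := if hω : Sewable ω then hω.choose else 0

/-- The germ `f ∪ δ g`. -/
def preYoung (D : Set (Euc d)) (f g : Euc d → ℝ) : Germ 1 D :=
  cup (germ0 D f) (extd (germ0 D g))

/-- The Young germ `f dg = sew (f ∪ δ g)` in `D`. -/
def young (D : Set (Euc d)) (f g : Euc d → ℝ) : Germ 1 D := sew (preYoung D f g)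

/-- The germ `f ∪ δ (g₁ dg₂)`. -/
def preZust (D : Set (Euc d)) (f g₁ g₂ : Euc d → ℝ) : Germ 2 D :=
  cup (germ0 D f) (extd (young D g₁ g₂))

/-- The Züst germ `f dg₁ ∧ dg₂ = sew (f ∪ δ (g₁ dg₂))` in `D`; its value on a `2`-simplex `S` is
the integral of `f dg₁ ∧ dg₂` over `S`. -/
def zust (D : Set (Euc d)) (f g₁ g₂ : Euc d → ℝ) : Germ 2 D := sew (preZust D f g₁ g₂)

/-- `η` is a side compensator of `ω`. -/
def IsSideCompensator (ω : Germ 2 D) (η : Germ 1 D) : Prop :=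
  (∃ u : Germ 1 D, IsDini 1 u ∧ Near u η 0) ∧
    ∀ S : Simp 2 D, S.1 1 = midpoint ℝ (S.1 0) (S.1 2) → (ω - extd η) S = 0

end Germs

end RoughForms

end

/-! Everything rests on one contraction principle: if a simplex is cut into `m` pieces, and a gauge
shrinks by a factor `θ` on each piece with `m * θ < 1`, then a quantity whose absolute value is at
most the sum over the pieces and is bounded by the gauge is zero (`Contracts.eq_zero`), and an
almost additive quantity converges to an additive one under refinement (`Contracts.lim_eq`,
`Contracts.abs_sub_lim_le`). For powers of the diameter this means exponent above 1 for halved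
segments and above 2 for quartered triangles.

Sewing. The defect of `g₁ ∪ δg₂` is `δg₁ ∪ δg₂`, of order `β > 1`, so halving produces the Young
germ. The defect of `f ∪ δ(g₁ dg₂)` is `δf ∪ δ(g₁ dg₂)`, of order `α + β > 2`, so quartering
produces the Züst germ. The limits are additive for midpoint subdivisions only, while regularity
asks for closedness on lines and planes. On lines, `additive_of_midpoint` builds a primitive. In
planes, midpoint additivity is improved first to additivity of parallelograms along a side
(`par_add`), then, through a shear identity, to triangles cut from a vertex (`tri_add`); Radon's
theorem then gives closedness (`dTri_eq_zero`).

Compensator. Let `ζ` be the difference between the algebraic pull-back of `g₁ dg₂` and the Young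
germ of the compositions; its order is `βσ > 1`. Comparing both Züst germs with the germs they are
sewn from shows that the two pull-backs differ by `(f ∘ φ) ∪ δζ`, hence by `δ((f ∘ φ) ∪ ζ)`, up to
order `γσ`. On a triangle `[p m q]` with `m` the midpoint the intrinsic pull-back vanishes, so the
equation for a compensator `η` prescribes its midpoint defect. Summing these defects over dyadic
subdivisions gives existence when `f ∘ φ` is bounded. Two solutions differ by a midpoint-additive
germ dominated by a Dini gauge, which is zero. The same argument shows that `η` agrees with `(f ∘ φ)
∪ ζ` up to order `γσ`, whence the second claim.

In the plane, the difference of the pull-backs minus `δη` is closed, zero on midpoint triangles and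
of order `γσ > 2`, so it is additive under quartering and vanishes (`eq_zero_of_dTri_eq_zero`). If
an edge is mapped into a segment, its midpoint triangles have collinear images, so `η` is midpoint
additive on it and vanishes. The last claim follows by restricting to the compact triangle, where `f
∘ φ` is bounded and a compensator exists. -/

namespace RoughForms

open Filter

/-! ### Refinement under a contracted gauge. -/

section SelfSimilar

variable {X ι : Type*} [Fintype ι]

/-- Iterated refinement of `w`: each step replaces the value at `x` by the sum of the values at the
children `T i x`, plus a source term `h x`. -/
noncomputable def selfSimIter (T : ι → X → X) (h w : X → ℝ) : ℕ → X → ℝ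
  | 0, x => w x
  | n + 1, x => ∑ i, selfSimIter T h w n (T i x) + h x

/-- The limit of the iterated refinements. -/
noncomputable def selfSimLim (T : ι → X → X) (h w : X → ℝ) (x : X) : ℝ :=
  limUnder atTop fun n => selfSimIter T h w n x

/-- A gauge `b` on the part of `X` singled out by `P` which is contracted by the children maps, the
factor being less than the inverse of the number of children. -/
structure Contracts (T : ι → X → X) (P : X → Prop) (b : X → ℝ) (θ : ℝ) : Prop where
  map_mem : ∀ i x, P x → P (T i x)
  nonneg : ∀ x, P x → 0 ≤ b x
  factor_nonneg : 0 ≤ θ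
  factor_lt : Fintype.card ι * θ < 1
  le : ∀ i x, P x → b (T i x) ≤ θ * b x

variable {T : ι → X → X} {P : X → Prop} {b : X → ℝ} {θ : ℝ} {h w : X → ℝ}

theorem Contracts.sum_le (hT : Contracts T P b θ) {c : ℝ} (hc : 0 ≤ c) {F : X → ℝ}
    (hF : ∀ x, P x → |F x| ≤ c * b x) {x : X} (hx : P x) :
    ∑ i, |F (T i x)| ≤ c * (Fintype.card ι * θ) * b x := by
  calc ∑ i, |F (T i x)| ≤ ∑ _i : ι, c * (θ * b x) :=
        Finset.sum_le_sum fun i _ => (hF _ (hT.map_mem i x hx)).trans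
          (mul_le_mul_of_nonneg_left (hT.le i x hx) hc)
    _ = c * (Fintype.card ι * θ) * b x := by
        rw [Finset.sum_const, Finset.card_univ, nsmul_eq_mul]; ring

/-- The source `h` cancels in consecutive differences, so each further refinement costs a factor
`card ι * θ`, starting from the defect bound `b`. -/
theorem Contracts.abs_iter_sub_le (hT : Contracts T P b θ)
    (hw : ∀ x, P x → |w x - (∑ i, w (T i x) + h x)| ≤ b x) (n : ℕ) :
    ∀ x, P x → |selfSimIter T h w n x - selfSimIter T h w (n + 1) x| ≤
      (Fintype.card ι * θ) ^ n * b x := by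
  have h0 : 0 ≤ (Fintype.card ι : ℝ) * θ := mul_nonneg (Nat.cast_nonneg _) hT.factor_nonneg
  induction n with
  | zero => intro x hx; simpa [selfSimIter] using hw x hx
  | succ n ih =>
    intro x hx
    have h1 : selfSimIter T h w (n + 1) x - selfSimIter T h w (n + 1 + 1) x =
        ∑ i, (selfSimIter T h w n (T i x) - selfSimIter T h w (n + 1) (T i x)) := by
      rw [Finset.sum_sub_distrib]
      simp only [selfSimIter]
      ring
    rw [h1]
    refine (Finset.abs_sum_le_sum_abs _ _).trans ((hT.sum_le (pow_nonneg h0 n)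
      (F := fun x => selfSimIter T h w n x - selfSimIter T h w (n + 1) x) ih hx).trans ?_)
    rw [pow_succ]

theorem Contracts.tendsto_lim (hT : Contracts T P b θ)
    (hw : ∀ x, P x → |w x - (∑ i, w (T i x) + h x)| ≤ b x) {x : X} (hx : P x) :
    Tendsto (fun n => selfSimIter T h w n x) atTop (𝓝 (selfSimLim T h w x)) := by
  refine CauchySeq.tendsto_limUnder (cauchySeq_of_le_geometric (Fintype.card ι * θ) (b x)
    hT.factor_lt fun n => ?_)
  rw [Real.dist_eq, mul_comm (b x)]
  exact hT.abs_iter_sub_le hw n x hx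

theorem Contracts.lim_eq (hT : Contracts T P b θ)
    (hw : ∀ x, P x → |w x - (∑ i, w (T i x) + h x)| ≤ b x) {x : X} (hx : P x) :
    selfSimLim T h w x = ∑ i, selfSimLim T h w (T i x) + h x := by
  refine tendsto_nhds_unique ((tendsto_add_atTop_iff_nat 1).2 (hT.tendsto_lim hw hx)) ?_
  exact (tendsto_finsetSum _ fun i _ => hT.tendsto_lim hw (hT.map_mem i x hx)).add_const _

theorem Contracts.abs_sub_lim_le (hT : Contracts T P b θ)
    (hw : ∀ x, P x → |w x - (∑ i, w (T i x) + h x)| ≤ b x) {x : X} (hx : P x) :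
    |w x - selfSimLim T h w x| ≤ b x / (1 - Fintype.card ι * θ) := by
  have := dist_le_of_le_geometric_of_tendsto₀ (Fintype.card ι * θ) (b x) hT.factor_lt
    (fun n => by
      rw [Real.dist_eq, mul_comm (b x)]
      exact hT.abs_iter_sub_le hw n x hx) (hT.tendsto_lim hw hx)
  rwa [Real.dist_eq] at this

/-- Passing to the children `n` times improves the bound `b` by `(card ι * θ) ^ n`, which tends to
zero. This is the source of all uniqueness and exact additivity statements based on explicit powers.
-/
theorem Contracts.eq_zero (hT : Contracts T P b θ) {E : X → ℝ}
    (hE : ∀ x, P x → |E x| ≤ ∑ i, |E (T i x)|) (hb : ∀ x, P x → |E x| ≤ b x) {x : X} (hx : P x) :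
    E x = 0 := by
  have h0 : 0 ≤ (Fintype.card ι : ℝ) * θ := mul_nonneg (Nat.cast_nonneg _) hT.factor_nonneg
  have key : ∀ (n : ℕ) (x : X), P x → |E x| ≤ (Fintype.card ι * θ) ^ n * b x := by
    intro n
    induction n with
    | zero => intro x hx; simpa using hb x hx
    | succ n ih =>
      intro x hx
      rw [pow_succ]
      exact (hE x hx).trans (hT.sum_le (pow_nonneg h0 n) ih hx)
  have ht : Tendsto (fun n : ℕ => ((Fintype.card ι : ℝ) * θ) ^ n * b x) atTop (𝓝 (0 * b x)) :=
    (tendsto_pow_atTop_nhds_zero_of_lt_one h0 hT.factor_lt).mul_const _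
  rw [zero_mul] at ht
  exact abs_eq_zero.1 (le_antisymm (ge_of_tendsto' ht fun n => key n x hx) (abs_nonneg _))

end SelfSimilar

theorem two_mul_two_rpow_neg_lt_one {β : ℝ} (hβ : 1 < β) : 2 * (2 : ℝ) ^ (-β) < 1 := by
  have h1 : (2 : ℝ) ^ (-β) < 2 ^ (-1 : ℝ) :=
    Real.rpow_lt_rpow_of_exponent_lt (by norm_num) (by linarith)
  rw [Real.rpow_neg_one] at h1
  linarith

theorem four_mul_two_rpow_neg_lt_one {β : ℝ} (hβ : 2 < β) : 4 * (2 : ℝ) ^ (-β) < 1 := by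
  have h1 : (2 : ℝ) ^ (-β) < 2 ^ (-2 : ℝ) :=
    Real.rpow_lt_rpow_of_exponent_lt (by norm_num) (by linarith)
  have h2 : (2 : ℝ) ^ (-2 : ℝ) = 1 / 4 := by
    rw [Real.rpow_neg (by norm_num)]; norm_num
  rw [h2] at h1
  linarith

theorem div_two_rpow {x : ℝ} (hx : 0 ≤ x) (β : ℝ) : (x / 2) ^ β = 2 ^ (-β) * x ^ β := by
  rw [Real.div_rpow hx (by norm_num), Real.rpow_neg (by norm_num), div_eq_mul_inv, mul_comm]

/-! ### Almost additive functions of intervals. -/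

section OneDim

variable {k : ℝ → ℝ → ℝ} {C β : ℝ}

theorem exists_le_mid_le {x : ℕ → ℝ} {c : ℝ} {N : ℕ} (h0 : x 0 ≤ c) (hN : c ≤ x (N + 1)) :
    ∃ i j, N = i + j ∧ x i ≤ c ∧ c ≤ x (i + 1) := by
  induction N with
  | zero => exact ⟨0, 0, rfl, h0, hN⟩
  | succ N ih =>
    rcases le_total c (x (N + 1)) with h | h
    · obtain ⟨i, j, hij, h1, h2⟩ := ih h
      exact ⟨i, j + 1, by omega, h1, h2⟩
    · exact ⟨N + 1, 0, by omega, h, hN⟩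

/-- Young's estimate: an almost additive function of intervals differs little from its sums over
arbitrary partitions. -/
theorem abs_sub_sum_partition_le (hβ : 1 < β)
    (hk : ∀ a m b, 0 ≤ a → a ≤ m → m ≤ b → b ≤ 1 → |k a b - k a m - k m b| ≤ C * (b - a) ^ β)
    (hk0 : ∀ a, 0 ≤ a → a ≤ 1 → k a a = 0) (N : ℕ) :
    ∀ x : ℕ → ℝ, Monotone x → 0 ≤ x 0 → x N ≤ 1 →
      |k (x 0) (x N) - ∑ i ∈ Finset.range N, k (x i) (x (i + 1))| ≤
        2 * C / (1 - 2 * 2 ^ (-β)) * (x N - x 0) ^ β := by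
  have hC : 0 ≤ C := by
    simpa using (abs_nonneg _).trans (hk 0 0 1 le_rfl le_rfl zero_le_one le_rfl)
  have hθ := two_mul_two_rpow_neg_lt_one hβ
  set A := 2 * C / (1 - 2 * 2 ^ (-β)) with hA
  have hA0 : 0 ≤ A := div_nonneg (by linarith) (by linarith)
  -- `A` is the fixed point of the recursion for the constant: two parts of at most half the length,
  -- plus two uses of the defect bound.
  have hAe : A * (2 * 2 ^ (-β)) + 2 * C = A := by
    have : A * (1 - 2 * 2 ^ (-β)) = 2 * C := div_mul_cancel₀ _ (by linarith)
    linarith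
  induction N using Nat.strong_induction_on with
  | _ N ih =>
    intro x hx h0 h1
    rcases N with _ | N
    · simp [hk0 _ h0 h1, Real.zero_rpow (by linarith : β ≠ 0)]
    have hle : x 0 ≤ x (N + 1) := hx (Nat.zero_le _)
    set L := x (N + 1) - x 0 with hL
    -- The cell that straddles the midpoint is isolated; the partitions to its left and right have
    -- length at most `L / 2` and fewer cells.
    obtain ⟨i, j, rfl, hi, hj⟩ := exists_le_mid_le (x := x) (c := x 0 + L / 2) (N := N)
      (by linarith) (by linarith)
    have hi1 : x i ≤ x (i + 1) := hx (Nat.le_succ _)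
    have hi2 : x (i + 1) ≤ x (i + j + 1) := hx (by omega)
    have hi0 : x 0 ≤ x i := hx (Nat.zero_le _)
    have e1 := ih i (by omega) x hx h0 (by linarith)
    have e2 := ih j (by omega) (fun l => x (i + 1 + l)) (fun a b hab => hx (by omega))
      (by simp only [Nat.add_zero]; linarith)
      (by rw [show i + 1 + j = i + j + 1 by omega]; exact h1)
    simp only [Nat.add_zero, show i + 1 + j = i + j + 1 by omega] at e2
    have hs : ∑ l ∈ Finset.range (i + j + 1), k (x l) (x (l + 1)) =
        ∑ l ∈ Finset.range i, k (x l) (x (l + 1)) + k (x i) (x (i + 1)) +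
          ∑ l ∈ Finset.range j, k (x (i + 1 + l)) (x (i + 1 + (l + 1))) := by
      rw [show i + j + 1 = (i + 1) + j by omega, Finset.sum_range_add, Finset.sum_range_succ]
      rfl
    have hh : ∀ y : ℝ, 0 ≤ y → y ≤ L / 2 → y ^ β ≤ 2 ^ (-β) * L ^ β := fun y hy hyL => by
      rw [← div_two_rpow (by linarith)]
      exact Real.rpow_le_rpow hy hyL (by linarith)
    have e3 : |k (x 0) (x (i + j + 1)) - k (x 0) (x i) - k (x i) (x (i + j + 1))| ≤ C * L ^ β :=
      hk _ _ _ h0 hi0 (by linarith) h1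
    have e4 : |k (x i) (x (i + j + 1)) - k (x i) (x (i + 1)) - k (x (i + 1)) (x (i + j + 1))| ≤
        C * L ^ β :=
      (hk _ _ _ (by linarith) hi1 hi2 h1).trans (mul_le_mul_of_nonneg_left
        (Real.rpow_le_rpow (by linarith) (by linarith) (by linarith)) hC)
    have e1' := e1.trans (mul_le_mul_of_nonneg_left (hh _ (by linarith) (by linarith)) hA0)
    have e2' := e2.trans (mul_le_mul_of_nonneg_left (hh _ (by linarith) (by linarith)) hA0)
    rw [hs]
    have hAe' : A * L ^ β = A * (2 ^ (-β) * L ^ β) + A * (2 ^ (-β) * L ^ β) + C * L ^ β +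
        C * L ^ β := by
      calc A * L ^ β = (A * (2 * 2 ^ (-β)) + 2 * C) * L ^ β := by rw [hAe]
        _ = _ := by ring
    rw [hAe']
    rw [abs_le] at e1' e2' e3 e4 ⊢
    constructor <;> linarith [e1'.1, e1'.2, e2'.1, e2'.2, e3.1, e3.2, e4.1, e4.2]

/-- An almost additive function of intervals has a primitive. -/
theorem exists_primitive (hβ : 1 < β)
    (hk : ∀ a m b, 0 ≤ a → a ≤ m → m ≤ b → b ≤ 1 → |k a b - k a m - k m b| ≤ C * (b - a) ^ β)
    (hk0 : ∀ a, 0 ≤ a → a ≤ 1 → k a a = 0) :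
    ∃ F : ℝ → ℝ, ∀ s t, 0 ≤ s → s ≤ t → t ≤ 1 →
      |F t - F s - k s t| ≤ 2 * C / (1 - 2 * 2 ^ (-β)) * (t - s) ^ β := by
  have hC : 0 ≤ C := by
    simpa using (abs_nonneg _).trans (hk 0 0 1 le_rfl le_rfl zero_le_one le_rfl)
  set A := 2 * C / (1 - 2 * 2 ^ (-β)) with hA
  let x : ℕ → ℕ → ℝ := fun n i => i / 2 ^ n
  have hx : ∀ n, Monotone (x n) := fun n i j hij => by
    simp only [x]; gcongr
  have hx0 : ∀ n, x n 0 = 0 := fun n => by simp [x]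
  have hx1 : ∀ n, x n (2 ^ n) = 1 := fun n => by simp [x]
  have hxs : ∀ n i, x n (i + 1) = x n i + 1 / 2 ^ n := fun n i => by
    simp only [x]; push_cast; ring
  -- Sum of `k` over the dyadic partition of `[0, t]`, truncated at `t`. The difference `G n t - G n
  -- s` is the corresponding sum over `[s, t]`, except for the cell that contains `s`.
  let G : ℕ → ℝ → ℝ := fun n t =>
    ∑ i ∈ Finset.range (2 ^ n), k (min (x n i) t) (min (x n (i + 1)) t)
  have hGb : ∀ t, 0 ≤ t → t ≤ 1 → ∀ n, |k 0 t - G n t| ≤ A * t ^ β := by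
    intro t ht0 ht1 n
    have := abs_sub_sum_partition_le hβ hk hk0 (2 ^ n) (fun i => min (x n i) t)
      (fun i j hij => min_le_min_right _ (hx n hij)) (by simp [hx0, ht0]) (by simp [ht1])
    simpa [hx0, hx1, ht0, ht1, G] using this
  have hGd : ∀ s t, 0 ≤ s → s ≤ t → t ≤ 1 → ∀ n,
      |G n t - G n s - k s t| ≤ A * (t - s) ^ β + 2 ^ n * (C * (1 / 2 ^ n) ^ β) := by
    intro s t hs hst ht n
    have h1 := abs_sub_sum_partition_le hβ hk hk0 (2 ^ n) (fun i => max s (min (x n i) t))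
      (fun i j hij => max_le_max_left _ (min_le_min_right _ (hx n hij)))
      (le_max_of_le_left hs) (by simp [ht, hst.trans ht])
    simp only [hx0, hx1, min_eq_left (hs.trans hst), max_eq_left hs, min_eq_right ht,
      max_eq_right hst] at h1
    have h2 : |G n t - G n s - ∑ i ∈ Finset.range (2 ^ n),
        k (max s (min (x n i) t)) (max s (min (x n (i + 1)) t))| ≤
        2 ^ n * (C * (1 / 2 ^ n) ^ β) := by
      simp only [G, ← Finset.sum_sub_distrib]
      refine (Finset.abs_sum_le_sum_abs _ _).trans ?_
      refine (Finset.sum_le_card_nsmul _ _ (C * (1 / 2 ^ n) ^ β) fun i hi => ?_).trans (by simp)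
      -- Cells on one side of `s` contribute zero, and a cell around `s` contributes one defect.
      -- Bounding every cell by that defect is wasteful but enough, since `2 ^ n * (2 ^ n) ^ (-β)`
      -- tends to zero.
      have hpos : 0 ≤ C * (1 / 2 ^ n) ^ β := by positivity
      have hi0 : 0 ≤ x n i := by simp only [x]; positivity
      have hii : x n i ≤ x n (i + 1) := hx n (Nat.le_succ i)
      rcases le_total (x n (i + 1)) s with h | h
      · have h' := hii.trans h
        rw [min_eq_left (h'.trans hst), min_eq_left (h.trans hst), min_eq_left h, min_eq_left h',
          max_eq_left h, max_eq_left h', hk0 s hs (hst.trans ht)]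
        simpa using hpos
      · rcases le_total s (x n i) with h' | h'
        · rw [min_eq_right h, min_eq_right h', hk0 s hs (hst.trans ht),
            max_eq_right (le_min h' hst), max_eq_right (le_min h hst)]
          simpa using hpos
        · rw [min_eq_right h, min_eq_left h', min_eq_left (h'.trans hst), max_eq_left h',
            max_eq_right (le_min h hst)]
          refine (hk _ _ _ hi0 h' (le_min h hst) (min_le_of_right_le ht)).trans
            (mul_le_mul_of_nonneg_left (Real.rpow_le_rpow ?_ ?_ (by linarith)) hC)
          · exact sub_nonneg.2 (h'.trans (le_min h hst))
          · have := min_le_left (x n (i + 1)) t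
            linarith [hxs n i]
    rw [abs_le] at h1 h2 ⊢
    constructor <;> linarith [h1.1, h1.2, h2.1, h2.2]
  -- Boundedness suffices for a limit along an ultrafilter; convergence of the dyadic sums is not
  -- needed.
  have hlim : ∀ t, 0 ≤ t → t ≤ 1 → ∃ l, Tendsto (fun n => G n t) (hyperfilter ℕ) (𝓝 l) := by
    intro t ht0 ht1
    obtain ⟨l, -, hl⟩ := (isCompact_Icc (a := k 0 t - A * t ^ β)
      (b := k 0 t + A * t ^ β)).ultrafilter_le_nhds ((hyperfilter ℕ).map fun n => G n t) (by
        rw [le_principal_iff]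
        refine Filter.mem_map.2 (Filter.univ_mem' fun n => ?_)
        have := abs_le.1 (hGb t ht0 ht1 n)
        exact ⟨by linarith [this.2], by linarith [this.1]⟩)
    exact ⟨l, hl⟩
  choose! F hF using hlim
  refine ⟨F, fun s t hs hst ht => ?_⟩
  have h1 : Tendsto (fun n => |G n t - G n s - k s t|) (hyperfilter ℕ) (𝓝 |F t - F s - k s t|) :=
    (((hF t (hs.trans hst) ht).sub (hF s hs (hst.trans ht))).sub_const _).abs
  have h2 : Tendsto (fun n : ℕ => A * (t - s) ^ β + 2 ^ n * (C * (1 / 2 ^ n) ^ β)) atTop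
      (𝓝 (A * (t - s) ^ β + C * 0)) := by
    refine tendsto_const_nhds.add ?_
    have h3 : ∀ n : ℕ, (2 : ℝ) ^ n * (C * (1 / 2 ^ n) ^ β) = C * (2 * 2 ^ (-β)) ^ n := by
      intro n
      rw [Real.div_rpow zero_le_one (by positivity), Real.one_rpow, mul_pow,
        ← Real.rpow_natCast (2 ^ (-β)) n, ← Real.rpow_natCast 2 n,
        ← Real.rpow_mul (by norm_num), ← Real.rpow_mul (by norm_num),
        one_div, ← Real.rpow_neg (by norm_num)]
      ring_nf
    simp only [h3]
    exact (tendsto_pow_atTop_nhds_zero_of_lt_one (by positivity)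
      (two_mul_two_rpow_neg_lt_one hβ)).const_mul C
  rw [mul_zero, add_zero] at h2
  exact le_of_tendsto_of_tendsto' h1 (h2.mono_left Nat.hyperfilter_le_atTop)
    fun n => hGd s t hs hst ht n

theorem contracts_halves (hβ : 1 < β) {c : ℝ} (hc : 0 ≤ c) :
    Contracts (X := ℝ × ℝ) (ι := Bool)
      (fun i x => if i then (x.1, (x.1 + x.2) / 2) else ((x.1 + x.2) / 2, x.2))
      (fun x => 0 ≤ x.1 ∧ x.1 ≤ x.2 ∧ x.2 ≤ 1) (fun x => c * (x.2 - x.1) ^ β) (2 ^ (-β)) where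
  map_mem i x hx := by
    obtain ⟨h1, h2, h3⟩ := hx
    cases i <;> refine ⟨?_, ?_, ?_⟩ <;> simp <;> linarith
  nonneg x hx := mul_nonneg hc (Real.rpow_nonneg (by linarith [hx.2.1]) _)
  factor_nonneg := by positivity
  factor_lt := by simpa using two_mul_two_rpow_neg_lt_one hβ
  le i x hx := by
    rw [mul_left_comm, ← div_two_rpow (by linarith [hx.2.1])]
    cases i <;> simp <;> apply le_of_eq <;> ring_nf

/-- A function of intervals which is almost additive, and additive with respect to midpoints, is
additive. -/
theorem additive_of_midpoint (hβ : 1 < β)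
    (hk : ∀ a m b, 0 ≤ a → a ≤ m → m ≤ b → b ≤ 1 → |k a b - k a m - k m b| ≤ C * (b - a) ^ β)
    (hm : ∀ a b, 0 ≤ a → a ≤ b → b ≤ 1 → k a b = k a ((a + b) / 2) + k ((a + b) / 2) b)
    {a m b : ℝ} (ha : 0 ≤ a) (ham : a ≤ m) (hmb : m ≤ b) (hb : b ≤ 1) :
    k a b = k a m + k m b := by
  have hC : 0 ≤ C := by
    simpa using (abs_nonneg _).trans (hk 0 0 1 le_rfl le_rfl zero_le_one le_rfl)
  have hk0 : ∀ a, 0 ≤ a → a ≤ 1 → k a a = 0 := fun a h0 h1 => by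
    have := hm a a h0 le_rfl h1
    rw [add_self_div_two] at this
    linarith
  obtain ⟨F, hF⟩ := exists_primitive hβ hk hk0
  have hθ := two_mul_two_rpow_neg_lt_one hβ
  -- The difference of the two sides is exactly midpoint additive and of order `β > 1`, so it
  -- vanishes by contraction.
  have key : ∀ s t, 0 ≤ s → s ≤ t → t ≤ 1 → k s t = F t - F s := by
    intro s t hs hst ht
    have := (contracts_halves hβ (c := 2 * C / (1 - 2 * 2 ^ (-β)))
      (div_nonneg (by linarith) (by linarith))).eq_zero
      (E := fun x => F x.2 - F x.1 - k x.1 x.2) (fun x hx => by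
        refine le_trans (le_of_eq ?_) (Finset.abs_sum_le_sum_abs _ _)
        congr 1
        simp only [Fintype.sum_bool, if_true, Bool.false_eq_true, if_false]
        rw [hm x.1 x.2 hx.1 hx.2.1 hx.2.2]
        ring) (fun x hx => hF x.1 x.2 hx.1 hx.2.1 hx.2.2) (x := (s, t)) ⟨hs, hst, ht⟩
    simp only at this
    linarith
  rw [key a b ha (ham.trans hmb) hb, key a m ha ham (hmb.trans hb), key m b (ha.trans ham) hmb hb]
  ring

end OneDim

end RoughForms

namespace RoughForms

/-! ### Midpoint-additive functions of triangles: antisymmetry and parallelograms. -/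

section Planar

variable {V : Type*} [NormedAddCommGroup V] [NormedSpace ℝ V]

/-- The exterior derivative of a function of triangles, on a tetrahedron. -/
def dTri (Ω : V → V → V → ℝ) (x y z t : V) : ℝ := Ω y z t - Ω x z t + Ω x y t - Ω x y z

/-- The four triangles into which a triangle is divided by the midpoints of its sides. -/
noncomputable def triChild (i : Fin 4) (x : V × V × V) : V × V × V :=
  ![(x.1, midpoint ℝ x.1 x.2.1, midpoint ℝ x.1 x.2.2),
    (midpoint ℝ x.1 x.2.1, x.2.1, midpoint ℝ x.2.1 x.2.2),
    (midpoint ℝ x.1 x.2.2, midpoint ℝ x.2.1 x.2.2, x.2.2),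
    (midpoint ℝ x.2.1 x.2.2, midpoint ℝ x.1 x.2.2, midpoint ℝ x.1 x.2.1)] i

theorem midpoint_eq_half_smul (x y : V) : midpoint ℝ x y = (2⁻¹ : ℝ) • (x + y) := by
  rw [midpoint_eq_smul_add, invOf_eq_inv]

theorem norm_half_smul (v : V) : ‖(2⁻¹ : ℝ) • v‖ = ‖v‖ / 2 := by
  rw [norm_smul]; norm_num; ring

/-- The sum of the two sides of a triangle at its base point. -/
noncomputable def triSize (x : V × V × V) : ℝ := ‖x.2.1 - x.1‖ + ‖x.2.2 - x.1‖

omit [NormedSpace ℝ V] in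
theorem triSize_nonneg (x : V × V × V) : 0 ≤ triSize x := by unfold triSize; positivity

theorem triSize_triChild (i : Fin 4) (x : V × V × V) : triSize (triChild i x) = triSize x / 2 := by
  obtain ⟨p, q, r⟩ := x
  have key : ∀ a b a' b' : V, a = (2⁻¹ : ℝ) • a' → b = (2⁻¹ : ℝ) • b' →
      ‖a‖ + ‖b‖ = (‖a'‖ + ‖b'‖) / 2 := by
    rintro a b a' b' rfl rfl
    rw [norm_half_smul, norm_half_smul]; ring
  fin_cases i
  · exact key _ _ _ _ (by simp [triChild, midpoint_eq_half_smul]; module)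
      (by simp [triChild, midpoint_eq_half_smul]; module)
  · exact key _ _ _ _ (by simp [triChild, midpoint_eq_half_smul]; module)
      (by simp [triChild, midpoint_eq_half_smul]; module)
  · refine key _ _ _ _ (by simp [triChild, midpoint_eq_half_smul]; module)
      (by simp [triChild, midpoint_eq_half_smul]; module)
  · simp only [triSize]
    rw [← norm_neg (q - p), ← norm_neg (r - p)]
    exact key _ _ _ _ (by simp [triChild, midpoint_eq_half_smul]; module)
      (by simp [triChild, midpoint_eq_half_smul]; module)

theorem contracts_triChild {P : V × V × V → Prop} (hP : ∀ i x, P x → P (triChild i x)) {γ c : ℝ}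
    (hγ : 2 < γ) (hc : 0 ≤ c) :
    Contracts triChild P (fun x => c * triSize x ^ γ) (2 ^ (-γ)) where
  map_mem := hP
  nonneg x _ := mul_nonneg hc (Real.rpow_nonneg (triSize_nonneg x) _)
  factor_nonneg := by positivity
  factor_lt := by simpa using four_mul_two_rpow_neg_lt_one hγ
  le i x _ := by
    rw [mul_left_comm, ← div_two_rpow (triSize_nonneg x), triSize_triChild]

theorem midpoint_mem_of_convex {K : Set V} (hK : Convex ℝ K) {x y : V} (hx : x ∈ K) (hy : y ∈ K) :
    midpoint ℝ x y ∈ K := by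
  rw [midpoint_eq_half_smul, smul_add]
  exact hK hx hy (by norm_num) (by norm_num) (by norm_num)

theorem triChild_mem_of_convex {K : Set V} (hK : Convex ℝ K) (i : Fin 4) {x : V × V × V}
    (hx : x.1 ∈ K ∧ x.2.1 ∈ K ∧ x.2.2 ∈ K) :
    (triChild i x).1 ∈ K ∧ (triChild i x).2.1 ∈ K ∧ (triChild i x).2.2 ∈ K := by
  obtain ⟨h1, h2, h3⟩ := hx
  have h12 := midpoint_mem_of_convex hK h1 h2
  have h13 := midpoint_mem_of_convex hK h1 h3
  have h23 := midpoint_mem_of_convex hK h2 h3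
  fin_cases i
  exacts [⟨h1, h12, h13⟩, ⟨h12, h2, h23⟩, ⟨h13, h23, h3⟩, ⟨h23, h13, h12⟩]

/-- A function of triangles in a convex set which vanishes on degenerate triangles, is additive
under subdivision by midpoints, and is almost closed. -/
structure MidpointSewn (K : Set V) (Ω : V → V → V → ℝ) (C γ : ℝ) : Prop where
  convex : Convex ℝ K
  lt : 2 < γ
  nonneg : 0 ≤ C
  degenerate : ∀ x ∈ K, ∀ y ∈ K, ∀ z ∈ K, Collinear ℝ {x, y, z} → Ω x y z = 0
  split : ∀ p ∈ K, ∀ q ∈ K, ∀ r ∈ K,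
    Ω p q r = Ω p (midpoint ℝ p q) (midpoint ℝ p r) + Ω (midpoint ℝ p q) q (midpoint ℝ q r) +
      Ω (midpoint ℝ p r) (midpoint ℝ q r) r +
      Ω (midpoint ℝ q r) (midpoint ℝ p r) (midpoint ℝ p q)
  near : ∀ x ∈ K, ∀ y ∈ K, ∀ z ∈ K, ∀ t ∈ K, ∀ L, ‖y - x‖ ≤ L → ‖z - x‖ ≤ L → ‖t - x‖ ≤ L →
    |dTri Ω x y z t| ≤ C * L ^ γ

theorem collinear_smul (x e : V) (a b c : ℝ) :
    Collinear ℝ {x + a • e, x + b • e, x + c • e} := by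
  rw [collinear_iff_exists_forall_eq_smul_vadd]
  refine ⟨x, e, ?_⟩
  rintro p (rfl | rfl | rfl)
  exacts [⟨a, add_comm _ _⟩, ⟨b, add_comm _ _⟩, ⟨c, add_comm _ _⟩]

namespace MidpointSewn

variable {K : Set V} {Ω : V → V → V → ℝ} {C γ : ℝ} (h : MidpointSewn K Ω C γ)

include h

theorem eq_left {x y : V} (hx : x ∈ K) (hy : y ∈ K) : Ω x x y = 0 :=
  h.degenerate x hx x hx y hy (by simpa using collinear_pair ℝ x y)

theorem eq_right {x y : V} (hx : x ∈ K) (hy : y ∈ K) : Ω x y y = 0 :=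
  h.degenerate x hx y hy y hy (by simpa using collinear_pair ℝ x y)

theorem eq_outer {x y : V} (hx : x ∈ K) (hy : y ∈ K) : Ω x y x = 0 :=
  h.degenerate x hx y hy x hx (by
    rw [Set.insert_comm]; simpa using collinear_pair ℝ y x)

theorem line {p q r : V} (x e : V) (a b c : ℝ) (hp : p = x + a • e) (hq : q = x + b • e)
    (hr : r = x + c • e) (hpK : p ∈ K) (hqK : q ∈ K) (hrK : r ∈ K) : Ω p q r = 0 :=
  h.degenerate p hpK q hqK r hrK (by subst hp hq hr; exact collinear_smul x e a b c)

theorem contracts : Contracts triChild (fun x : V × V × V => x.1 ∈ K ∧ x.2.1 ∈ K ∧ x.2.2 ∈ K)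
    (fun x => C * triSize x ^ γ) (2 ^ (-γ)) :=
  contracts_triChild (fun i _ hx => triChild_mem_of_convex h.convex i hx) h.lt h.nonneg

/-- The sum of the two values is additive over the quarters, because quartering commutes with
relabelling, and it is the defect on the degenerate tetrahedron `[p q p r]`, hence of order `γ > 2`.
-/
theorem swap_left {p q r : V} (hp : p ∈ K) (hq : q ∈ K) (hr : r ∈ K) : Ω q p r = -Ω p q r := by
  have := h.contracts.eq_zero (E := fun x => Ω x.2.1 x.1 x.2.2 + Ω x.1 x.2.1 x.2.2)
    (fun ⟨p, q, r⟩ ⟨hp, hq, hr⟩ => by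
      refine le_trans (le_of_eq ?_) (Finset.abs_sum_le_sum_abs _ _)
      congr 1
      simp only [Fin.sum_univ_four]
      simp only [triChild, Matrix.cons_val]
      rw [h.split p hp q hq r hr, h.split q hq p hp r hr, midpoint_comm q p]
      ring)
    (fun ⟨p, q, r⟩ ⟨hp, hq, hr⟩ => by
      have h1 := h.near p hp q hq p hp r hr (triSize (p, q, r))
        (le_add_of_nonneg_right (norm_nonneg _)) (by simpa using triSize_nonneg (p, q, r))
        (le_add_of_nonneg_left (norm_nonneg _))
      rw [dTri, h.eq_left hp hr, h.eq_outer hp hq] at h1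
      simpa using h1) (x := (p, q, r)) ⟨hp, hq, hr⟩
  simp only at this
  linarith

theorem swap_right {p q r : V} (hp : p ∈ K) (hq : q ∈ K) (hr : r ∈ K) : Ω p r q = -Ω p q r := by
  have := h.contracts.eq_zero (E := fun x => Ω x.1 x.2.2 x.2.1 + Ω x.1 x.2.1 x.2.2)
    (fun ⟨p, q, r⟩ ⟨hp, hq, hr⟩ => by
      refine le_trans (le_of_eq ?_) (Finset.abs_sum_le_sum_abs _ _)
      congr 1
      simp only [Fin.sum_univ_four]
      simp only [triChild, Matrix.cons_val]
      rw [h.split p hp q hq r hr, h.split p hp r hr q hq, midpoint_comm r q]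
      ring)
    (fun ⟨p, q, r⟩ ⟨hp, hq, hr⟩ => by
      have h1 := h.near p hp q hq r hr q hq (triSize (p, q, r))
        (le_add_of_nonneg_right (norm_nonneg _)) (le_add_of_nonneg_left (norm_nonneg _))
        (le_add_of_nonneg_right (norm_nonneg _))
      rw [dTri, h.eq_right hp hq, h.eq_outer hq hr] at h1
      rw [← abs_neg]
      convert h1 using 2
      ring) (x := (p, q, r)) ⟨hp, hq, hr⟩
  simp only at this
  linarith

end MidpointSewn

/-- The value on the triangle `[x, x + u, x + u + e]`. -/
def tri (Ω : V → V → V → ℝ) (x u e : V) : ℝ := Ω x (x + u) (x + u + e)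

/-- The value on the parallelogram with vertex `x` and sides `u`, `e`. -/
def par (Ω : V → V → V → ℝ) (x u e : V) : ℝ :=
  Ω x (x + u) (x + u + e) + Ω x (x + u + e) (x + e)

/-- The parallelogram with vertex `x` and sides `u`, `l • e` is contained in `K`. -/
def ParIn (K : Set V) (x u e : V) (l : ℝ) : Prop :=
  ∀ a b : ℝ, 0 ≤ a → a ≤ 1 → 0 ≤ b → b ≤ l → x + a • u + b • e ∈ K

/-- The triangle `[x, x + u, x + u + e]` is contained in `K`. -/
def TriIn (K : Set V) (x u e : V) : Prop :=
  ∀ a b : ℝ, a ≤ 1 → 0 ≤ b → b ≤ a → x + a • u + b • e ∈ K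

namespace MidpointSewn

variable {K : Set V} {Ω : V → V → V → ℝ} {C γ : ℝ} (h : MidpointSewn K Ω C γ)

include h

theorem par_swap {x u e : V} (hP : ParIn K x u e 1) : par Ω x e u = -par Ω x u e := by
  have h0 : x ∈ K := by simpa using hP 0 0 (by simp) (by simp) (by simp) (by simp)
  have h1 : x + u ∈ K := by simpa using hP 1 0 (by simp) (by simp) (by simp) (by simp)
  have h2 : x + e ∈ K := by simpa using hP 0 1 (by simp) (by simp) (by simp) (by simp)
  have h3 : x + u + e ∈ K := by simpa using hP 1 1 (by simp) (by simp) (by simp) (by simp)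
  rw [par, par, add_right_comm x e u, h.swap_right h0 h3 h2, h.swap_right h0 h1 h3]
  ring

theorem par_eq_tri {x u e : V} (hP : ParIn K x u e 1) :
    par Ω x u e = tri Ω x u e - tri Ω x e u := by
  have h0 : x ∈ K := by simpa using hP 0 0 (by simp) (by simp) (by simp) (by simp)
  have h2 : x + e ∈ K := by simpa using hP 0 1 (by simp) (by simp) (by simp) (by simp)
  have h3 : x + u + e ∈ K := by simpa using hP 1 1 (by simp) (by simp) (by simp) (by simp)
  rw [par, tri, tri, add_right_comm x e u, h.swap_right h0 h3 h2]
  ring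

/-- The corner quarters at the first and last vertex are translated halves of the triangle; the
other two quarters form a parallelogram. -/
theorem tri_split {x u e : V} (hP : TriIn K x u e) :
    tri Ω x u e = tri Ω x ((2⁻¹ : ℝ) • u) ((2⁻¹ : ℝ) • e) +
      tri Ω (x + (2⁻¹ : ℝ) • u + (2⁻¹ : ℝ) • e) ((2⁻¹ : ℝ) • u) ((2⁻¹ : ℝ) • e) +
      par Ω (x + (2⁻¹ : ℝ) • u) ((2⁻¹ : ℝ) • u) ((2⁻¹ : ℝ) • e) := by
  have h0 : x ∈ K := by simpa using hP 0 0 (by simp) (by simp) (by simp)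
  have h1 : x + u ∈ K := by simpa using hP 1 0 (by simp) (by simp) (by simp)
  have h2 : x + u + e ∈ K := by simpa using hP 1 1 (by simp) (by simp) (by simp)
  have c1 : x + (2⁻¹ : ℝ) • u ∈ K := by
    simpa using hP 2⁻¹ 0 (by norm_num) (by norm_num) (by norm_num)
  have c2 : x + (2⁻¹ : ℝ) • u + (2⁻¹ : ℝ) • e ∈ K := hP 2⁻¹ 2⁻¹ (by norm_num) (by norm_num) le_rfl
  have c3 : x + u + (2⁻¹ : ℝ) • e ∈ K := by
    simpa using hP 1 2⁻¹ (by norm_num) (by norm_num) (by norm_num)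
  have m1 : midpoint ℝ x (x + u) = x + (2⁻¹ : ℝ) • u := by rw [midpoint_eq_half_smul]; module
  have m2 : midpoint ℝ x (x + u + e) = x + (2⁻¹ : ℝ) • u + (2⁻¹ : ℝ) • e := by
    rw [midpoint_eq_half_smul]; module
  have m3 : midpoint ℝ (x + u) (x + u + e) = x + u + (2⁻¹ : ℝ) • e := by
    rw [midpoint_eq_half_smul]; module
  have s := h.split x h0 _ h1 _ h2
  rw [m1, m2, m3, h.swap_left c2 c3 c1, h.swap_right c2 c1 c3, h.swap_left c1 c2 c3,
    h.swap_right c1 c3 c2] at s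
  rw [tri, tri, tri, par,
    show x + (2⁻¹ : ℝ) • u + (2⁻¹ : ℝ) • u = x + u by module,
    show x + (2⁻¹ : ℝ) • u + (2⁻¹ : ℝ) • e + (2⁻¹ : ℝ) • u = x + u + (2⁻¹ : ℝ) • e by module,
    show x + u + (2⁻¹ : ℝ) • e + (2⁻¹ : ℝ) • e = x + u + e by module, s]
  ring

end MidpointSewn

theorem ParIn.sub {K : Set V} {x u e : V} {l : ℝ} (hP : ParIn K x u e l) {a b c d l' : ℝ}
    (ha : 0 ≤ a) (hc : 0 ≤ c) (hac : a + c ≤ 1) (hb : 0 ≤ b) (hd : 0 ≤ d)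
    (hbd : b + d * l' ≤ l) :
    ParIn K (x + a • u + b • e) (c • u) (d • e) l' := by
  intro s t hs hs1 ht htl
  have := hP (a + s * c) (b + t * d) (by positivity) (by nlinarith) (by positivity) (by nlinarith)
  convert this using 1
  module

theorem ParIn.tri {K : Set V} {x u e : V} (hP : ParIn K x u e 1) : TriIn K x u e :=
  fun a b ha hb hba => hP a b (hb.trans hba) ha hb (hba.trans ha)

theorem ParIn.symm {K : Set V} {x u e : V} (hP : ParIn K x u e 1) : ParIn K x e u 1 := by
  intro a b ha ha1 hb hb1
  rw [add_right_comm]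
  exact hP b a hb hb1 ha ha1

namespace MidpointSewn

variable {K : Set V} {Ω : V → V → V → ℝ} {C γ : ℝ} (h : MidpointSewn K Ω C γ)

include h

theorem par_split {x u e : V} (hP : ParIn K x u e 1) :
    par Ω x u e = par Ω x ((2⁻¹ : ℝ) • u) ((2⁻¹ : ℝ) • e) +
      par Ω (x + (2⁻¹ : ℝ) • u) ((2⁻¹ : ℝ) • u) ((2⁻¹ : ℝ) • e) +
      par Ω (x + (2⁻¹ : ℝ) • e) ((2⁻¹ : ℝ) • u) ((2⁻¹ : ℝ) • e) +
      par Ω (x + (2⁻¹ : ℝ) • u + (2⁻¹ : ℝ) • e) ((2⁻¹ : ℝ) • u) ((2⁻¹ : ℝ) • e) := by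
  have hs : ∀ a b : ℝ, 0 ≤ a → a ≤ 2⁻¹ → 0 ≤ b → b ≤ 2⁻¹ →
      ParIn K (x + a • u + b • e) ((2⁻¹ : ℝ) • u) ((2⁻¹ : ℝ) • e) 1 := fun a b ha ha' hb hb' =>
    hP.sub ha (by norm_num) (by linarith) hb (by norm_num) (by linarith)
  have s1 := hs 0 0 (by norm_num) (by norm_num) (by norm_num) (by norm_num)
  have s2 := hs 0 2⁻¹ (by norm_num) (by norm_num) (by norm_num) le_rfl
  have s3 := hs 2⁻¹ 2⁻¹ (by norm_num) le_rfl (by norm_num) le_rfl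
  simp only [zero_smul, add_zero] at s1 s2
  rw [h.par_eq_tri hP, h.tri_split hP.tri, h.tri_split hP.symm.tri, h.par_eq_tri s1,
    h.par_eq_tri s3, h.par_swap s2, add_right_comm x ((2⁻¹ : ℝ) • e) ((2⁻¹ : ℝ) • u)]
  ring

theorem near_base {x y z t : V} {L : ℝ} (hx : x ∈ K) (hy : x + y ∈ K) (hz : x + z ∈ K)
    (ht : x + t ∈ K) (hyL : ‖y‖ ≤ L) (hzL : ‖z‖ ≤ L) (htL : ‖t‖ ≤ L) :
    |dTri Ω x (x + y) (x + z) (x + t)| ≤ C * L ^ γ :=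
  h.near x hx _ hy _ hz _ ht L (by simpa) (by simpa) (by simpa)

/-- The two triangulations of the parallelogram differ by three flat tetrahedra and by triangles on
its sides, where `Ω` vanishes. -/
theorem abs_par_sub_le {x u e : V} {s t : ℝ} (hs : 0 ≤ s) (ht : 0 ≤ t)
    (hP : ParIn K x u e (s + t)) :
    |par Ω x u ((s + t) • e) - par Ω x u (s • e) - par Ω (x + s • e) u (t • e)| ≤
      3 * C * (‖u‖ + (s + t) * ‖e‖) ^ γ := by
  have hst : 0 ≤ s + t := add_nonneg hs ht
  have h0 : x ∈ K := by simpa using hP 0 0 le_rfl zero_le_one le_rfl hst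
  have hu : x + u ∈ K := by simpa using hP 1 0 zero_le_one le_rfl le_rfl hst
  have hs' : x + s • e ∈ K := by simpa using hP 0 s le_rfl zero_le_one hs (by linarith)
  have he : x + (s + t) • e ∈ K := by
    simpa only [zero_smul, add_zero] using hP 0 (s + t) le_rfl zero_le_one hst le_rfl
  have hus : x + (u + s • e) ∈ K := by
    simpa [add_assoc] using hP 1 s zero_le_one le_rfl hs (by linarith)
  have hue : x + (u + (s + t) • e) ∈ K := by
    simpa only [one_smul, add_assoc] using hP 1 (s + t) zero_le_one le_rfl hst le_rfl
  have nn : ∀ b : ℝ, 0 ≤ b → b ≤ s + t → ‖b • e‖ ≤ ‖u‖ + (s + t) * ‖e‖ := fun b hb hb' => by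
    rw [norm_smul, Real.norm_of_nonneg hb]
    nlinarith [norm_nonneg u, norm_nonneg e]
  have nu : ∀ b : ℝ, 0 ≤ b → b ≤ s + t → ‖u + b • e‖ ≤ ‖u‖ + (s + t) * ‖e‖ := fun b hb hb' => by
    refine (norm_add_le _ _).trans ?_
    rw [norm_smul, Real.norm_of_nonneg hb]
    nlinarith [norm_nonneg u, norm_nonneg e]
  have nu0 : ‖u‖ ≤ ‖u‖ + (s + t) * ‖e‖ := by simpa using nu 0 le_rfl hst
  have d1 := h.near_base h0 hs' hus hue (nn s hs (by linarith)) (nu s hs (by linarith))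
    (nu _ hst le_rfl)
  have d2 := h.near_base h0 hs' hue he (nn s hs (by linarith)) (nu _ hst le_rfl) (nn _ hst le_rfl)
  have d3 := h.near_base h0 hu hus hue nu0 (nu s hs (by linarith)) (nu _ hst le_rfl)
  have z1 : Ω x (x + s • e) (x + (s + t) • e) = 0 :=
    h.line x e 0 s (s + t) (by simp) rfl rfl h0 hs' he
  have z2 : Ω (x + u) (x + (u + s • e)) (x + (u + (s + t) • e)) = 0 :=
    h.line (x + u) e 0 s (s + t) (by simp) (by module) (by module) hu hus hue
  have z3 := h.swap_right h0 hs' hus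
  simp only [dTri] at d1 d2 d3
  have hp : par Ω (x + s • e) u (t • e) = Ω (x + s • e) (x + (u + s • e)) (x + (u + (s + t) • e)) +
      Ω (x + s • e) (x + (u + (s + t) • e)) (x + (s + t) • e) := by
    rw [par, show x + s • e + u = x + (u + s • e) by module,
      show x + (u + s • e) + t • e = x + (u + (s + t) • e) by module,
      show x + s • e + t • e = x + (s + t) • e by module]
  rw [hp, par, par, add_assoc x u, add_assoc x u]
  rw [abs_le] at d1 d2 d3 ⊢
  constructor <;> linarith [d1.1, d1.2, d2.1, d2.2, d3.1, d3.2]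

/-- By `par_split`, the defect of a halving is the sum of the defects of the four half-size
parallelograms; it is also of order `γ > 2`. -/
theorem par_half_right {x u e : V} (hP : ParIn K x u e 1) :
    par Ω x u e = par Ω x u ((2⁻¹ : ℝ) • e) +
      par Ω (x + (2⁻¹ : ℝ) • e) u ((2⁻¹ : ℝ) • e) := by
  let T : Bool × Bool → V × V × V → V × V × V := fun i x =>
    (x.1 + (if i.1 then (2⁻¹ : ℝ) else 0) • x.2.1 + (if i.2 then (2⁻¹ : ℝ) else 0) • x.2.2,
      (2⁻¹ : ℝ) • x.2.1, (2⁻¹ : ℝ) • x.2.2)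
  have hT : Contracts T (fun x => ParIn K x.1 x.2.1 x.2.2 1)
      (fun x => 3 * C * (‖x.2.1‖ + ‖x.2.2‖) ^ γ) (2 ^ (-γ)) := by
    refine ⟨fun i x hx => ?_, fun x hx => ?_, by positivity, ?_, fun i x hx => ?_⟩
    · refine hx.sub ?_ (by norm_num) ?_ ?_ (by norm_num) ?_ <;> split_ifs <;>
        norm_num
    · have := h.nonneg
      positivity
    · have := four_mul_two_rpow_neg_lt_one h.lt
      norm_num
      linarith
    · rw [mul_left_comm, ← div_two_rpow (by positivity)]
      simp only [T, norm_half_smul]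
      rw [add_div]
  have := hT.eq_zero (E := fun x => par Ω x.1 x.2.1 x.2.2 - par Ω x.1 x.2.1 ((2⁻¹ : ℝ) • x.2.2) -
      par Ω (x.1 + (2⁻¹ : ℝ) • x.2.2) x.2.1 ((2⁻¹ : ℝ) • x.2.2))
    (fun ⟨x, u, e⟩ hx => by
      simp only at hx
      refine le_trans (le_of_eq ?_) (Finset.abs_sum_le_sum_abs _ _)
      congr 1
      have p1 : ParIn K x u ((2⁻¹ : ℝ) • e) 1 := by
        simpa using hx.sub (a := 0) (b := 0) (c := 1) (d := 2⁻¹) (l' := 1) le_rfl (by norm_num)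
          (by norm_num) le_rfl (by norm_num) (by norm_num)
      have p2 : ParIn K (x + (2⁻¹ : ℝ) • e) u ((2⁻¹ : ℝ) • e) 1 := by
        simpa using hx.sub (a := 0) (b := 2⁻¹) (c := 1) (d := 2⁻¹) (l' := 1) le_rfl (by norm_num)
          (by norm_num) (by norm_num) (by norm_num) (by norm_num)
      simp only [Fintype.sum_prod_type, Fintype.sum_bool, T, if_true, Bool.false_eq_true, if_false,
        zero_smul, add_zero]
      rw [h.par_split hx, h.par_split p1, h.par_split p2]
      simp only [add_right_comm _ ((2⁻¹ : ℝ) • e) ((2⁻¹ : ℝ) • u)]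
      ring)
    (fun ⟨x, u, e⟩ hx => by
      have := h.abs_par_sub_le (x := x) (u := u) (e := e) (s := 2⁻¹) (t := 2⁻¹) (by norm_num)
        (by norm_num) (by norm_num; exact hx)
      norm_num at this
      norm_num
      exact this) (x := (x, u, e)) hP
  simp only at this
  linarith

theorem par_half_left {x u e : V} (hP : ParIn K x u e 1) :
    par Ω x u e = par Ω x ((2⁻¹ : ℝ) • u) e + par Ω (x + (2⁻¹ : ℝ) • u) ((2⁻¹ : ℝ) • u) e := by
  have p1 : ParIn K x ((2⁻¹ : ℝ) • u) e 1 := by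
    simpa using hP.sub (a := 0) (b := 0) (c := 2⁻¹) (d := 1) (l' := 1) le_rfl (by norm_num)
      (by norm_num) le_rfl (by norm_num) (by norm_num)
  have p2 : ParIn K (x + (2⁻¹ : ℝ) • u) ((2⁻¹ : ℝ) • u) e 1 := by
    simpa using hP.sub (a := 2⁻¹) (b := 0) (c := 2⁻¹) (d := 1) (l' := 1) (by norm_num)
      (by norm_num) (by norm_num) (by norm_num) (by norm_num) (by norm_num)
  rw [← neg_inj, ← h.par_swap hP, h.par_half_right hP.symm, h.par_swap p1, h.par_swap p2]
  ring

end MidpointSewn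

end Planar

end RoughForms

namespace RoughForms

/-! ### From midpoint additivity to additivity for arbitrary cuts. -/

section Planar

variable {V : Type*} [NormedAddCommGroup V] [NormedSpace ℝ V]

theorem ParIn.mono {K : Set V} {x u e : V} {l l' : ℝ} (hP : ParIn K x u e l) (hl : l' ≤ l) :
    ParIn K x u e l' := fun a b ha ha1 hb hb1 => hP a b ha ha1 hb (hb1.trans hl)

theorem ParIn.shift {K : Set V} {x u e : V} {l : ℝ} (hP : ParIn K x u e l) {b l' : ℝ}
    (hb : 0 ≤ b) (hbl : b + l' ≤ l) : ParIn K (x + b • e) u e l' := by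
  simpa using hP.sub (a := 0) (b := b) (c := 1) (d := 1) (l' := l') le_rfl zero_le_one (by simp) hb
    zero_le_one (by simpa)

theorem ParIn.smul {K : Set V} {x u e : V} {l : ℝ} (hP : ParIn K x u e l) (hl : 0 ≤ l) :
    ParIn K x u (l • e) 1 := by
  simpa using hP.sub (a := 0) (b := 0) (c := 1) (d := l) (l' := 1) le_rfl zero_le_one (by simp)
    le_rfl hl (by simp)

theorem ParIn.left {K : Set V} {x u e : V} {l : ℝ} (hP : ParIn K x u e l) :
    ParIn K x ((2⁻¹ : ℝ) • u) e l := by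
  simpa using hP.sub (a := 0) (b := 0) (c := 2⁻¹) (d := 1) (l' := l) le_rfl (by norm_num)
    (by norm_num) le_rfl zero_le_one (by simp)

theorem ParIn.right {K : Set V} {x u e : V} {l : ℝ} (hP : ParIn K x u e l) :
    ParIn K (x + (2⁻¹ : ℝ) • u) ((2⁻¹ : ℝ) • u) e l := by
  simpa using hP.sub (a := 2⁻¹) (b := 0) (c := 2⁻¹) (d := 1) (l' := l) (by norm_num) (by norm_num)
    (by norm_num) le_rfl zero_le_one (by simp)

namespace MidpointSewn

variable {K : Set V} {Ω : V → V → V → ℝ} {C γ : ℝ} (h : MidpointSewn K Ω C γ)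

include h

/-- Before the defect is estimated, the side `u` is cut into `2 ^ n` equal parts, which is exact by
`par_half_left`. The freedom in `n` allows the parts to be as narrow as the divided side is short.
-/
theorem abs_par_sub_le_pow {e : V} {s t : ℝ} (hs : 0 ≤ s) (ht : 0 ≤ t) (n : ℕ) :
    ∀ x u : V, ParIn K x u e (s + t) →
    |par Ω x u ((s + t) • e) - par Ω x u (s • e) - par Ω (x + s • e) u (t • e)| ≤
      2 ^ n * (3 * C * (‖u‖ / 2 ^ n + (s + t) * ‖e‖) ^ γ) := by
  induction n with
  | zero => intro x u hP; simpa using h.abs_par_sub_le hs ht hP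
  | succ n ih =>
    intro x u hP
    have i1 := ih _ _ hP.left
    have i2 := ih _ _ hP.right
    rw [add_right_comm x ((2⁻¹ : ℝ) • u)] at i2
    rw [norm_half_smul, div_div, ← pow_succ'] at i1 i2
    rw [h.par_half_left (hP.smul (add_nonneg hs ht)),
      h.par_half_left ((hP.mono (by linarith)).smul hs),
      h.par_half_left ((hP.shift hs le_rfl).smul ht), pow_succ, mul_comm _ (2 : ℝ), mul_assoc,
      two_mul]
    rw [← pow_succ'] at *
    rw [abs_le] at i1 i2 ⊢
    constructor <;> linarith [i1.1, i1.2, i2.1, i2.2]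

theorem par_zero {x u e : V} {l : ℝ} (hl : 0 ≤ l) (hP : ParIn K x u e l) : par Ω x u 0 = 0 := by
  have h0 : x ∈ K := by simpa using hP 0 0 le_rfl zero_le_one le_rfl hl
  have hu : x + u ∈ K := by simpa using hP 1 0 zero_le_one le_rfl le_rfl hl
  rw [par, add_zero, add_zero, h.eq_right h0 hu, h.eq_outer h0 hu, add_zero]

/-- Additivity of the values on parallelograms with respect to a division of a side. -/
theorem par_add {x u e : V} {s t : ℝ} (hs : 0 ≤ s) (ht : 0 ≤ t) (hP : ParIn K x u e (s + t)) :
    par Ω x u ((s + t) • e) = par Ω x u (s • e) + par Ω (x + s • e) u (t • e) := by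
  have hl0 : 0 ≤ s + t := add_nonneg hs ht
  obtain ⟨l, hl⟩ : ∃ l, s + t = l := ⟨_, rfl⟩
  rw [hl] at hP hl0
  have hγ := h.lt
  have hC := h.nonneg
  -- The strip between the heights `l * a` and `l * b`, as a function of the interval `[a, b]` in
  -- `[0, 1]`. It will be almost additive with exponent `γ - 1 > 1`.
  let k : ℝ → ℝ → ℝ := fun a b => par Ω (x + (l * a) • e) u ((l * (b - a)) • e)
  have hsub : ∀ a b, 0 ≤ a → b ≤ 1 → ParIn K (x + (l * a) • e) u e (l * (b - a)) :=
    fun a b ha hb => hP.shift (by positivity) (by nlinarith)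
  have hk : ∀ a m b, 0 ≤ a → a ≤ m → m ≤ b → b ≤ 1 → |k a b - k a m - k m b| ≤
      3 * C * (2 * ‖u‖ + l * ‖e‖) ^ γ * (b - a) ^ (γ - 1) := by
    intro a m b ha ham hmb hb
    have e1 : l * (m - a) + l * (b - m) = l * (b - a) := by ring
    have e2 : x + (l * a) • e + (l * (m - a)) • e = x + (l * m) • e := by module
    have key := fun n => h.abs_par_sub_le_pow (e := e) (s := l * (m - a)) (t := l * (b - m))
      (mul_nonneg hl0 (by linarith)) (mul_nonneg hl0 (by linarith)) n (x + (l * a) • e) u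
      (by rw [e1]; exact hsub a b ha hb)
    simp only [e1, e2] at key
    rcases (ham.trans hmb).eq_or_lt with hab | hab
    · obtain rfl : a = b := hab
      obtain rfl : a = m := le_antisymm ham hmb
      simp only [k, sub_self, mul_zero, zero_smul]
      rw [h.par_zero (by simp) (hsub a a ha hb), Real.zero_rpow (by linarith)]
      simp
    · obtain ⟨n, hn1, hn2⟩ := exists_nat_pow_near_of_lt_one (sub_pos.2 hab) (by linarith : b - a ≤ 1)
        (by norm_num : (0 : ℝ) < 2⁻¹) (by norm_num)
      have hτ : 0 < b - a := sub_pos.2 hab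
      have hn3 : 1 / (2 : ℝ) ^ n ≤ 2 * (b - a) := by
        rw [pow_succ, inv_pow] at hn1
        rw [one_div]
        linarith
      have hn4 : (2 : ℝ) ^ n ≤ (b - a)⁻¹ := by
        rw [inv_pow] at hn2
        exact (le_inv_comm₀ hτ (by positivity)).1 hn2
      refine (key n).trans ?_
      have h1 : ‖u‖ / 2 ^ n + l * (b - a) * ‖e‖ ≤ (2 * ‖u‖ + l * ‖e‖) * (b - a) := by
        have : ‖u‖ * (1 / 2 ^ n) ≤ ‖u‖ * (2 * (b - a)) := by gcongr
        rw [mul_one_div] at this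
        linarith
      calc 2 ^ n * (3 * C * (‖u‖ / 2 ^ n + l * (b - a) * ‖e‖) ^ γ)
          ≤ (b - a)⁻¹ * (3 * C * ((2 * ‖u‖ + l * ‖e‖) * (b - a)) ^ γ) := by gcongr
        _ = _ := by
          rw [Real.mul_rpow (by positivity) hτ.le, Real.rpow_sub_one hτ.ne']
          ring
  have hm : ∀ a b, 0 ≤ a → a ≤ b → b ≤ 1 → k a b = k a ((a + b) / 2) + k ((a + b) / 2) b := by
    intro a b ha hab hb
    have := h.par_half_right ((hsub a b ha hb).smul (mul_nonneg hl0 (by linarith)))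
    simp only [k]
    rw [this, smul_smul, show x + (l * a) • e + ((2⁻¹ : ℝ) * (l * (b - a))) • e =
      x + (l * ((a + b) / 2)) • e by module,
      show (2⁻¹ : ℝ) * (l * (b - a)) = l * ((a + b) / 2 - a) by ring,
      show l * (b - (a + b) / 2) = l * ((a + b) / 2 - a) by ring]
  -- If `l = 0` then `s = 0`, and the convention for division by zero gives the right value.
  have hls : l * (s / l) = s := by
    rcases hl0.eq_or_lt with h0 | h0
    · rw [← h0]; linarith
    · field_simp
  have := additive_of_midpoint (by linarith : 1 < γ - 1) hk hm (a := 0) (m := s / l) (b := 1) le_rfl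
    (div_nonneg hs hl0) (div_le_one_of_le₀ (by linarith) hl0) le_rfl
  simp only [k, mul_zero, zero_smul, add_zero, sub_zero, mul_one, hls] at this
  rw [hl, this, show l * (1 - s / l) = t by rw [mul_sub, hls]; linarith]

end MidpointSewn

/-- The trapezoid with vertices `y`, `y + v`, `y + v + (κ + l) • e`, `y + κ • e` is contained
in `K`. -/
def TrapIn (K : Set V) (κ l : ℝ) (y v e : V) : Prop :=
  ∀ a b : ℝ, 0 ≤ a → a ≤ 1 → 0 ≤ b → b ≤ κ + l * a → y + a • v + b • e ∈ K

/-- The difference of the values on a trapezoid which come from its two decompositions into a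
triangle and a parallelogram. -/
def shear (Ω : V → V → V → ℝ) (κ l : ℝ) (y v e : V) : ℝ :=
  tri Ω y v (l • e) + par Ω y (v + l • e) (κ • e) - par Ω y v (κ • e) -
    tri Ω (y + κ • e) v (l • e)

theorem TrapIn.par {K : Set V} {κ l : ℝ} {y v e : V} (hP : TrapIn K κ l y v e) (hl : 0 ≤ l) :
    ParIn K y v e κ := fun a b ha ha1 hb hbκ => hP a b ha ha1 hb (by nlinarith)

theorem TrapIn.par_shear {K : Set V} {κ l : ℝ} {y v e : V} (hP : TrapIn K κ l y v e) (hl : 0 ≤ l) :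
    ParIn K y (v + l • e) e κ := fun a b ha ha1 hb hbκ => by
  have := hP a (b + l * a) ha ha1 (by positivity) (by linarith)
  convert this using 1
  module

theorem TrapIn.tri {K : Set V} {κ l : ℝ} {y v e : V} (hP : TrapIn K κ l y v e) (hκ : 0 ≤ κ)
    (hl : 0 ≤ l) : TriIn K y v (l • e) := fun a b ha hb hba => by
  have := hP a (b * l) (hb.trans hba) ha (by positivity) (by nlinarith)
  convert this using 1
  module

theorem TrapIn.tri_shift {K : Set V} {κ l : ℝ} {y v e : V} (hP : TrapIn K κ l y v e) (hκ : 0 ≤ κ)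
    (hl : 0 ≤ l) : TriIn K (y + κ • e) v (l • e) := fun a b ha hb hba => by
  have := hP a (κ + b * l) (hb.trans hba) ha (by positivity) (by nlinarith)
  convert this using 1
  module

theorem TrapIn.par_half {K : Set V} {κ l : ℝ} {y v e : V} (hP : TrapIn K κ l y v e) (hl : 0 ≤ l) :
    ParIn K (y + (2⁻¹ : ℝ) • v) ((2⁻¹ : ℝ) • v) e (κ + l * 2⁻¹) := fun a b ha ha1 hb hbκ => by
  have := hP (2⁻¹ + 2⁻¹ * a) b (by positivity) (by linarith) hb (by nlinarith)
  convert this using 1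
  module

/-- The four trapezoids of half the size into which a trapezoid is divided, up to triangles and
parallelograms. -/
noncomputable def trapChild (κ l : ℝ) (i : Bool × Bool) (x : V × V × V) : V × V × V :=
  (x.1 + (if i.1 then (2⁻¹ : ℝ) else 0) • (x.2.1 + l • x.2.2) +
    (if i.2 then 2⁻¹ * κ else 0) • x.2.2, (2⁻¹ : ℝ) • x.2.1, (2⁻¹ : ℝ) • x.2.2)

theorem TrapIn.child {K : Set V} {κ l : ℝ} {x : V × V × V} (hP : TrapIn K κ l x.1 x.2.1 x.2.2)
    (hκ : 0 ≤ κ) (hl : 0 ≤ l) (i : Bool × Bool) :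
    TrapIn K κ l (trapChild κ l i x).1 (trapChild κ l i x).2.1 (trapChild κ l i x).2.2 := by
  intro a b ha ha1 hb hbl
  obtain ⟨c, hc, hc0, hc1⟩ : ∃ c : ℝ, (if i.1 then (2⁻¹ : ℝ) else 0) = c ∧ 0 ≤ c ∧ c ≤ 2⁻¹ :=
    ⟨_, rfl, by split_ifs <;> norm_num, by split_ifs <;> norm_num⟩
  obtain ⟨d, hd, hd0, hd1⟩ : ∃ d : ℝ, (if i.2 then 2⁻¹ * κ else 0) = d ∧ 0 ≤ d ∧ d ≤ 2⁻¹ * κ :=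
    ⟨_, rfl, by split_ifs <;> positivity, by split_ifs <;> linarith⟩
  have := hP (c + a * 2⁻¹) (c * l + d + b * 2⁻¹) (by positivity) (by linarith) (by positivity)
    (by nlinarith)
  convert this using 1
  simp only [trapChild, hc, hd]
  module

namespace MidpointSewn

variable {K : Set V} {Ω : V → V → V → ℝ} {C γ : ℝ} (h : MidpointSewn K Ω C γ)

include h

theorem par_halves {x u e : V} {κ : ℝ} (hκ : 0 ≤ κ) (hP : ParIn K x u e κ) :
    par Ω x u (κ • e) = par Ω x u (κ • (2⁻¹ : ℝ) • e) +
      par Ω (x + (2⁻¹ * κ) • e) u (κ • (2⁻¹ : ℝ) • e) := by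
  have := h.par_add (s := 2⁻¹ * κ) (t := 2⁻¹ * κ) (by positivity) (by positivity)
    (hP.mono (by linarith))
  rw [show 2⁻¹ * κ + 2⁻¹ * κ = κ by ring] at this
  rw [this, show κ • (2⁻¹ : ℝ) • e = (2⁻¹ * κ) • e by module]

/-- Quartering the triangles and halving the parallelograms leaves a strip of height `κ + l / 2`
over the second half of `v`. Dividing it by `par_add` in the two orders `l / 2, κ` and `κ, l / 2`
makes all terms outside the four children cancel. -/
theorem shear_split {κ l : ℝ} (hκ : 0 ≤ κ) (hl : 0 ≤ l) {y v e : V} (hP : TrapIn K κ l y v e) :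
    shear Ω κ l y v e = ∑ i, shear Ω κ l (trapChild κ l i (y, v, e)).1
      (trapChild κ l i (y, v, e)).2.1 (trapChild κ l i (y, v, e)).2.2 := by
  have hP1 : ParIn K y v e κ := hP.par hl
  have hP2 := hP.par_shear hl
  have hP3 := hP.par_half hl
  have t1 := h.tri_split (hP.tri hκ hl)
  have t2 := h.tri_split (hP.tri_shift hκ hl)
  have p1 := h.par_half_left (hP1.smul hκ)
  have p2 := h.par_half_left (hP2.smul hκ)
  have p3 := h.par_add (s := l * 2⁻¹) (t := κ) (by positivity) hκ (hP3.mono (by linarith))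
  have p4 := h.par_add (s := κ) (t := l * 2⁻¹) hκ (by positivity) hP3
  rw [add_comm κ (l * 2⁻¹), p3] at p4
  have q1 := h.par_halves hκ hP1.left
  have q2 := h.par_halves hκ hP2.left
  have q3 := h.par_halves hκ (hP3.shift (b := l * 2⁻¹) (l' := κ) (by positivity) (by linarith))
  have q4 := h.par_halves hκ hP2.right
  have a1 : (2⁻¹ : ℝ) • l • e = l • (2⁻¹ : ℝ) • e := smul_comm _ _ _
  have a2 : (l * 2⁻¹) • e = l • (2⁻¹ : ℝ) • e := mul_smul _ _ _
  have a3 : (2⁻¹ * κ) • e = κ • (2⁻¹ : ℝ) • e := by module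
  simp only [smul_add, a1, a2, a3] at t1 t2 p1 p2 p3 p4 q1 q2 q3 q4
  have b1 : y + (2⁻¹ : ℝ) • v + κ • e = y + κ • e + (2⁻¹ : ℝ) • v := add_right_comm _ _ _
  have b2 : ∀ z : V, z + κ • (2⁻¹ : ℝ) • e + κ • (2⁻¹ : ℝ) • e = z + κ • e := fun z => by module
  have b3 : y + κ • e + (2⁻¹ : ℝ) • v + l • (2⁻¹ : ℝ) • e =
      y + (2⁻¹ : ℝ) • v + l • (2⁻¹ : ℝ) • e + κ • e := by module
  simp only [b1, b3, ← add_assoc] at t1 t2 p1 p2 p3 p4 q1 q2 q3 q4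
  simp only [Fintype.sum_prod_type, Fintype.sum_bool, shear, trapChild, if_true,
    Bool.false_eq_true, if_false, zero_smul, add_zero, smul_add, a1, a3, b2, ← add_assoc]
  linarith

/-- The two triangulations of the trapezoid differ by three flat tetrahedra; `κ + l ≤ 1` keeps all
edges from `y` below `‖v‖ + ‖e‖`. -/
theorem abs_shear_le {κ l : ℝ} (hκ : 0 ≤ κ) (hl : 0 ≤ l) (hκl : κ + l ≤ 1) {y v e : V}
    (hP : TrapIn K κ l y v e) : |shear Ω κ l y v e| ≤ 3 * C * (‖v‖ + ‖e‖) ^ γ := by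
  have m0 : y ∈ K := by simpa using hP 0 0 le_rfl zero_le_one le_rfl (by simpa)
  have mv : ∀ b, 0 ≤ b → b ≤ κ + l → y + (v + b • e) ∈ K := fun b hb hb' => by
    simpa [add_assoc] using hP 1 b zero_le_one le_rfl hb (by simpa)
  have mκ : y + κ • e ∈ K := by simpa using hP 0 κ le_rfl zero_le_one hκ (by simp)
  have nv : ∀ b, 0 ≤ b → b ≤ κ + l → ‖v + b • e‖ ≤ ‖v‖ + ‖e‖ := fun b hb hb' => by
    refine (norm_add_le _ _).trans ?_
    rw [norm_smul, Real.norm_of_nonneg hb]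
    nlinarith [norm_nonneg e]
  have nκ : ‖κ • e‖ ≤ ‖v‖ + ‖e‖ := by
    rw [norm_smul, Real.norm_of_nonneg hκ]
    nlinarith [norm_nonneg e, norm_nonneg v]
  have z0 : 0 ≤ κ + l := by linarith
  have d1 := h.near_base m0 mκ (mv κ hκ (by linarith)) (mv _ z0 le_rfl) nκ (nv κ hκ (by linarith))
    (nv _ z0 le_rfl)
  have d2 := h.near_base m0 (mv 0 le_rfl z0) (mv l hl (by linarith)) (mv _ z0 le_rfl)
    (nv 0 le_rfl z0) (nv l hl (by linarith)) (nv _ z0 le_rfl)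
  have d3 := h.near_base m0 (mv 0 le_rfl z0) (mv κ hκ (by linarith)) (mv _ z0 le_rfl)
    (nv 0 le_rfl z0) (nv κ hκ (by linarith)) (nv _ z0 le_rfl)
  have e2 := h.line (y + v) e 0 l (κ + l) (by module) (by module) (by module)
    (mv 0 le_rfl z0) (mv l hl (by linarith)) (mv _ z0 le_rfl)
  have e3 := h.line (y + v) e 0 κ (κ + l) (by module) (by module) (by module)
    (mv 0 le_rfl z0) (mv κ hκ (by linarith)) (mv _ z0 le_rfl)
  have s1 := h.swap_right m0 mκ (mv _ z0 le_rfl)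
  have s2 := h.swap_right m0 mκ (mv κ hκ (by linarith))
  simp only [dTri] at d1 d2 d3
  simp only [zero_smul, add_zero] at d1 d2 d3 e2 e3
  rw [shear, tri, tri, par, par, show y + v + l • e = y + (v + l • e) by module,
    show y + (v + l • e) + κ • e = y + (v + (κ + l) • e) by module,
    show y + v + κ • e = y + (v + κ • e) by module,
    show y + κ • e + v = y + (v + κ • e) by module,
    show y + (v + κ • e) + l • e = y + (v + (κ + l) • e) by module]
  rw [abs_le] at d1 d2 d3 ⊢
  constructor <;> linarith [d1.1, d1.2, d2.1, d2.2, d3.1, d3.2]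

theorem shear_eq_zero {κ l : ℝ} (hκ : 0 ≤ κ) (hl : 0 ≤ l) (hκl : κ + l ≤ 1) {y v e : V}
    (hP : TrapIn K κ l y v e) : shear Ω κ l y v e = 0 := by
  have hT : Contracts (trapChild κ l) (fun x : V × V × V => TrapIn K κ l x.1 x.2.1 x.2.2)
      (fun x => 3 * C * (‖x.2.1‖ + ‖x.2.2‖) ^ γ) (2 ^ (-γ)) := by
    refine ⟨fun i x hx => hx.child hκ hl i, fun x hx => ?_, by positivity, ?_, fun i x hx => ?_⟩
    · have := h.nonneg
      positivity
    · have := four_mul_two_rpow_neg_lt_one h.lt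
      norm_num
      linarith
    · rw [mul_left_comm, ← div_two_rpow (by positivity)]
      simp only [trapChild, norm_half_smul]
      rw [add_div]
  exact hT.eq_zero (E := fun x => shear Ω κ l x.1 x.2.1 x.2.2)
    (fun x hx => (le_of_eq (congrArg abs (h.shear_split hκ hl hx))).trans
      (Finset.abs_sum_le_sum_abs _ _))
    (fun x hx => h.abs_shear_le hκ hl hκl hx) (x := (y, v, e)) hP

/-- Additivity of the values on triangles with respect to a division of the side opposite to the
first vertex. -/
theorem tri_add {s t : ℝ} (hs : 0 ≤ s) (ht : 0 ≤ t) (hst : s + t = 1) {p u e : V}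
    (hP : TriIn K p u e) : tri Ω p u e = tri Ω p u (s • e) + tri Ω p (u + s • e) (t • e) := by
  let T : Bool → V × V × V → V × V × V := fun i x =>
    (x.1 + (if i then (2⁻¹ : ℝ) else 0) • (x.2.1 + x.2.2), (2⁻¹ : ℝ) • x.2.1, (2⁻¹ : ℝ) • x.2.2)
  have hγ := h.lt
  have hT : Contracts T (fun x => TriIn K x.1 x.2.1 x.2.2)
      (fun x => C * (‖x.2.1‖ + ‖x.2.2‖) ^ γ) (2 ^ (-γ)) := by
    refine ⟨fun i x hx => ?_, fun x hx => ?_, by positivity, ?_, fun i x hx => ?_⟩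
    · intro a b ha hb hba
      obtain ⟨c, hc, hc0, hc1⟩ : ∃ c : ℝ, (if i then (2⁻¹ : ℝ) else 0) = c ∧ 0 ≤ c ∧ c ≤ 2⁻¹ :=
        ⟨_, rfl, by split_ifs <;> norm_num, by split_ifs <;> norm_num⟩
      have := hx (c + a * 2⁻¹) (c + b * 2⁻¹) (by linarith) (by positivity) (by linarith)
      convert this using 1
      simp only [T, hc]
      module
    · have := h.nonneg
      positivity
    · have := two_mul_two_rpow_neg_lt_one (by linarith : 1 < γ)
      simpa
    · rw [mul_left_comm, ← div_two_rpow (by positivity)]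
      simp only [T, norm_half_smul]
      rw [add_div]
  -- The defect reproduces itself on two half-size triangles only. The middle parallelograms, which
  -- do not match directly, are reconciled by `par_add` and by one vanishing shear with `κ = t`, `l
  -- = s`.
  have hsplit : ∀ p u e : V, TriIn K p u e →
      tri Ω p u e - tri Ω p u (s • e) - tri Ω p (u + s • e) (t • e) =
      ∑ i, (tri Ω (T i (p, u, e)).1 (T i (p, u, e)).2.1 (T i (p, u, e)).2.2 -
        tri Ω (T i (p, u, e)).1 (T i (p, u, e)).2.1 (s • (T i (p, u, e)).2.2) -
        tri Ω (T i (p, u, e)).1 ((T i (p, u, e)).2.1 + s • (T i (p, u, e)).2.2)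
          (t • (T i (p, u, e)).2.2)) := by
    intro p u e hP
    have t0 := h.tri_split hP
    have t1 := h.tri_split (x := p) (u := u) (e := s • e) (fun a b ha hb hba => by
      have := hP a (b * s) ha (by positivity) (by nlinarith)
      convert this using 1
      module)
    have t2 := h.tri_split (x := p) (u := u + s • e) (e := t • e) (fun a b ha hb hba => by
      have := hP a (a * s + b * t) ha (by have := hb.trans hba; positivity) (by
        have := hb.trans hba
        nlinarith)
      convert this using 1
      module)
    have p1 := h.par_add (x := p + (2⁻¹ : ℝ) • u) (u := (2⁻¹ : ℝ) • u) (e := (2⁻¹ : ℝ) • e) hs ht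
      (fun a b ha ha1 hb hbl => by
        have := hP (2⁻¹ + a * 2⁻¹) (b * 2⁻¹) (by linarith) (by positivity) (by linarith)
        convert this using 1
        module)
    have z := h.shear_eq_zero ht hs (by linarith) (y := p + (2⁻¹ : ℝ) • u + (2⁻¹ : ℝ) • s • e)
      (v := (2⁻¹ : ℝ) • u) (e := (2⁻¹ : ℝ) • e) (fun a b ha ha1 hb hbl => by
        have := hP (2⁻¹ + a * 2⁻¹) (2⁻¹ * s + b * 2⁻¹) (by linarith) (by positivity) (by nlinarith)
        convert this using 1
        module)
    rw [hst, one_smul] at p1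
    rw [shear] at z
    have a1 : (2⁻¹ : ℝ) • s • e = s • (2⁻¹ : ℝ) • e := smul_comm _ _ _
    have a2 : (2⁻¹ : ℝ) • t • e = t • (2⁻¹ : ℝ) • e := smul_comm _ _ _
    have a3 : s • (2⁻¹ : ℝ) • e + t • (2⁻¹ : ℝ) • e = (2⁻¹ : ℝ) • e := by
      rw [← add_smul, hst, one_smul]
    simp only [smul_add, a1, a2] at t0 t1 t2 p1 z
    have b1 : p + ((2⁻¹ : ℝ) • u + s • (2⁻¹ : ℝ) • e) + t • (2⁻¹ : ℝ) • e =
        p + (2⁻¹ : ℝ) • u + (2⁻¹ : ℝ) • e := by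
      rw [add_assoc, add_assoc, a3, ← add_assoc]
    have b2 : p + (2⁻¹ : ℝ) • u + s • (2⁻¹ : ℝ) • e + t • (2⁻¹ : ℝ) • e =
        p + (2⁻¹ : ℝ) • u + (2⁻¹ : ℝ) • e := by
      rw [add_assoc, a3]
    rw [b1, ← add_assoc p] at t2
    rw [b2] at z
    simp only [Fintype.sum_bool, T, if_true, Bool.false_eq_true, if_false, zero_smul, add_zero,
      smul_add, ← add_assoc]
    linarith
  have := hT.eq_zero (E := fun x => tri Ω x.1 x.2.1 x.2.2 - tri Ω x.1 x.2.1 (s • x.2.2) -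
      tri Ω x.1 (x.2.1 + s • x.2.2) (t • x.2.2))
    (fun x hx => (le_of_eq (congrArg abs (hsplit _ _ _ hx))).trans
      (Finset.abs_sum_le_sum_abs _ _))
    (fun ⟨p, u, e⟩ hx => by
      have m0 : p ∈ K := by simpa using hx 0 0 zero_le_one le_rfl le_rfl
      have mb : ∀ b : ℝ, 0 ≤ b → b ≤ 1 → p + (u + b • e) ∈ K := fun b hb hb' => by
        simpa [add_assoc] using hx 1 b le_rfl hb (by simpa)
      have nb : ∀ b : ℝ, 0 ≤ b → b ≤ 1 → ‖u + b • e‖ ≤ ‖u‖ + ‖e‖ := fun b hb hb' => by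
        refine (norm_add_le _ _).trans ?_
        rw [norm_smul, Real.norm_of_nonneg hb]
        nlinarith [norm_nonneg e]
      have hs1 : s ≤ 1 := by linarith
      have d := h.near_base m0 (mb 0 le_rfl zero_le_one) (mb s hs hs1) (mb 1 zero_le_one le_rfl)
        (nb 0 le_rfl zero_le_one) (nb s hs hs1) (nb 1 zero_le_one le_rfl)
      have z := h.line (p + u) e 0 s 1 (by module) (by module) (by module)
        (mb 0 le_rfl zero_le_one) (mb s hs hs1) (mb 1 zero_le_one le_rfl)
      rw [dTri, z] at d
      simp only [zero_smul, add_zero, one_smul] at d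
      simp only [tri]
      rw [show p + (u + s • e) + t • e = p + (u + e) by
        rw [show p + (u + s • e) + t • e = p + (u + (s + t) • e) by module, hst, one_smul],
        add_assoc p u e, add_assoc p u]
      rw [← abs_neg] at d
      rw [← abs_neg]
      convert d using 2
      ring) (x := (p, u, e)) hP
  simp only at this
  linarith

end MidpointSewn

end Planar

end RoughForms

namespace RoughForms

/-! ### Closedness in the plane. -/

section Planar

variable {V : Type*} [NormedAddCommGroup V] [NormedSpace ℝ V]

omit [NormedAddCommGroup V] [NormedSpace ℝ V] in
-- This is `δ ∘ δ = 0` on the cone with apex `z`: closedness may be tested on tetrahedra with a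
-- conveniently chosen vertex.
theorem dTri_cocycle (Ω : V → V → V → ℝ) (z x₀ x₁ x₂ x₃ : V) :
    dTri Ω x₀ x₁ x₂ x₃ = dTri Ω z x₁ x₂ x₃ - dTri Ω z x₀ x₂ x₃ + dTri Ω z x₀ x₁ x₃ -
      dTri Ω z x₀ x₁ x₂ := by
  simp only [dTri]; ring

theorem _root_.Convex.three_mem {K : Set V} (hK : Convex ℝ K) {x y z : V} (hx : x ∈ K) (hy : y ∈ K)
    (hz : z ∈ K) {a b c : ℝ} (ha : 0 ≤ a) (hb : 0 ≤ b) (hc : 0 ≤ c) (habc : a + b + c = 1) :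
    a • x + b • y + c • z ∈ K := by
  have := hK.sum_mem (t := Finset.univ) (w := ![a, b, c]) (z := ![x, y, z])
    (by intro i _; fin_cases i <;> simpa) (by simpa [Fin.sum_univ_three] using habc)
    (by intro i _; fin_cases i <;> simpa)
  simpa [Fin.sum_univ_three] using this

theorem collinear_image {E : Type*} [AddCommGroup E] [Module ℝ E] {s : Set E}
    (hs : Collinear ℝ s) (A : E →ᵃ[ℝ] V) : Collinear ℝ (A '' s) := by
  obtain ⟨p, v, hv⟩ := (collinear_iff_exists_forall_eq_smul_vadd s).1 hs
  refine (collinear_iff_exists_forall_eq_smul_vadd _).2 ⟨A p, A.linear v, ?_⟩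
  rintro _ ⟨x, hx, rfl⟩
  obtain ⟨r, rfl⟩ := hv x hx
  exact ⟨r, by rw [AffineMap.map_vadd, map_smul]⟩

namespace MidpointSewn

variable {K : Set V} {Ω : V → V → V → ℝ} {C γ : ℝ} (h : MidpointSewn K Ω C γ)

include h

/-- The face `[a m b]` is degenerate, and the remaining identity is the division of `[p a b]` from
`p`, that is `tri_add`. -/
theorem dTri_of_wbtw {p a m b : V} (hp : p ∈ K) (ha : a ∈ K) (hb : b ∈ K) (hm : Wbtw ℝ a m b) :
    dTri Ω p a m b = 0 := by
  have hmK : m ∈ K := h.convex.segment_subset ha hb (mem_segment_iff_wbtw.2 hm)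
  have z := h.degenerate a ha m hmK b hb hm.collinear
  obtain ⟨t, ⟨ht0, ht1⟩, rfl⟩ := hm
  have key := h.tri_add ht0 (sub_nonneg.2 ht1) (by ring) (p := p) (u := a - p) (e := b - a)
    (fun s r hs hr hrs => by
      have := h.convex.three_mem hp ha hb (sub_nonneg.2 hs) (sub_nonneg.2 hrs) hr (by ring)
      convert this using 1
      module)
  simp only [tri, AffineMap.lineMap_apply_module'] at key z ⊢
  rw [show p + (a - p) = a by abel, show a + (b - a) = b by abel,
    show p + (a - p + t • (b - a)) = t • (b - a) + a by module,
    show a + t • (b - a) = t • (b - a) + a by module,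
    show t • (b - a) + a + (1 - t) • (b - a) = b by module] at key
  rw [dTri, z, key]
  ring

theorem dTri_of_collinear {p a b c : V} (hp : p ∈ K) (ha : a ∈ K) (hb : b ∈ K) (hc : c ∈ K)
    (hcol : Collinear ℝ {a, b, c}) : dTri Ω p a b c = 0 := by
  have z0 := h.degenerate a ha b hb c hc hcol
  have s1 := h.swap_right hp ha hb
  have s2 := h.swap_right hp ha hc
  have s3 := h.swap_right hp hb hc
  rcases hcol.wbtw_or_wbtw_or_wbtw with hw | hw | hw
  · exact h.dTri_of_wbtw hp ha hc hw
  · have z1 := h.degenerate b hb c hc a ha hw.collinear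
    have := h.dTri_of_wbtw hp hb ha hw
    simp only [dTri] at this ⊢
    linarith
  · have z1 := h.degenerate c hc a ha b hb hw.collinear
    have := h.dTri_of_wbtw hp hc hb hw
    simp only [dTri] at this ⊢
    linarith

theorem dTri_swap {p q a b : V} (hp : p ∈ K) (hq : q ∈ K) (ha : a ∈ K) (hb : b ∈ K) :
    dTri Ω q p a b = -dTri Ω p q a b := by
  have s1 := h.swap_left hp hq ha
  have s2 := h.swap_left hp hq hb
  simp only [dTri]
  linarith

/-- The ray from `a` through `y` meets `[b c]` in a point `z`. In the cone with apex `z`, each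
tetrahedron contains one of the collinear triples `z, b, c` and `z, y, a`. -/
theorem dTri_of_mem_convexHull {y a b c : V} (ha : a ∈ K) (hb : b ∈ K) (hc : c ∈ K)
    (hy : y ∈ convexHull ℝ {a, b, c}) : dTri Ω y a b c = 0 := by
  have hyK : y ∈ K := convexHull_min (by rintro x (rfl | rfl | rfl) <;> assumption) h.convex hy
  rw [convexHull_insert (Set.insert_nonempty _ _), mem_convexJoin, convexHull_pair] at hy
  obtain ⟨a', ha', z, hz, hyz⟩ := hy
  rw [Set.mem_singleton_iff] at ha'
  rw [ha'] at hyz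
  have hzK := h.convex.segment_subset hb hc hz
  have c1 : Collinear ℝ {z, b, c} := (Wbtw.collinear (mem_segment_iff_wbtw.1 hz)).subset (by
    intro x; simp only [Set.mem_insert_iff, Set.mem_singleton_iff]; tauto)
  have c2 : Collinear ℝ {z, y, a} := (Wbtw.collinear (mem_segment_iff_wbtw.1 hyz)).subset (by
    intro x; simp only [Set.mem_insert_iff, Set.mem_singleton_iff]; tauto)
  rw [dTri_cocycle Ω z]
  have e1 := h.dTri_swap hzK ha hb hc
  rw [h.dTri_of_collinear ha hzK hb hc c1] at e1
  have e2 := h.dTri_swap hzK hyK hb hc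
  rw [h.dTri_of_collinear hyK hzK hb hc c1] at e2
  have c3 : ∀ d ∈ K, dTri Ω z y a d = 0 := fun d hd => by
    have f1 := h.dTri_of_collinear hd hzK hyK ha c2
    have s1 := h.swap_left hzK hd hyK
    have s2 := h.swap_right hzK hyK hd
    have s3 := h.swap_left hyK hd ha
    have s4 := h.swap_right hyK ha hd
    have s5 := h.swap_left hzK hd ha
    have s6 := h.swap_right hzK ha hd
    simp only [dTri] at f1 ⊢
    linarith
  rw [c3 b hb, c3 c hc]
  linarith

/-- In a plane, a germ which is additive under subdivision by midpoints and almost closed is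
closed. -/
theorem dTri_eq_zero [FiniteDimensional ℝ V] (hV : Module.finrank ℝ V ≤ 2) {x : Fin 4 → V}
    (hx : ∀ i, x i ∈ K) : dTri Ω (x 0) (x 1) (x 2) (x 3) = 0 := by
  have hna : ¬ AffineIndependent ℝ x := fun hi => by
    have := hi.card_le_finrank_succ
    have h2 := Submodule.finrank_le (vectorSpan ℝ (Set.range x))
    simp only [Fintype.card_fin] at this
    omega
  obtain ⟨I, y, hy1, hy2⟩ := Convex.radon_partition hna
  have hyK : y ∈ K := convexHull_min (by rintro _ ⟨i, -, rfl⟩; exact hx i) h.convex hy1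
  -- The Radon point lies in the triangle opposite to any vertex `l`: it belongs to the hulls of
  -- both classes of the partition, and one class omits `l`.
  have key : ∀ l i j k : Fin 4, (∀ m, m = l ∨ m = i ∨ m = j ∨ m = k) →
      dTri Ω y (x i) (x j) (x k) = 0 := by
    intro l i j k hm
    have hsub : ∀ J : Set (Fin 4), l ∉ J → x '' J ⊆ {x i, x j, x k} := by
      rintro J hl _ ⟨m, hmJ, rfl⟩
      rcases hm m with rfl | rfl | rfl | rfl
      · exact absurd hmJ hl
      all_goals simp
    refine h.dTri_of_mem_convexHull (hx i) (hx j) (hx k) ?_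
    by_cases hl : l ∈ I
    · exact convexHull_mono (hsub Iᶜ (by simpa using hl)) hy2
    · exact convexHull_mono (hsub I hl) hy1
  rw [dTri_cocycle Ω y, key 0 1 2 3 (by decide), key 1 0 2 3 (by decide), key 2 0 1 3 (by decide),
    key 3 0 1 2 (by decide)]
  ring

/-- Affine maps preserve midpoints and collinearity, and scale lengths by a bounded factor. This
transfers the planar result to planes in higher dimension. -/
theorem comp {E : Type*} [NormedAddCommGroup E] [NormedSpace ℝ E] [FiniteDimensional ℝ E]
    (A : E →ᵃ[ℝ] V) :
    MidpointSewn (A ⁻¹' K) (fun x y z => Ω (A x) (A y) (A z))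
      (C * ‖LinearMap.toContinuousLinearMap A.linear‖ ^ γ) γ where
  convex := h.convex.affine_preimage A
  lt := h.lt
  nonneg := mul_nonneg h.nonneg (by positivity)
  degenerate x hx y hy z hz hcol := h.degenerate _ hx _ hy _ hz (by
    simpa [Set.image_insert_eq] using collinear_image hcol A)
  split p hp q hq r hr := by
    simp only [AffineMap.map_midpoint]
    exact h.split _ hp _ hq _ hr
  near x hx y hy z hz t ht L h1 h2 h3 := by
    have hL : 0 ≤ L := (norm_nonneg _).trans h1
    have hA : ∀ y, ‖y - x‖ ≤ L → ‖A y - A x‖ ≤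
        ‖LinearMap.toContinuousLinearMap A.linear‖ * L := fun y hy => by
      have e : A y - A x = LinearMap.toContinuousLinearMap A.linear (y - x) := by
        simpa using (A.linearMap_vsub y x).symm
      rw [e]
      exact (ContinuousLinearMap.le_opNorm _ _).trans (by gcongr)
    rw [mul_assoc, ← Real.mul_rpow (norm_nonneg _) hL]
    exact h.near _ hx _ hy _ hz _ ht _ (hA y h1) (hA z h2) (hA t h3)

end MidpointSewn

end Planar

/-! ### Sewing lemma for triangles. -/

section Sewing

variable {V : Type*} [NormedAddCommGroup V] [NormedSpace ℝ V]

/-- The dyadic sewing of a function of triangles. -/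
noncomputable def sewTri (W : V → V → V → ℝ) (p q r : V) : ℝ :=
  selfSimLim triChild 0 (fun x : V × V × V => W x.1 x.2.1 x.2.2) (p, q, r)

/-- An almost closed function of triangles is almost additive under subdivision by midpoints, if
it vanishes on the degenerate triangles which occur in the subdivision. -/
theorem abs_sub_sum_triChild_le {K : Set V} {W : V → V → V → ℝ} {C γ : ℝ} (hK : Convex ℝ K)
    (hmid : ∀ x ∈ K, ∀ y ∈ K, W x (midpoint ℝ x y) y = 0)
    (z4 : ∀ x ∈ K, ∀ y ∈ K, W x y x = 0) (z5 : ∀ x ∈ K, ∀ y ∈ K, W x y y = 0)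
    (hnear : ∀ x ∈ K, ∀ y ∈ K, ∀ z ∈ K, ∀ t ∈ K, ∀ L, ‖y - x‖ ≤ L → ‖z - x‖ ≤ L →
      ‖t - x‖ ≤ L → |dTri W x y z t| ≤ C * L ^ γ) (x : V × V × V) (hx : x.1 ∈ K ∧ x.2.1 ∈ K ∧ x.2.2 ∈ K) :
    |W x.1 x.2.1 x.2.2 - (∑ i, W (triChild i x).1 (triChild i x).2.1 (triChild i x).2.2)| ≤
      7 * C * triSize x ^ γ := by
  obtain ⟨p, q, r⟩ := x
  obtain ⟨hp, hq, hr⟩ := hx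
  simp only at hp hq hr
  simp only [Fin.sum_univ_four]
  simp only [triChild, Matrix.cons_val]
  obtain ⟨c, hc⟩ : ∃ c, midpoint ℝ p q = c := ⟨_, rfl⟩
  obtain ⟨b, hb⟩ : ∃ b, midpoint ℝ p r = b := ⟨_, rfl⟩
  obtain ⟨a, ha⟩ : ∃ a, midpoint ℝ q r = a := ⟨_, rfl⟩
  have cK : c ∈ K := hc ▸ midpoint_mem_of_convex hK hp hq
  have bK : b ∈ K := hb ▸ midpoint_mem_of_convex hK hp hr
  have aK : a ∈ K := ha ▸ midpoint_mem_of_convex hK hq hr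
  have nq : ‖q - p‖ ≤ triSize (p, q, r) := le_add_of_nonneg_right (norm_nonneg _)
  have nr : ‖r - p‖ ≤ triSize (p, q, r) := le_add_of_nonneg_left (norm_nonneg _)
  have nc : ‖c - p‖ ≤ triSize (p, q, r) := by
    rw [← hc, midpoint_eq_half_smul, show (2⁻¹ : ℝ) • (p + q) - p = (2⁻¹ : ℝ) • (q - p) by module,
      norm_half_smul]
    linarith [norm_nonneg (q - p)]
  have nb : ‖b - p‖ ≤ triSize (p, q, r) := by
    rw [← hb, midpoint_eq_half_smul, show (2⁻¹ : ℝ) • (p + r) - p = (2⁻¹ : ℝ) • (r - p) by module,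
      norm_half_smul]
    linarith [norm_nonneg (r - p)]
  have na : ‖a - p‖ ≤ triSize (p, q, r) := by
    rw [← ha, midpoint_eq_half_smul,
      show (2⁻¹ : ℝ) • (q + r) - p = (2⁻¹ : ℝ) • ((q - p) + (r - p)) by module, norm_half_smul]
    linarith [norm_add_le (q - p) (r - p), norm_nonneg (q - p + (r - p)),
      show triSize (p, q, r) = ‖q - p‖ + ‖r - p‖ from rfl]
  have z1 : W p c q = 0 := hc ▸ hmid p hp q hq
  have z2 : W p b r = 0 := hb ▸ hmid p hp r hr
  have z3 : W q a r = 0 := ha ▸ hmid q hq r hr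
  -- `d4` cuts along the median `[p a]`, `d1` and `d2` cut the two halves at `c` and `b`, and `d3`
  -- isolates the inner triangle. `d5`, `d6` and `d7` replace the antisymmetry which `W` need not
  -- have.
  have d1 := hnear p hp c cK q hq a aK _ nc nq na
  have d2 := hnear p hp b bK a aK r hr _ nb na nr
  have d3 := hnear p hp a aK b bK c cK _ na nb nc
  have d4 := hnear p hp q hq a aK r hr _ nq na nr
  have d5 := hnear p hp b bK c cK b bK _ nb nc nb
  have d6 := hnear p hp a aK c cK a aK _ na nc na
  have d7 := hnear p hp a aK b bK a aK _ na nb na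
  simp only [dTri, z1, z2, z3, z4 _ aK _ bK, z4 _ bK _ cK, z4 _ aK _ cK] at d1 d2 d3 d4 d5 d6 d7
  have w1 := z5 p hp b bK
  have w2 := z5 p hp a aK
  rw [hc, hb, ha]
  rw [abs_le] at d1 d2 d3 d4 d5 d6 d7 ⊢
  constructor <;> linarith [d1.1, d1.2, d2.1, d2.2, d3.1, d3.2, d4.1, d4.2, d5.1, d5.2, d6.1, d6.2,
    d7.1, d7.2]

/-- A function of triangles in a convex set which vanishes on degenerate triangles and is almost
closed. -/
structure AlmostClosed (K : Set V) (W : V → V → V → ℝ) (C γ : ℝ) : Prop where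
  convex : Convex ℝ K
  lt : 2 < γ
  nonneg : 0 ≤ C
  degenerate : ∀ x ∈ K, ∀ y ∈ K, ∀ z ∈ K, Collinear ℝ {x, y, z} → W x y z = 0
  near : ∀ x ∈ K, ∀ y ∈ K, ∀ z ∈ K, ∀ t ∈ K, ∀ L, ‖y - x‖ ≤ L → ‖z - x‖ ≤ L → ‖t - x‖ ≤ L →
    |dTri W x y z t| ≤ C * L ^ γ

/-- The constant in the sewing lemma for triangles. -/
noncomputable def triConst (C γ : ℝ) : ℝ := 7 * C / (1 - 4 * 2 ^ (-γ))

theorem triConst_nonneg {C γ : ℝ} (hC : 0 ≤ C) (hγ : 2 < γ) : 0 ≤ triConst C γ :=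
  div_nonneg (by positivity) (by linarith [four_mul_two_rpow_neg_lt_one hγ])

namespace AlmostClosed

variable {K : Set V} {W : V → V → V → ℝ} {C γ : ℝ} (h : AlmostClosed K W C γ)

include h

theorem contracts : Contracts triChild (fun x : V × V × V => x.1 ∈ K ∧ x.2.1 ∈ K ∧ x.2.2 ∈ K)
    (fun x => 7 * C * triSize x ^ γ) (2 ^ (-γ)) :=
  contracts_triChild (fun i _ hx => triChild_mem_of_convex h.convex i hx) h.lt
    (mul_nonneg (by norm_num) h.nonneg)

theorem abs_sub_children_le (x : V × V × V) (hx : x.1 ∈ K ∧ x.2.1 ∈ K ∧ x.2.2 ∈ K) :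
    |W x.1 x.2.1 x.2.2 - (∑ i, W (triChild i x).1 (triChild i x).2.1 (triChild i x).2.2 +
      (0 : V × V × V → ℝ) x)| ≤ 7 * C * triSize x ^ γ := by
  rw [Pi.zero_apply, add_zero]
  exact abs_sub_sum_triChild_le h.convex
    (fun x hx y hy => h.degenerate x hx _ (midpoint_mem_of_convex h.convex hx hy) y hy
      (wbtw_midpoint ℝ x y).collinear)
    (fun x hx y hy => h.degenerate x hx y hy x hx (by
      rw [Set.insert_comm]; simpa using collinear_pair ℝ y x))
    (fun x hx y hy => h.degenerate x hx y hy y hy (by simpa using collinear_pair ℝ x y))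
    h.near x hx

theorem abs_sub_sewTri_le {p q r : V} (hp : p ∈ K) (hq : q ∈ K) (hr : r ∈ K) :
    |W p q r - sewTri W p q r| ≤ triConst C γ * triSize (p, q, r) ^ γ := by
  have := h.contracts.abs_sub_lim_le (h := 0) h.abs_sub_children_le (x := (p, q, r)) ⟨hp, hq, hr⟩
  refine this.trans (le_of_eq ?_)
  rw [Fintype.card_fin, triConst]
  push_cast
  ring

theorem sewTri_split {p q r : V} (hp : p ∈ K) (hq : q ∈ K) (hr : r ∈ K) :
    sewTri W p q r = sewTri W p (midpoint ℝ p q) (midpoint ℝ p r) +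
      sewTri W (midpoint ℝ p q) q (midpoint ℝ q r) + sewTri W (midpoint ℝ p r) (midpoint ℝ q r) r +
      sewTri W (midpoint ℝ q r) (midpoint ℝ p r) (midpoint ℝ p q) := by
  have := h.contracts.lim_eq (h := 0) h.abs_sub_children_le (x := (p, q, r)) ⟨hp, hq, hr⟩
  rw [Fin.sum_univ_four, Pi.zero_apply, add_zero] at this
  exact this

/-- The quarters of a collinear triple remain on its line, where `W = 0`; there the sewn function is
additive and of order `γ > 2`. -/
theorem sewTri_of_collinear {p q r : V} (hp : p ∈ K) (hq : q ∈ K) (hr : r ∈ K)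
    (hcol : Collinear ℝ {p, q, r}) : sewTri W p q r = 0 := by
  have hT := contracts_triChild (V := V)
    (P := fun x => (x.1 ∈ K ∧ x.2.1 ∈ K ∧ x.2.2 ∈ K) ∧ Collinear ℝ {x.1, x.2.1, x.2.2})
    (fun i x hx => ⟨triChild_mem_of_convex h.convex i hx.1, by
      have hline : ∀ y ∈ ({(triChild i x).1, (triChild i x).2.1, (triChild i x).2.2} : Set V),
          y ∈ affineSpan ℝ ({x.1, x.2.1, x.2.2} : Set V) := by
        have := triChild_mem_of_convex
          (affineSpan ℝ ({x.1, x.2.1, x.2.2} : Set V)).convex i (x := x)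
          ⟨subset_affineSpan ℝ _ (by simp), subset_affineSpan ℝ _ (by simp),
            subset_affineSpan ℝ _ (by simp)⟩
        rintro y (rfl | rfl | rfl)
        exacts [this.1, this.2.1, this.2.2]
      have hspan : Collinear ℝ (affineSpan ℝ ({x.1, x.2.1, x.2.2} : Set V) : Set V) := by
        rw [Collinear, ← direction_affineSpan, AffineSubspace.affineSpan_coe, direction_affineSpan]
        exact hx.2
      exact hspan.subset hline⟩)
    h.lt (triConst_nonneg h.nonneg h.lt)
  exact hT.eq_zero (E := fun x => sewTri W x.1 x.2.1 x.2.2)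
    (fun x hx => by
      refine le_trans (le_of_eq ?_) (Finset.abs_sum_le_sum_abs _ _)
      congr 1
      rw [Fin.sum_univ_four]
      exact h.sewTri_split hx.1.1 hx.1.2.1 hx.1.2.2)
    (fun x hx => by
      have := h.abs_sub_sewTri_le hx.1.1 hx.1.2.1 hx.1.2.2
      rwa [h.degenerate _ hx.1.1 _ hx.1.2.1 _ hx.1.2.2 hx.2, zero_sub, abs_neg] at this)
    (x := (p, q, r)) ⟨⟨hp, hq, hr⟩, hcol⟩

/-- In the constant, 4 counts the faces of a tetrahedron, and `4 ^ γ` comes from faces of size at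
most `4 * L`. -/
theorem midpointSewn : MidpointSewn K (sewTri W) (C + 4 * (triConst C γ * 4 ^ γ)) γ where
  convex := h.convex
  lt := h.lt
  nonneg := by
    have := triConst_nonneg h.nonneg h.lt
    have := h.nonneg
    positivity
  degenerate x hx y hy z hz hcol := h.sewTri_of_collinear hx hy hz hcol
  split p hp q hq r hr := h.sewTri_split hp hq hr
  near x hx y hy z hz t ht L h1 h2 h3 := by
    have hC := triConst_nonneg h.nonneg h.lt
    have hγ := h.lt
    have hL : 0 ≤ L := (norm_nonneg _).trans h1
    have key : ∀ p ∈ K, ∀ q ∈ K, ∀ r ∈ K, ‖p - x‖ ≤ L → ‖q - x‖ ≤ L → ‖r - x‖ ≤ L →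
        |W p q r - sewTri W p q r| ≤ triConst C γ * 4 ^ γ * L ^ γ := by
      intro p hp q hq r hr hpL hqL hrL
      refine (h.abs_sub_sewTri_le hp hq hr).trans ?_
      rw [mul_assoc, ← Real.mul_rpow (by norm_num) hL]
      refine mul_le_mul_of_nonneg_left (Real.rpow_le_rpow (triSize_nonneg _) ?_ (by linarith)) hC
      have e1 := norm_sub_le (q - x) (p - x)
      have e2 := norm_sub_le (r - x) (p - x)
      rw [sub_sub_sub_cancel_right] at e1 e2
      simp only [triSize]
      linarith
    have hx0 : ‖x - x‖ ≤ L := by simpa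
    have k1 := key y hy z hz t ht h1 h2 h3
    have k2 := key x hx z hz t ht hx0 h2 h3
    have k3 := key x hx y hy t ht hx0 h1 h3
    have k4 := key x hx y hy z hz hx0 h1 h2
    have k0 := h.near x hx y hy z hz t ht L h1 h2 h3
    rw [add_mul, mul_assoc 4]
    simp only [dTri] at k0 ⊢
    rw [abs_le] at *
    constructor <;> linarith [k0.1, k0.2, k1.1, k1.2, k2.1, k2.2, k3.1, k3.2, k4.1, k4.2]

end AlmostClosed

end Sewing

end RoughForms

namespace RoughForms

/-! ### Sewing lemma for segments. -/

section SewingSegments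

variable {V : Type*} [NormedAddCommGroup V] [NormedSpace ℝ V]

/-- The two halves of a segment. -/
noncomputable def segChild (i : Bool) (x : V × V) : V × V :=
  if i then (x.1, midpoint ℝ x.1 x.2) else (midpoint ℝ x.1 x.2, x.2)

/-- The dyadic sewing of a function of oriented segments. -/
noncomputable def sewSeg (W : V → V → ℝ) (p q : V) : ℝ :=
  selfSimLim segChild 0 (fun x : V × V => W x.1 x.2) (p, q)

/-- The constant in the sewing lemma for segments. -/
noncomputable def segConst (C β : ℝ) : ℝ := C / (1 - 2 * 2 ^ (-β))

theorem segConst_nonneg {C β : ℝ} (hC : 0 ≤ C) (hβ : 1 < β) : 0 ≤ segConst C β :=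
  div_nonneg hC (by linarith [two_mul_two_rpow_neg_lt_one hβ])

theorem norm_segChild (i : Bool) (x : V × V) :
    ‖(segChild i x).2 - (segChild i x).1‖ = ‖x.2 - x.1‖ / 2 := by
  rw [← norm_half_smul]
  congr 1
  cases i <;> simp [segChild, midpoint_eq_half_smul] <;> module

theorem contracts_segChild {P : V × V → Prop} (hP : ∀ i x, P x → P (segChild i x)) {β c : ℝ}
    (hβ : 1 < β) (hc : 0 ≤ c) :
    Contracts segChild P (fun x => c * ‖x.2 - x.1‖ ^ β) (2 ^ (-β)) where
  map_mem := hP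
  nonneg x _ := by positivity
  factor_nonneg := by positivity
  factor_lt := by simpa using two_mul_two_rpow_neg_lt_one hβ
  le i x _ := by rw [mul_left_comm, ← div_two_rpow (norm_nonneg _), norm_segChild]

theorem segChild_mem_of_convex {K : Set V} (hK : Convex ℝ K) (i : Bool) {x : V × V}
    (hx : x.1 ∈ K ∧ x.2 ∈ K) : (segChild i x).1 ∈ K ∧ (segChild i x).2 ∈ K := by
  have := midpoint_mem_of_convex hK hx.1 hx.2
  cases i
  exacts [⟨this, hx.2⟩, ⟨hx.1, this⟩]

/-- A function of oriented segments in a convex set which is almost additive on lines. -/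
structure AlmostAdditive (K : Set V) (W : V → V → ℝ) (C β : ℝ) : Prop where
  convex : Convex ℝ K
  lt : 1 < β
  nonneg : 0 ≤ C
  diag : ∀ x ∈ K, W x x = 0
  near : ∀ p ∈ K, ∀ q ∈ K, ∀ r ∈ K, Collinear ℝ {p, q, r} → ∀ L, ‖q - p‖ ≤ L → ‖r - p‖ ≤ L →
    |W q r - W p r + W p q| ≤ C * L ^ β

namespace AlmostAdditive

variable {K : Set V} {W : V → V → ℝ} {C β : ℝ} (h : AlmostAdditive K W C β)

include h

theorem contracts : Contracts segChild (fun x : V × V => x.1 ∈ K ∧ x.2 ∈ K)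
    (fun x => C * ‖x.2 - x.1‖ ^ β) (2 ^ (-β)) :=
  contracts_segChild (fun i _ hx => segChild_mem_of_convex h.convex i hx) h.lt h.nonneg

theorem abs_sub_children_le (x : V × V) (hx : x.1 ∈ K ∧ x.2 ∈ K) :
    |W x.1 x.2 - (∑ i, W (segChild i x).1 (segChild i x).2 + (0 : V × V → ℝ) x)| ≤
      C * ‖x.2 - x.1‖ ^ β := by
  have hm := midpoint_mem_of_convex h.convex hx.1 hx.2
  have := h.near _ hx.1 _ hm _ hx.2 (wbtw_midpoint ℝ _ _).collinear ‖x.2 - x.1‖ (by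
    have := norm_segChild true x
    simp only [segChild, if_true] at this
    rw [this]
    linarith [norm_nonneg (x.2 - x.1)]) le_rfl
  rw [← abs_neg] at this
  simp only [Fintype.sum_bool, segChild, if_true, Bool.false_eq_true, if_false, Pi.zero_apply,
    add_zero]
  convert this using 2
  ring

theorem abs_sub_sewSeg_le {p q : V} (hp : p ∈ K) (hq : q ∈ K) :
    |W p q - sewSeg W p q| ≤ segConst C β * ‖q - p‖ ^ β := by
  have := h.contracts.abs_sub_lim_le (h := 0) h.abs_sub_children_le (x := (p, q)) ⟨hp, hq⟩
  refine this.trans (le_of_eq ?_)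
  rw [Fintype.card_bool, segConst]
  push_cast
  ring

theorem sewSeg_midpoint {p q : V} (hp : p ∈ K) (hq : q ∈ K) :
    sewSeg W p q = sewSeg W p (midpoint ℝ p q) + sewSeg W (midpoint ℝ p q) q := by
  have := h.contracts.lim_eq (h := 0) h.abs_sub_children_le (x := (p, q)) ⟨hp, hq⟩
  rw [Fintype.sum_bool, Pi.zero_apply, add_zero] at this
  exact this

/-- Collinearity is not assumed: besides closedness on lines, this controls Young integrals on
boundaries of genuine triangles. -/
theorem abs_sewSeg_le {p q r : V} (hp : p ∈ K) (hq : q ∈ K) (hr : r ∈ K) {L : ℝ}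
    (hpq : ‖q - p‖ ≤ L) (hpr : ‖r - p‖ ≤ L) :
    |(sewSeg W q r - sewSeg W p r + sewSeg W p q) - (W q r - W p r + W p q)| ≤
      3 * (segConst C β * 2 ^ β) * L ^ β := by
  have hL : 0 ≤ L := (norm_nonneg _).trans hpq
  have hβ := h.lt
  have hC := segConst_nonneg h.nonneg h.lt
  have key : ∀ x ∈ K, ∀ y ∈ K, ‖y - x‖ ≤ 2 * L →
      |W x y - sewSeg W x y| ≤ segConst C β * 2 ^ β * L ^ β := fun x hx y hy hxy => by
    refine (h.abs_sub_sewSeg_le hx hy).trans ?_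
    rw [mul_assoc, ← Real.mul_rpow (by norm_num) hL]
    exact mul_le_mul_of_nonneg_left (Real.rpow_le_rpow (norm_nonneg _) hxy (by linarith)) hC
  have k1 := key q hq r hr (by
    have := norm_sub_le (r - p) (q - p)
    rw [sub_sub_sub_cancel_right] at this
    linarith)
  have k2 := key p hp r hr (by linarith)
  have k3 := key p hp q hq (by linarith)
  rw [abs_le] at *
  constructor <;> linarith [k1.1, k1.2, k2.1, k2.2, k3.1, k3.2]

theorem sewSeg_self {p : V} (hp : p ∈ K) : sewSeg W p p = 0 := by
  have := h.sewSeg_midpoint hp hp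
  rw [midpoint_self] at this
  linarith

/-- Parametrized by `[0, 1]`, the sewn function is midpoint additive and almost additive, so
`additive_of_midpoint` applies. -/
theorem sewSeg_of_wbtw {p m q : V} (hp : p ∈ K) (hq : q ∈ K) (hm : Wbtw ℝ p m q) :
    sewSeg W p q = sewSeg W p m + sewSeg W m q := by
  obtain ⟨t, ⟨ht0, ht1⟩, rfl⟩ := hm
  have hβ := h.lt
  have hmem : ∀ s : ℝ, 0 ≤ s → s ≤ 1 → AffineMap.lineMap p q s ∈ K := fun s h0 h1 =>
    h.convex.lineMap_mem hp hq ⟨h0, h1⟩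
  have hnorm : ∀ a b : ℝ, a ≤ b → ‖AffineMap.lineMap p q b - AffineMap.lineMap p q a‖ =
      (b - a) * ‖q - p‖ := fun a b hab => by
    rw [← dist_eq_norm, dist_lineMap_lineMap, Real.dist_eq, abs_of_nonneg (by linarith),
      dist_comm, dist_eq_norm]
  have := additive_of_midpoint h.lt
    (k := fun a b => sewSeg W (AffineMap.lineMap p q a) (AffineMap.lineMap p q b))
    (C := (C + 3 * (segConst C β * 2 ^ β)) * ‖q - p‖ ^ β)
    (fun a m b ha ham hmb hb => by
      have hL : 0 ≤ (b - a) * ‖q - p‖ := mul_nonneg (by linarith) (norm_nonneg _)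
      have e1 : ‖AffineMap.lineMap p q m - AffineMap.lineMap p q a‖ ≤ (b - a) * ‖q - p‖ := by
        rw [hnorm a m ham]
        gcongr
      have e2 := (hnorm a b (by linarith)).le
      have aK := hmem a ha (by linarith)
      have mK := hmem m (by linarith) (by linarith)
      have bK := hmem b (by linarith) hb
      have k1 := h.abs_sewSeg_le aK mK bK e1 e2
      have k2 := h.near _ aK _ mK _ bK (by
        have := collinear_smul p (q - p) a m b
        simpa [AffineMap.lineMap_apply_module', add_comm] using this) _ e1 e2
      rw [mul_right_comm, mul_assoc, ← Real.mul_rpow (by linarith) (norm_nonneg _), add_mul]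
      rw [abs_le] at *
      constructor <;> linarith [k1.1, k1.2, k2.1, k2.2])
    (fun a b ha hab hb => by
      have := h.sewSeg_midpoint (hmem a ha (by linarith)) (hmem b (by linarith) hb)
      rw [← AffineMap.map_midpoint, show midpoint ℝ a b = (a + b) / 2 by
        rw [midpoint_eq_half_smul, smul_eq_mul]; ring] at this
      exact this)
    (a := 0) (m := t) (b := 1) le_rfl ht0 ht1 le_rfl
  simpa using this

theorem sewSeg_swap {p q : V} (hp : p ∈ K) (hq : q ∈ K) : sewSeg W q p = -sewSeg W p q := by
  have hβ := h.lt
  have hC := segConst_nonneg h.nonneg h.lt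
  have := (contracts_segChild (V := V) (P := fun x : V × V => x.1 ∈ K ∧ x.2 ∈ K)
    (c := C + 3 * (segConst C β * 2 ^ β))
    (fun i _ hx => segChild_mem_of_convex h.convex i hx) h.lt
    (by have := h.nonneg; positivity)).eq_zero
    (E := fun x => sewSeg W x.2 x.1 + sewSeg W x.1 x.2)
    (fun ⟨p, q⟩ ⟨hp, hq⟩ => by
      refine le_trans (le_of_eq ?_) (Finset.abs_sum_le_sum_abs _ _)
      congr 1
      simp only [Fintype.sum_bool, segChild, if_true, Bool.false_eq_true, if_false]
      rw [h.sewSeg_midpoint hp hq, h.sewSeg_midpoint hq hp, midpoint_comm q p]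
      ring)
    (fun ⟨p, q⟩ ⟨hp, hq⟩ => by
      simp only at hp hq
      have k1 := h.abs_sewSeg_le hp hq hp (L := ‖q - p‖) le_rfl (by simp)
      have k2 := h.near p hp q hq p hp (by
        rw [Set.insert_comm]; simpa using collinear_pair ℝ q p) ‖q - p‖ le_rfl (by simp)
      rw [h.sewSeg_self hp] at k1
      simp only
      rw [add_mul]
      rw [abs_le] at *
      constructor <;> linarith [k1.1, k1.2, k2.1, k2.2]) (x := (p, q)) ⟨hp, hq⟩
  simp only at this
  linarith

theorem sewSeg_closed {p q r : V} (hp : p ∈ K) (hq : q ∈ K) (hr : r ∈ K)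
    (hcol : Collinear ℝ {p, q, r}) : sewSeg W q r - sewSeg W p r + sewSeg W p q = 0 := by
  have s1 := h.sewSeg_swap hp hq
  have s2 := h.sewSeg_swap hp hr
  have s3 := h.sewSeg_swap hq hr
  rcases hcol.wbtw_or_wbtw_or_wbtw with hw | hw | hw
  · linarith [h.sewSeg_of_wbtw hp hr hw]
  · linarith [h.sewSeg_of_wbtw hq hp hw]
  · linarith [h.sewSeg_of_wbtw hr hq hw]

end AlmostAdditive

end SewingSegments

/-! ### Young and Züst integrals. -/

section YoungZust

variable {V : Type*} [NormedAddCommGroup V] [NormedSpace ℝ V]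

/-- The Young integral of `g₁ dg₂` on the segment from `p` to `q`. -/
noncomputable def youngInt (g₁ g₂ : V → ℝ) (p q : V) : ℝ :=
  sewSeg (fun p q => g₁ p * (g₂ q - g₂ p)) p q

/-- The Young integral of `g₁ dg₂` on the boundary of the triangle `[p q r]`. -/
noncomputable def youngBdry (g₁ g₂ : V → ℝ) (p q r : V) : ℝ :=
  youngInt g₁ g₂ q r - youngInt g₁ g₂ p r + youngInt g₁ g₂ p q

/-- The Züst integral of `f dg₁ ∧ dg₂` on the triangle `[p q r]`. -/
noncomputable def zustInt (f g₁ g₂ : V → ℝ) (p q r : V) : ℝ :=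
  sewTri (fun p q r => f p * youngBdry g₁ g₂ p q r) p q r

/-- The condition `[δg₁ ∪ δg₂]_β < ∞` on a convex set. -/
structure YoungPair (K : Set V) (g₁ g₂ : V → ℝ) (C β : ℝ) : Prop where
  convex : Convex ℝ K
  lt : 1 < β
  nonneg : 0 ≤ C
  le : ∀ p ∈ K, ∀ q ∈ K, ∀ r ∈ K, ∀ L, ‖q - p‖ ≤ L → ‖r - p‖ ≤ L →
    |(g₁ q - g₁ p) * (g₂ r - g₂ q)| ≤ C * L ^ β

/-- The constant which bounds Young integrals on boundaries of triangles. -/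
noncomputable def bdryConst (C β : ℝ) : ℝ := C + 3 * (segConst C β * 2 ^ β)

theorem bdryConst_nonneg {C β : ℝ} (hC : 0 ≤ C) (hβ : 1 < β) : 0 ≤ bdryConst C β := by
  have := segConst_nonneg hC hβ
  unfold bdryConst
  positivity

namespace YoungPair

variable {K : Set V} {g₁ g₂ : V → ℝ} {C β : ℝ} (h : YoungPair K g₁ g₂ C β)

include h

theorem almostAdditive : AlmostAdditive K (fun p q => g₁ p * (g₂ q - g₂ p)) C β where
  convex := h.convex
  lt := h.lt
  nonneg := h.nonneg
  diag x _ := by simp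
  near p hp q hq r hr _ L h1 h2 := by
    convert h.le p hp q hq r hr L h1 h2 using 2
    ring

theorem abs_youngInt_sub_le {p q : V} (hp : p ∈ K) (hq : q ∈ K) :
    |g₁ p * (g₂ q - g₂ p) - youngInt g₁ g₂ p q| ≤ segConst C β * ‖q - p‖ ^ β :=
  h.almostAdditive.abs_sub_sewSeg_le hp hq

theorem youngBdry_of_collinear {p q r : V} (hp : p ∈ K) (hq : q ∈ K) (hr : r ∈ K)
    (hcol : Collinear ℝ {p, q, r}) : youngBdry g₁ g₂ p q r = 0 :=
  h.almostAdditive.sewSeg_closed hp hq hr hcol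

theorem abs_youngBdry_le {p q r : V} (hp : p ∈ K) (hq : q ∈ K) (hr : r ∈ K) {L : ℝ}
    (hpq : ‖q - p‖ ≤ L) (hpr : ‖r - p‖ ≤ L) : |youngBdry g₁ g₂ p q r| ≤ bdryConst C β * L ^ β := by
  have k1 := h.almostAdditive.abs_sewSeg_le hp hq hr hpq hpr
  have k2 := h.le p hp q hq r hr L hpq hpr
  rw [show (g₁ q - g₁ p) * (g₂ r - g₂ q) =
    g₁ q * (g₂ r - g₂ q) - g₁ p * (g₂ r - g₂ p) + g₁ p * (g₂ q - g₂ p) by ring] at k2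
  rw [youngBdry, bdryConst, add_mul]
  simp only [youngInt]
  rw [abs_le] at *
  constructor <;> linarith [k1.1, k1.2, k2.1, k2.2]

/-- The constant in the almost closedness of `f ∪ δ(g₁ dg₂)`. -/
theorem almostClosed {f : V → ℝ} {A α : ℝ} (hA : 0 ≤ A) (hα : 0 < α) (hαβ : 2 < α + β)
    (hf : ∀ p ∈ K, ∀ q ∈ K, |f q - f p| ≤ A * ‖q - p‖ ^ α) :
    AlmostClosed K (fun p q r => f p * youngBdry g₁ g₂ p q r)
      (A * (bdryConst C β * 2 ^ β)) (α + β) where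
  convex := h.convex
  lt := hαβ
  nonneg := by
    have := bdryConst_nonneg h.nonneg h.lt
    positivity
  degenerate x hx y hy z hz hcol := by
    rw [h.youngBdry_of_collinear hx hy hz hcol, mul_zero]
  near x hx y hy z hz t ht L h1 h2 h3 := by
    have hβ := h.lt
    have hL : 0 ≤ L := (norm_nonneg _).trans h1
    have hb := bdryConst_nonneg h.nonneg h.lt
    -- Leibniz rule together with `δ ∘ δ = 0`; the two factors have orders `α` and `β`.
    have e : dTri (fun p q r => f p * youngBdry g₁ g₂ p q r) x y z t =
        (f y - f x) * youngBdry g₁ g₂ y z t := by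
      simp only [dTri, youngBdry]; ring
    have n1 := norm_sub_le (z - x) (y - x)
    have n2 := norm_sub_le (t - x) (y - x)
    rw [sub_sub_sub_cancel_right] at n1 n2
    have k1 := h.abs_youngBdry_le hy hz ht (L := 2 * L) (by linarith) (by linarith)
    rw [Real.mul_rpow (by norm_num) hL, ← mul_assoc] at k1
    have k2 : |f y - f x| ≤ A * L ^ α := (hf x hx y hy).trans
      (mul_le_mul_of_nonneg_left (Real.rpow_le_rpow (norm_nonneg _) h1 hα.le) hA)
    rw [e, abs_mul, Real.rpow_add_of_nonneg hL hα.le (by linarith)]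
    calc |f y - f x| * |youngBdry g₁ g₂ y z t|
        ≤ (A * L ^ α) * (bdryConst C β * 2 ^ β * L ^ β) := by gcongr
      _ = _ := by ring

end YoungPair

end YoungZust

end RoughForms

namespace RoughForms

/-! ### Diameters and scaled copies of simplices. -/

section SimplexGeometry

variable {d k : ℕ} {D : Set (Euc d)}

theorem Simp.vertex_mem (S : Simp k D) (i : Fin (k + 1)) : S.1 i ∈ D :=
  S.2 (subset_convexHull ℝ _ ⟨i, rfl⟩)

theorem Simp.norm_sub_le_diam (S : Simp k D) (i j : Fin (k + 1)) : ‖S.1 i - S.1 j‖ ≤ S.diam := by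
  rw [← dist_eq_norm]
  exact Metric.dist_le_diam_of_mem (Set.finite_range _).isBounded ⟨i, rfl⟩ ⟨j, rfl⟩

theorem Simp.diam_nonneg (S : Simp k D) : 0 ≤ S.diam := Metric.diam_nonneg

theorem Simp.diam_le (S : Simp k D) {L : ℝ} (hL : ∀ i j, ‖S.1 i - S.1 j‖ ≤ L) : S.diam ≤ L := by
  refine Metric.diam_le_of_forall_dist_le ((norm_nonneg _).trans (hL 0 0)) ?_
  rintro _ ⟨i, rfl⟩ _ ⟨j, rfl⟩
  rw [dist_eq_norm]
  exact hL i j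

theorem Simp.diam_one (S : Simp 1 D) : S.diam = ‖S.1 1 - S.1 0‖ := by
  refine le_antisymm (S.diam_le fun i j => ?_) (S.norm_sub_le_diam 1 0)
  fin_cases i <;> fin_cases j <;> simp [norm_sub_rev]

theorem Simp.Isometric.diam_eq {S T : Simp k D} (h : S.Isometric T) : S.diam = T.diam := by
  obtain ⟨i, hi, hij⟩ := h
  have : Set.range T.1 = i '' Set.range S.1 := by
    rw [← Set.range_comp]
    congr 1
    ext1 j
    exact (hij j).symm
  rw [Simp.diam, Simp.diam, this, hi.diam_image]

theorem Simp.shrink_zero (S : Simp k D) : S.shrink 0 = S := by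
  apply Subtype.ext
  ext1 i
  simp [Simp.shrink]

theorem Simp.shrink_apply (S : Simp k D) (n : ℕ) (j : Fin (k + 1)) :
    (S.shrink n).1 j = S.1 0 + ((2 : ℝ) ^ n)⁻¹ • (S.1 j - S.1 0) := by
  simp [Simp.shrink, AffineMap.homothety_apply, add_comm]

theorem Simp.diam_shrink (S : Simp k D) (n : ℕ) : (S.shrink n).diam = ((2 : ℝ) ^ n)⁻¹ * S.diam := by
  have h0 : (0 : ℝ) < 2 ^ n := by positivity
  have key : ∀ i j, ‖(S.shrink n).1 i - (S.shrink n).1 j‖ = ((2 : ℝ) ^ n)⁻¹ * ‖S.1 i - S.1 j‖ := by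
    intro i j
    rw [S.shrink_apply, S.shrink_apply, add_sub_add_left_eq_sub, ← smul_sub,
      sub_sub_sub_cancel_right, norm_smul, Real.norm_of_nonneg (by positivity)]
  refine le_antisymm ((S.shrink n).diam_le fun i j => ?_) ?_
  · rw [key]
    gcongr
    exact S.norm_sub_le_diam i j
  · rw [inv_mul_le_iff₀ h0]
    refine S.diam_le fun i j => ?_
    rw [← inv_mul_le_iff₀ h0, ← key]
    exact (S.shrink n).norm_sub_le_diam i j

/-- A simplex with the same shape as `S`, of half the size, possibly reflected at a point, has
copies of the same shape as those of `S`. -/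
theorem Simp.isometric_shrink_succ {S T : Simp k D} {c : ℝ} (hc : c = 1 ∨ c = -1)
    (h : ∀ j, T.1 j - T.1 0 = (c * 2⁻¹) • (S.1 j - S.1 0)) (n : ℕ) :
    (T.shrink n).Isometric (S.shrink (n + 1)) := by
  refine ⟨fun x => S.1 0 + c • (x - T.1 0), ?_, fun j => ?_⟩
  · refine Isometry.of_dist_eq fun x y => ?_
    rw [dist_add_left, dist_eq_norm, dist_eq_norm, ← smul_sub, sub_sub_sub_cancel_right, norm_smul]
    rcases hc with rfl | rfl <;> simp
  · have hcc : c * c = 1 := by rcases hc with rfl | rfl <;> norm_num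
    beta_reduce
    rw [T.shrink_apply, S.shrink_apply, add_sub_cancel_left, h, smul_smul, smul_smul, pow_succ,
      mul_inv]
    congr 2
    linear_combination ((2 : ℝ) ^ n)⁻¹ * 2⁻¹ * hcc

end SimplexGeometry

/-! ### Dini gauges and subdivision. -/

section Dini

variable {d k : ℕ} {D : Set (Euc d)}

theorem isDini_diamPow {r γ : ℝ} (hγ : r < γ) : IsDini r (diamPow γ : Germ k D) where
  nonneg S := Real.rpow_nonneg S.diam_nonneg _
  uniform S T h := by rw [diamPow, diamPow, h.diam_eq]
  tendsto S := by
    have e : ∀ n : ℕ, (2 : ℝ) ^ ((n : ℝ) * r) * diamPow γ (S.shrink n) =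
        (2 ^ (r - γ)) ^ n * S.diam ^ γ := by
      intro n
      rw [diamPow, S.diam_shrink, Real.mul_rpow (by positivity) S.diam_nonneg, ← mul_assoc,
        ← Real.rpow_natCast 2 n, ← Real.rpow_neg (by norm_num), ← Real.rpow_mul (by norm_num),
        ← Real.rpow_add (by norm_num), ← Real.rpow_natCast (2 ^ (r - γ)) n,
        ← Real.rpow_mul (by norm_num)]
      ring_nf
    simp only [e]
    have := (tendsto_pow_atTop_nhds_zero_of_lt_one (r := (2 : ℝ) ^ (r - γ)) (by positivity)
      (Real.rpow_lt_one_of_one_lt_of_neg (by norm_num) (by linarith))).mul_const (S.diam ^ γ)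
    rwa [zero_mul] at this

theorem IsDini.add {r : ℝ} {u v : Germ k D} (hu : IsDini r u) (hv : IsDini r v) :
    IsDini r (u + v) where
  nonneg S := add_nonneg (hu.nonneg S) (hv.nonneg S)
  uniform S T h := by rw [Pi.add_apply, Pi.add_apply, hu.uniform S T h, hv.uniform S T h]
  tendsto S := by
    have := (hu.tendsto S).add (hv.tendsto S)
    rw [add_zero] at this
    refine this.congr fun n => ?_
    rw [Pi.add_apply, mul_add]

theorem near_iff {v ω ω' : Germ k D} :
    Near v ω ω' ↔ ∃ c : ℝ≥0, ∀ S, |ω S - ω' S| ≤ c * v S :=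
  gaugeSize_lt_top_iff _ _

theorem near_of_le {v ω ω' : Germ k D} {c : ℝ} (hc : 0 ≤ c)
    (h : ∀ S, |ω S - ω' S| ≤ c * v S) : Near v ω ω' :=
  near_iff.2 ⟨⟨c, hc⟩, h⟩

theorem Near.exists_le {v ω ω' : Germ k D} (h : Near v ω ω') :
    ∃ c : ℝ, 0 ≤ c ∧ ∀ S, |ω S - ω' S| ≤ c * v S := by
  obtain ⟨c, hc⟩ := near_iff.1 h
  exact ⟨c, c.2, hc⟩

/-- A germ which is dominated by a Dini gauge, and subadditive under subdivision up to an error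
`diam ^ κ` with `κ > k`, is dominated by `diam ^ κ`. -/
theorem abs_le_of_children {ι : Type*} [Fintype ι] (hι : Fintype.card ι = 2 ^ k)
    (ch : ι → Simp k D → Simp k D)
    (hch : ∀ i n S, ((ch i S).shrink n).Isometric (S.shrink (n + 1)))
    {P : Simp k D → Prop} (hP : ∀ i S, P S → P (ch i S)) {E u : Germ k D} (hu : IsDini (k : ℝ) u)
    {c : ℝ} (hEu : ∀ S, P S → |E S| ≤ c * u S) {κ C : ℝ} (hκ : (k : ℝ) < κ) (hC : 0 ≤ C)
    (hE : ∀ S, P S → |E S| ≤ ∑ i, |E (ch i S)| + C * S.diam ^ κ) {S : Simp k D} (hS : P S) :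
    |E S| ≤ C / (1 - 2 ^ ((k : ℝ) - κ)) * S.diam ^ κ := by
  have hκ1 : (2 : ℝ) ^ ((k : ℝ) - κ) < 1 :=
    Real.rpow_lt_one_of_one_lt_of_neg (by norm_num) (by linarith)
  obtain ⟨A, hA⟩ : ∃ A, C / (1 - (2 : ℝ) ^ ((k : ℝ) - κ)) = A := ⟨_, rfl⟩
  have hAe : A * (1 - 2 ^ ((k : ℝ) - κ)) = C := by rw [← hA]; exact div_mul_cancel₀ _ (by linarith)
  rw [hA]
  have hdiam : ∀ i (S : Simp k D), (ch i S).diam = S.diam / 2 := fun i S => by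
    have := (hch i 0 S).diam_eq
    rw [Simp.shrink_zero, Simp.diam_shrink] at this
    rw [this]; norm_num; ring
  -- The `n`-th copy of a child is isometric to the `(n + 1)`-st copy of the parent, so all `2 ^ k`
  -- children give the same value of `u`, and the Dini limit is needed for the single simplex `S`.
  -- `A` is the fixed point of `A ↦ 2 ^ (k - κ) * A + C`; the constant `c` disappears in the limit.
  have key : ∀ (n : ℕ) (S : Simp k D), P S →
      |E S| ≤ A * S.diam ^ κ + c * (2 ^ ((n : ℝ) * k) * u (S.shrink n)) := by
    intro n
    induction n with
    | zero =>
      intro S hS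
      have hA0 : 0 ≤ A := by rw [← hA]; exact div_nonneg hC (by linarith)
      have h1 := hEu S hS
      have h2 : 0 ≤ A * S.diam ^ κ := mul_nonneg hA0 (Real.rpow_nonneg S.diam_nonneg _)
      simpa [Simp.shrink_zero] using by linarith
    | succ n ih =>
      intro S hS
      have h1 : ∀ i, |E (ch i S)| ≤
          A * (2 ^ (-κ) * S.diam ^ κ) + c * (2 ^ ((n : ℝ) * k) * u (S.shrink (n + 1))) := fun i => by
        have := ih (ch i S) (hP i S hS)
        rwa [hdiam, div_two_rpow S.diam_nonneg, hu.uniform _ _ (hch i n S)] at this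
      have h2 : ∑ i, |E (ch i S)| ≤ 2 ^ (k : ℝ) *
          (A * (2 ^ (-κ) * S.diam ^ κ) + c * (2 ^ ((n : ℝ) * k) * u (S.shrink (n + 1)))) := by
        refine (Finset.sum_le_card_nsmul _ _ _ fun i _ => h1 i).trans (le_of_eq ?_)
        rw [Finset.card_univ, hι, nsmul_eq_mul, Real.rpow_natCast]
        push_cast
        ring
      refine (hE S hS).trans ((add_le_add_left h2 _).trans (le_of_eq ?_))
      rw [← hAe, sub_eq_add_neg (k : ℝ), Real.rpow_add (by norm_num)]
      push_cast
      rw [add_mul (n : ℝ), one_mul, Real.rpow_add (by norm_num)]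
      ring
  have hlim : Filter.Tendsto
      (fun n : ℕ => A * S.diam ^ κ + c * ((2 : ℝ) ^ ((n : ℝ) * k) * u (S.shrink n)))
      Filter.atTop (𝓝 (A * S.diam ^ κ + c * 0)) :=
    tendsto_const_nhds.add ((hu.tendsto S).const_mul c)
  rw [mul_zero, add_zero] at hlim
  exact ge_of_tendsto' hlim fun n => key n S hS

end Dini

/-! ### Germs in degrees one and two. -/

section LowDim

variable {d : ℕ} {D : Set (Euc d)}

/-- The simplex `[p q]`. -/
def mkSeg (p q : Euc d) (h : convexHull ℝ {p, q} ⊆ D) : Simp 1 D :=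
  ⟨![p, q], by simpa [Matrix.range_cons, Set.pair_comm] using h⟩

/-- The simplex `[p q r]`. -/
def mkTri (p q r : Euc d) (h : convexHull ℝ {p, q, r} ⊆ D) : Simp 2 D :=
  ⟨![p, q, r], by
    have : Set.range ![p, q, r] = {p, q, r} := by
      ext x; simp [Matrix.range_cons]; tauto
    rwa [this]⟩

theorem Simp.range_one (S : Simp 1 D) : Set.range S.1 = {S.1 0, S.1 1} := by
  ext x
  constructor
  · rintro ⟨j, rfl⟩
    fin_cases j <;> simp
  · rintro (rfl | rfl)
    exacts [⟨0, rfl⟩, ⟨1, rfl⟩]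

theorem Simp.range_two (S : Simp 2 D) : Set.range S.1 = {S.1 0, S.1 1, S.1 2} := by
  ext x
  constructor
  · rintro ⟨j, rfl⟩
    fin_cases j <;> simp
  · rintro (rfl | rfl | rfl)
    exacts [⟨0, rfl⟩, ⟨1, rfl⟩, ⟨2, rfl⟩]

theorem Simp.hull_one (S : Simp 1 D) : convexHull ℝ {S.1 0, S.1 1} ⊆ D := S.range_one ▸ S.2

theorem Simp.hull_two (S : Simp 2 D) : convexHull ℝ {S.1 0, S.1 1, S.1 2} ⊆ D := S.range_two ▸ S.2

theorem Simp.eq_mkSeg (S : Simp 1 D) : S = mkSeg (S.1 0) (S.1 1) S.hull_one := by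
  apply Subtype.ext
  ext1 j
  fin_cases j <;> rfl

theorem Simp.eq_mkTri (S : Simp 2 D) : S = mkTri (S.1 0) (S.1 1) (S.1 2) S.hull_two := by
  apply Subtype.ext
  ext1 j
  fin_cases j <;> rfl

theorem convexHull_pair_subset {K : Set (Euc d)} (hK : Convex ℝ K) {p q : Euc d} (hp : p ∈ K)
    (hq : q ∈ K) : convexHull ℝ {p, q} ⊆ K :=
  convexHull_min (by rintro x (rfl | rfl) <;> assumption) hK

theorem convexHull_triple_subset {K : Set (Euc d)} (hK : Convex ℝ K) {p q r : Euc d} (hp : p ∈ K)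
    (hq : q ∈ K) (hr : r ∈ K) : convexHull ℝ {p, q, r} ⊆ K :=
  convexHull_min (by rintro x (rfl | rfl | rfl) <;> assumption) hK

/-- The halves of a `1`-simplex. -/
noncomputable def segHalf (i : Bool) (S : Simp 1 D) : Simp 1 D :=
  mkSeg (segChild i (S.1 0, S.1 1)).1 (segChild i (S.1 0, S.1 1)).2 (by
    have := segChild_mem_of_convex (convex_convexHull ℝ {S.1 0, S.1 1}) i (x := (S.1 0, S.1 1))
      ⟨subset_convexHull ℝ _ (by simp), subset_convexHull ℝ _ (by simp)⟩
    exact (convexHull_pair_subset (convex_convexHull ℝ _) this.1 this.2).trans S.hull_one)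

/-- The quarters of a `2`-simplex. -/
noncomputable def triQuarter (i : Fin 4) (S : Simp 2 D) : Simp 2 D :=
  mkTri (triChild i (S.1 0, S.1 1, S.1 2)).1 (triChild i (S.1 0, S.1 1, S.1 2)).2.1
    (triChild i (S.1 0, S.1 1, S.1 2)).2.2 (by
    have := triChild_mem_of_convex (convex_convexHull ℝ {S.1 0, S.1 1, S.1 2}) i
      (x := (S.1 0, S.1 1, S.1 2))
      ⟨subset_convexHull ℝ _ (by simp), subset_convexHull ℝ _ (by simp),
        subset_convexHull ℝ _ (by simp)⟩
    exact (convexHull_triple_subset (convex_convexHull ℝ _) this.1 this.2.1 this.2.2).trans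
      S.hull_two)

theorem segHalf_isometric (i : Bool) (n : ℕ) (S : Simp 1 D) :
    ((segHalf i S).shrink n).Isometric (S.shrink (n + 1)) := by
  refine Simp.isometric_shrink_succ (Or.inl rfl) (fun j => ?_) n
  cases i <;> fin_cases j <;> simp [segHalf, mkSeg, segChild, midpoint_eq_half_smul] <;> module

/-- The inner quarter, in the chosen order of its vertices, is a copy of `S` scaled by `-1/2`; this
is why point reflections are admitted in `Simp.isometric_shrink_succ`. -/
theorem triQuarter_isometric (i : Fin 4) (n : ℕ) (S : Simp 2 D) :
    ((triQuarter i S).shrink n).Isometric (S.shrink (n + 1)) := by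
  by_cases hi : i = 3
  · subst hi
    refine Simp.isometric_shrink_succ (Or.inr rfl) (fun j => ?_) n
    fin_cases j <;> simp [triQuarter, mkTri, triChild, midpoint_eq_half_smul] <;> module
  · refine Simp.isometric_shrink_succ (Or.inl rfl) (fun j => ?_) n
    fin_cases i <;> fin_cases j <;>
      simp [triQuarter, mkTri, triChild, midpoint_eq_half_smul] at hi ⊢ <;> module

theorem extd_one_apply (ω : Germ 1 D) (S : Simp 2 D) :
    extd ω S = ω (S.edge 1 2) - ω (S.edge 0 2) + ω (S.edge 0 1) := by
  have e0 : S.reindex (Fin.succAbove (0 : Fin 3)) = S.edge 1 2 := by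
    apply Subtype.ext; ext1 j; fin_cases j <;> rfl
  have e1 : S.reindex (Fin.succAbove (1 : Fin 3)) = S.edge 0 2 := by
    apply Subtype.ext; ext1 j; fin_cases j <;> rfl
  have e2 : S.reindex (Fin.succAbove (2 : Fin 3)) = S.edge 0 1 := by
    apply Subtype.ext; ext1 j; fin_cases j <;> rfl
  rw [extd, Fin.sum_univ_three, e0, e1, e2]
  norm_num
  ring

theorem extd_zero_apply (f : Euc d → ℝ) (S : Simp 1 D) :
    extd (germ0 D f) S = f (S.1 1) - f (S.1 0) := by
  rw [extd, Fin.sum_univ_two]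
  simp [germ0, Simp.reindex]
  rfl

theorem preYoung_apply (f g : Euc d → ℝ) (S : Simp 1 D) :
    preYoung D f g S = f (S.1 0) * (g (S.1 1) - g (S.1 0)) := by
  rw [preYoung, cup, extd_zero_apply]
  rfl

theorem preZust_apply (f g₁ g₂ : Euc d → ℝ) (S : Simp 2 D) :
    preZust D f g₁ g₂ S = f (S.1 0) * (young D g₁ g₂ (S.edge 1 2) - young D g₁ g₂ (S.edge 0 2) +
      young D g₁ g₂ (S.edge 0 1)) := by
  have e : (S.reindex fun i : Fin 3 => (⟨0 + i.1, by omega⟩ : Fin 3)) = S := by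
    apply Subtype.ext; ext1 j; fin_cases j <;> rfl
  have : preZust D f g₁ g₂ S = f (S.1 0) * extd (young D g₁ g₂)
      (S.reindex fun i : Fin 3 => (⟨0 + i.1, by omega⟩ : Fin 3)) := rfl
  rw [this, e, extd_one_apply]

theorem cup_extd_apply (g₁ g₂ : Euc d → ℝ) (S : Simp 2 D) :
    cup (extd (germ0 D g₁)) (extd (germ0 D g₂)) S =
      (g₁ (S.1 1) - g₁ (S.1 0)) * (g₂ (S.1 2) - g₂ (S.1 1)) := by
  rw [cup, extd_zero_apply, extd_zero_apply]
  rfl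

end LowDim

end RoughForms

namespace RoughForms

/-! ### Zero area and collinearity. -/

section Volume

variable {d : ℕ} {D : Set (Euc d)}

theorem sum_mul_eq_inner (u v : Euc d) : ∑ l, u l * v l = inner ℝ u v := by
  rw [PiLp.inner_apply]
  refine Finset.sum_congr rfl fun l _ => ?_
  simp [mul_comm]

theorem Simp.vol_one (S : Simp 1 D) : S.vol = ‖S.1 1 - S.1 0‖ := by
  rw [Simp.vol]
  simp only [Matrix.det_fin_one, Matrix.mul_apply, Matrix.transpose_apply, Matrix.of_apply]
  rw [sum_mul_eq_inner, real_inner_self_eq_norm_sq]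
  simp

theorem Simp.vol_two (S : Simp 2 D) : S.vol =
    √(‖S.1 1 - S.1 0‖ ^ 2 * ‖S.1 2 - S.1 0‖ ^ 2 -
      inner ℝ (S.1 1 - S.1 0) (S.1 2 - S.1 0) ^ 2) / 2 := by
  rw [Simp.vol]
  simp only [Matrix.det_fin_two, Matrix.mul_apply, Matrix.transpose_apply, Matrix.of_apply]
  simp only [sum_mul_eq_inner]
  simp only [Fin.succ_zero_eq_one, Fin.succ_one_eq_two, real_inner_self_eq_norm_sq,
    real_inner_comm (S.1 1 - S.1 0)]
  simp [pow_two]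

theorem collinear_of_sub_eq_smul {p q r u : Euc d} {a b : ℝ} (hq : q - p = a • u)
    (hr : r - p = b • u) : Collinear ℝ {p, q, r} := by
  have := collinear_smul p u 0 a b
  rwa [← hq, ← hr, zero_smul, add_zero, add_sub_cancel, add_sub_cancel] at this

/-- The Gram determinant vanishes exactly in the equality case of the Cauchy–Schwarz inequality. -/
theorem Simp.vol_two_eq_zero_iff (S : Simp 2 D) :
    S.vol = 0 ↔ Collinear ℝ {S.1 0, S.1 1, S.1 2} := by
  rw [S.vol_two, div_eq_zero_iff, or_iff_left (by norm_num), Real.sqrt_eq_zero']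
  obtain ⟨u, hu⟩ : ∃ u, S.1 1 - S.1 0 = u := ⟨_, rfl⟩
  obtain ⟨w, hw⟩ : ∃ w, S.1 2 - S.1 0 = w := ⟨_, rfl⟩
  rw [hu, hw]
  constructor
  · intro h
    rcases eq_or_ne u 0 with rfl | hu0
    · exact collinear_of_sub_eq_smul (u := w) (a := 0) (b := 1) (by simp [hu]) (by simp [hw])
    · have hu1 : ‖u‖ ≠ 0 := by simpa
      have h1 : ‖(‖u‖ ^ 2) • w - (inner ℝ u w) • u‖ ^ 2 ≤ 0 := by
        rw [@norm_sub_sq ℝ]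
        simp only [norm_smul, inner_smul_left, inner_smul_right, real_inner_comm u w, mul_pow,
          Real.norm_eq_abs, sq_abs]
        simp
        nlinarith [mul_nonneg (sq_nonneg ‖u‖) (sub_nonneg.2 h)]
      have h2 : (‖u‖ ^ 2) • w = (inner ℝ u w) • u :=
        sub_eq_zero.1 (norm_eq_zero.1 (pow_eq_zero_iff two_ne_zero |>.1
          (le_antisymm h1 (sq_nonneg _))))
      refine collinear_of_sub_eq_smul (u := u) (a := 1) (b := inner ℝ u w / ‖u‖ ^ 2)
        (by simp [hu]) ?_
      rw [hw, div_eq_inv_mul, mul_smul, ← h2, smul_smul, inv_mul_cancel₀ (by positivity), one_smul]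
  · intro h
    obtain ⟨v, hv⟩ := (collinear_iff_of_mem (p₀ := S.1 0) (by simp)).1 h
    obtain ⟨a, ha⟩ := hv (S.1 1) (by simp)
    obtain ⟨b, hb⟩ := hv (S.1 2) (by simp)
    have e1 : u = a • v := by rw [← hu, ha]; simp
    have e2 : w = b • v := by rw [← hw, hb]; simp
    rw [e1, e2, inner_smul_left, inner_smul_right, real_inner_self_eq_norm_sq, norm_smul, norm_smul,
      mul_pow, mul_pow, Real.norm_eq_abs, Real.norm_eq_abs, sq_abs, sq_abs]
    apply le_of_eq
    simp
    ring

end Volume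

/-! ### Regular germs and uniqueness of the sewing. -/

section Regular

variable {d k : ℕ} {D : Set (Euc d)}

theorem extd_two_apply (ω : Germ 2 D) (S : Simp 3 D) :
    extd ω S = ω (S.reindex ![1, 2, 3]) - ω (S.reindex ![0, 2, 3]) + ω (S.reindex ![0, 1, 3]) -
      ω (S.reindex ![0, 1, 2]) := by
  have e0 : S.reindex (Fin.succAbove (0 : Fin 4)) = S.reindex ![1, 2, 3] := by
    apply Subtype.ext; ext1 j; fin_cases j <;> rfl
  have e1 : S.reindex (Fin.succAbove (1 : Fin 4)) = S.reindex ![0, 2, 3] := by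
    apply Subtype.ext; ext1 j; fin_cases j <;> rfl
  have e2 : S.reindex (Fin.succAbove (2 : Fin 4)) = S.reindex ![0, 1, 3] := by
    apply Subtype.ext; ext1 j; fin_cases j <;> rfl
  have e3 : S.reindex (Fin.succAbove (3 : Fin 4)) = S.reindex ![0, 1, 2] := by
    apply Subtype.ext; ext1 j; fin_cases j <;> rfl
  rw [extd, Fin.sum_univ_four, e0, e1, e2, e3]
  norm_num
  ring

open Classical in
/-- The values of a `1`-germ, as a function of two points. -/
noncomputable def evalSeg (ω : Germ 1 D) (p q : Euc d) : ℝ :=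
  if h : convexHull ℝ {p, q} ⊆ D then ω (mkSeg p q h) else 0

open Classical in
/-- The values of a `2`-germ, as a function of three points. -/
noncomputable def evalTri (ω : Germ 2 D) (p q r : Euc d) : ℝ :=
  if h : convexHull ℝ {p, q, r} ⊆ D then ω (mkTri p q r h) else 0

theorem evalSeg_vertices (ω : Germ 1 D) (S : Simp 1 D) : evalSeg ω (S.1 0) (S.1 1) = ω S := by
  rw [evalSeg, dif_pos S.hull_one, ← S.eq_mkSeg]

theorem evalTri_vertices (ω : Germ 2 D) (S : Simp 2 D) :
    evalTri ω (S.1 0) (S.1 1) (S.1 2) = ω S := by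
  rw [evalTri, dif_pos S.hull_two, ← S.eq_mkTri]

/-- The affine map `x ↦ p + ∑ xᵢ vᵢ`. -/
noncomputable def coordMap (p : Euc d) (v : Fin k → Euc d) : Euc k →ᵃ[ℝ] Euc d :=
  (∑ i, ((EuclideanSpace.proj i : Euc k →L[ℝ] ℝ).smulRight (v i))).toLinearMap.toAffineMap +
    AffineMap.const ℝ _ p

theorem coordMap_apply (p : Euc d) (v : Fin k → Euc d) (x : Fin k → ℝ) :
    coordMap p v (WithLp.toLp 2 x) = p + ∑ i, x i • v i := by
  simp [coordMap, add_comm]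

/-- A tuple of points whose images under an affine map span a simplex in `D`. -/
def liftSimp {h : ℕ} (A : Euc k →ᵃ[ℝ] Euc d) (x : Fin (h + 1) → Euc k)
    (hx : convexHull ℝ (Set.range fun i => A (x i)) ⊆ D) : Simp h (A ⁻¹' D) :=
  ⟨x, by
    intro y hy
    refine hx ?_
    have e : (Set.range fun i => A (x i)) = A '' Set.range x := by rw [← Set.range_comp]; rfl
    rw [e, ← AffineMap.image_convexHull]
    exact ⟨y, hy, rfl⟩⟩

theorem exists_affine_parametrization (p q r : Euc d) :
    ∃ A : Euc 2 →ᵃ[ℝ] Euc d, ∀ x ∈ convexHull ℝ {p, q, r}, ∃ c, A c = x := by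
  refine ⟨coordMap p ![q - p, r - p], fun x hx => ?_⟩
  have hsub : convexHull ℝ {p, q, r} ⊆ coordMap p ![q - p, r - p] '' Set.univ := by
    refine convexHull_triple_subset (convex_univ.affine_image _) ?_ ?_ ?_
    · exact ⟨WithLp.toLp 2 ![0, 0], trivial, by simp [coordMap_apply]⟩
    · exact ⟨WithLp.toLp 2 ![1, 0], trivial, by simp [coordMap_apply]⟩
    · exact ⟨WithLp.toLp 2 ![0, 1], trivial, by simp [coordMap_apply]⟩
  obtain ⟨c, -, hc⟩ := hsub hx
  exact ⟨c, hc⟩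

theorem IsRegular.evalSeg_closed {ω : Germ 1 D} (hω : IsRegular ω) (A : Euc 1 →ᵃ[ℝ] Euc d)
    (x : Fin 3 → Euc 1) (hx : convexHull ℝ (Set.range fun i => A (x i)) ⊆ D) :
    evalSeg ω (A (x 1)) (A (x 2)) - evalSeg ω (A (x 0)) (A (x 2)) +
      evalSeg ω (A (x 0)) (A (x 1)) = 0 := by
  have key := congrFun (hω.2 _ A (Set.mapsTo_preimage A D)) (liftSimp A x hx)
  rw [extd_one_apply] at key
  simp only [pullback, Pi.zero_apply] at key
  rw [← evalSeg_vertices ω, ← evalSeg_vertices ω, ← evalSeg_vertices ω] at key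
  exact key

theorem IsRegular.evalTri_closed {ω : Germ 2 D} (hω : IsRegular ω) (A : Euc 2 →ᵃ[ℝ] Euc d)
    (x : Fin 4 → Euc 2) (hx : convexHull ℝ (Set.range fun i => A (x i)) ⊆ D) :
    dTri (evalTri ω) (A (x 0)) (A (x 1)) (A (x 2)) (A (x 3)) = 0 := by
  have key := congrFun (hω.2 _ A (Set.mapsTo_preimage A D)) (liftSimp A x hx)
  rw [extd_two_apply] at key
  simp only [pullback, Pi.zero_apply] at key
  rw [← evalTri_vertices ω, ← evalTri_vertices ω, ← evalTri_vertices ω,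
    ← evalTri_vertices ω] at key
  exact key

/-- With constant `0` the estimates for almost additive functions become identities; the exponent
`2` is an arbitrary number above 1. -/
theorem IsRegular.almostAdditive {ω : Germ 1 D} (hω : IsRegular ω) {K : Set (Euc d)}
    (hK : Convex ℝ K) (hKD : K ⊆ D) : AlmostAdditive K (evalSeg ω) 0 2 where
  convex := hK
  lt := one_lt_two
  nonneg := le_rfl
  diag x hx := by
    have h := (convexHull_pair_subset hK hx hx).trans hKD
    have := evalSeg_vertices ω (mkSeg x x h)
    rw [hω.1 _ (by rw [Simp.vol_one]; simp [mkSeg])] at this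
    exact this
  near p hp q hq r hr hcol L _ _ := by
    obtain ⟨v, hv⟩ := (collinear_iff_of_mem (p₀ := p) (by simp)).1 hcol
    obtain ⟨a, ha⟩ := hv q (by simp)
    obtain ⟨b, hb⟩ := hv r (by simp)
    let A : Euc 1 →ᵃ[ℝ] Euc d := coordMap p fun _ => v
    let x : Fin 3 → Euc 1 := ![WithLp.toLp 2 ![0], WithLp.toLp 2 ![a], WithLp.toLp 2 ![b]]
    have x0 : A (x 0) = p := by simp [A, x, coordMap_apply]
    have x1 : A (x 1) = q := by simp [A, x, coordMap_apply, ha, add_comm]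
    have x2 : A (x 2) = r := by simp [A, x, coordMap_apply, hb, add_comm]
    have hx : convexHull ℝ (Set.range fun i => A (x i)) ⊆ D := by
      refine (convexHull_min ?_ hK).trans hKD
      rintro _ ⟨i, rfl⟩
      fin_cases i
      · change A (x 0) ∈ K
        rwa [x0]
      · change A (x 1) ∈ K
        rwa [x1]
      · change A (x 2) ∈ K
        rwa [x2]
    have key := hω.evalSeg_closed A x hx
    rw [x0, x1, x2] at key
    rw [key]
    simp

/-- A regular germ is exactly closed in the plane of the triangle, hence exactly additive over its
quarters; the exponent `3` plays no role. -/
theorem IsRegular.almostClosed {ω : Germ 2 D} (hω : IsRegular ω) {p q r : Euc d}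
    (h : convexHull ℝ {p, q, r} ⊆ D) :
    AlmostClosed (convexHull ℝ {p, q, r}) (evalTri ω) 0 3 where
  convex := convex_convexHull ℝ _
  lt := by norm_num
  nonneg := le_rfl
  degenerate x hx y hy z hz hcol := by
    have hs := (convexHull_triple_subset (convex_convexHull ℝ _) hx hy hz).trans h
    have := evalTri_vertices ω (mkTri x y z hs)
    rw [hω.1 (mkTri x y z hs) ((Simp.vol_two_eq_zero_iff (mkTri x y z hs)).2 hcol)] at this
    exact this
  near x hx y hy z hz t ht L _ _ _ := by
    obtain ⟨A, hA⟩ := exists_affine_parametrization p q r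
    obtain ⟨a0, rfl⟩ := hA x hx
    obtain ⟨a1, rfl⟩ := hA y hy
    obtain ⟨a2, rfl⟩ := hA z hz
    obtain ⟨a3, rfl⟩ := hA t ht
    have hc : convexHull ℝ (Set.range fun i => A (![a0, a1, a2, a3] i)) ⊆ D := by
      refine (convexHull_min ?_ (convex_convexHull ℝ _)).trans h
      rintro _ ⟨i, rfl⟩
      fin_cases i
      · exact hx
      · exact hy
      · exact hz
      · exact ht
    have key := hω.evalTri_closed A _ hc
    simp only [Matrix.cons_val] at key
    rw [key]
    simp

theorem hull_image_subset {J : Set (Euc k)} {A : Euc k →ᵃ[ℝ] Euc d} (hA : Set.MapsTo A J D) {h : ℕ}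
    (S : Simp h J) : convexHull ℝ (Set.range fun i => A (S.1 i)) ⊆ D :=
  mapsSimp_of_affine A hA S

theorem isRegular_of_seg {W : Euc d → Euc d → ℝ} (h0 : ∀ p ∈ D, W p p = 0)
    (h : ∀ p q r, convexHull ℝ {p, q, r} ⊆ D → Collinear ℝ {p, q, r} →
      W q r - W p r + W p q = 0) :
    IsRegular (fun S : Simp 1 D => W (S.1 0) (S.1 1)) := by
  refine ⟨fun S hS => ?_, fun J A hA => funext fun S => ?_⟩
  · rw [S.vol_one, norm_eq_zero, sub_eq_zero] at hS
    beta_reduce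
    rw [hS]
    exact h0 _ (S.vertex_mem 0)
  · rw [extd_one_apply]
    refine h _ _ _ ((S.push A (mapsSimp_of_affine A hA)).hull_two) ?_
    have hcol : Collinear ℝ (Set.univ : Set (Euc 1)) := by
      rw [collinear_iff_finrank_le_one]
      exact (Submodule.finrank_le _).trans (by simp)
    have := collinear_image (hcol.subset (Set.subset_univ {S.1 0, S.1 1, S.1 2})) A
    rw [Set.image_insert_eq, Set.image_insert_eq, Set.image_singleton] at this
    exact this

theorem isRegular_of_tri {W : Euc d → Euc d → Euc d → ℝ}
    (h0 : ∀ p q r, convexHull ℝ {p, q, r} ⊆ D → Collinear ℝ {p, q, r} → W p q r = 0)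
    (h : ∀ (A : Euc 2 →ᵃ[ℝ] Euc d) (x : Fin 4 → Euc 2),
      convexHull ℝ (Set.range fun i => A (x i)) ⊆ D →
        dTri W (A (x 0)) (A (x 1)) (A (x 2)) (A (x 3)) = 0) :
    IsRegular (fun S : Simp 2 D => W (S.1 0) (S.1 1) (S.1 2)) := by
  refine ⟨fun S hS => h0 _ _ _ S.hull_two (S.vol_two_eq_zero_iff.1 hS),
    fun J A hA => funext fun S => ?_⟩
  rw [extd_two_apply]
  exact h A S.1 (hull_image_subset hA S)

theorem IsRegular.sub {ω ω' : Germ k D} (h : IsRegular ω) (h' : IsRegular ω') :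
    IsRegular (ω - ω') := by
  refine ⟨fun S hS => by rw [Pi.sub_apply, h.1 S hS, h'.1 S hS, sub_zero], fun J A hA => ?_⟩
  have e1 := h.2 J A hA
  have e2 := h'.2 J A hA
  funext S
  have f1 := congrFun e1 S
  have f2 := congrFun e2 S
  simp only [extd, pullback, Pi.sub_apply, Pi.zero_apply] at f1 f2 ⊢
  simp only [mul_sub, Finset.sum_sub_distrib, f1, f2, sub_zero]

/-- The difference of two candidates is additive over the children and dominated by the sum of two
Dini gauges, so `abs_le_of_children` with `C = 0` kills it. -/
theorem eq_of_isSew {ι : Type*} [Fintype ι] (hι : Fintype.card ι = 2 ^ k)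
    (ch : ι → Simp k D → Simp k D)
    (hch : ∀ i n S, ((ch i S).shrink n).Isometric (S.shrink (n + 1)))
    (hadd : ∀ E : Germ k D, IsRegular E → ∀ S, E S = ∑ i, E (ch i S))
    {ω ω₁ ω₂ : Germ k D} (h1 : IsSew ω ω₁) (h2 : IsSew ω ω₂) : ω₁ = ω₂ := by
  obtain ⟨r1, v1, hv1, n1⟩ := h1
  obtain ⟨r2, v2, hv2, n2⟩ := h2
  obtain ⟨c1, c10, n1⟩ := n1.exists_le
  obtain ⟨c2, c20, n2⟩ := n2.exists_le
  funext S
  have := abs_le_of_children hι ch hch (P := fun _ => True) (fun _ _ _ => trivial)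
    (E := ω₁ - ω₂) (hv1.add hv2) (c := c1 + c2) (fun S _ => by
      have a1 := n1 S
      have a2 := n2 S
      have b1 := mul_nonneg c10 (hv2.nonneg S)
      have b2 := mul_nonneg c20 (hv1.nonneg S)
      rw [Pi.sub_apply, Pi.add_apply, add_mul, mul_add, mul_add]
      rw [abs_le] at *
      constructor <;> linarith [a1.1, a1.2, a2.1, a2.2]) (κ := k + 1) (C := 0) (by linarith) le_rfl
    (fun S _ => by
      rw [zero_mul, add_zero, hadd _ (r1.sub r2) S]
      exact Finset.abs_sum_le_sum_abs _ _) (S := S) trivial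
  rw [zero_div, zero_mul] at this
  exact sub_eq_zero.1 (abs_eq_zero.1 (le_antisymm this (abs_nonneg _)))

theorem IsSew.sew_eq_one {ω ω' : Germ 1 D} (h : IsSew ω ω') : sew ω = ω' := by
  have hs : Sewable ω := ⟨ω', h⟩
  rw [sew, dif_pos hs]
  refine eq_of_isSew (by simp) segHalf segHalf_isometric (fun E hE S => ?_) hs.choose_spec h
  have := (hE.almostAdditive (convex_convexHull ℝ _) S.hull_one).abs_sub_children_le
    (S.1 0, S.1 1) ⟨subset_convexHull ℝ _ (by simp), subset_convexHull ℝ _ (by simp)⟩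
  rw [zero_mul] at this
  have := sub_eq_zero.1 (abs_eq_zero.1 (le_antisymm this (abs_nonneg _)))
  rw [evalSeg_vertices, Pi.zero_apply, add_zero] at this
  exact this.trans (Finset.sum_congr rfl fun i _ => evalSeg_vertices E (segHalf i S))

theorem IsSew.sew_eq_two {ω ω' : Germ 2 D} (h : IsSew ω ω') : sew ω = ω' := by
  have hs : Sewable ω := ⟨ω', h⟩
  rw [sew, dif_pos hs]
  refine eq_of_isSew (by simp) triQuarter triQuarter_isometric (fun E hE S => ?_)
    hs.choose_spec h
  have := (hE.almostClosed S.hull_two).abs_sub_children_le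
    (S.1 0, S.1 1, S.1 2) ⟨subset_convexHull ℝ _ (by simp), subset_convexHull ℝ _ (by simp),
      subset_convexHull ℝ _ (by simp)⟩
  rw [mul_zero, zero_mul] at this
  have := sub_eq_zero.1 (abs_eq_zero.1 (le_antisymm this (abs_nonneg _)))
  rw [evalTri_vertices, Pi.zero_apply, add_zero] at this
  exact this.trans (Finset.sum_congr rfl fun i _ => evalTri_vertices E (triQuarter i S))

end Regular

/-! ### The germs of the theorem as explicit dyadic limits. -/

section Integrals

variable {d : ℕ} {D : Set (Euc d)} {f g₁ g₂ : Euc d → ℝ} {C β A α : ℝ}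

theorem pair_mem_hull (p q : Euc d) : p ∈ convexHull ℝ {p, q} ∧ q ∈ convexHull ℝ {p, q} :=
  ⟨subset_convexHull ℝ _ (by simp), subset_convexHull ℝ _ (by simp)⟩

theorem triple_mem_hull (p q r : Euc d) : p ∈ convexHull ℝ {p, q, r} ∧
    q ∈ convexHull ℝ {p, q, r} ∧ r ∈ convexHull ℝ {p, q, r} :=
  ⟨subset_convexHull ℝ _ (by simp), subset_convexHull ℝ _ (by simp),
    subset_convexHull ℝ _ (by simp)⟩

/-- The pair `g₁`, `g₂` satisfies Young's condition, with the same constant, on all convex subsets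
of `D`. -/
def YoungOn (D : Set (Euc d)) (g₁ g₂ : Euc d → ℝ) (C β : ℝ) : Prop :=
  1 < β ∧ 0 ≤ C ∧ ∀ K : Set (Euc d), Convex ℝ K → K ⊆ D → YoungPair K g₁ g₂ C β

/-- The function `f` is `α`-Hölder, with the same constant, on all segments in `D`. -/
def HolderOnSegs (D : Set (Euc d)) (f : Euc d → ℝ) (A α : ℝ) : Prop :=
  0 ≤ A ∧ 0 < α ∧ ∀ p q, convexHull ℝ {p, q} ⊆ D → |f q - f p| ≤ A * ‖q - p‖ ^ α

theorem YoungOn.isSew (h : YoungOn D g₁ g₂ C β) :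
    IsSew (preYoung D g₁ g₂) fun S => youngInt g₁ g₂ (S.1 0) (S.1 1) := by
  obtain ⟨hβ, hC, h⟩ := h
  refine ⟨isRegular_of_seg (fun p hp => ?_) fun p q r hs hcol => ?_, diamPow β,
    isDini_diamPow (by simpa), near_of_le (segConst_nonneg hC hβ) fun S => ?_⟩
  · exact (h {p} (convex_singleton p) (by simpa)).almostAdditive.sewSeg_self rfl
  · obtain ⟨hp, hq, hr⟩ := triple_mem_hull p q r
    exact (h _ (convex_convexHull ℝ _) hs).youngBdry_of_collinear hp hq hr hcol
  · obtain ⟨hp, hq⟩ := pair_mem_hull (S.1 0) (S.1 1)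
    rw [preYoung_apply, diamPow, S.diam_one]
    exact (h _ (convex_convexHull ℝ _) S.hull_one).abs_youngInt_sub_le hp hq

theorem YoungOn.young_apply (h : YoungOn D g₁ g₂ C β) (S : Simp 1 D) :
    young D g₁ g₂ S = youngInt g₁ g₂ (S.1 0) (S.1 1) := by
  rw [young, h.isSew.sew_eq_one]

theorem YoungOn.preZust_apply (h : YoungOn D g₁ g₂ C β) (f : Euc d → ℝ) (S : Simp 2 D) :
    preZust D f g₁ g₂ S = f (S.1 0) * youngBdry g₁ g₂ (S.1 0) (S.1 1) (S.1 2) := by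
  rw [RoughForms.preZust_apply, h.young_apply, h.young_apply, h.young_apply]
  rfl

theorem YoungOn.almostClosed (h : YoungOn D g₁ g₂ C β) (hf : HolderOnSegs D f A α)
    (hαβ : 2 < α + β) {K : Set (Euc d)} (hK : Convex ℝ K) (hKD : K ⊆ D) :
    AlmostClosed K (fun p q r => f p * youngBdry g₁ g₂ p q r)
      (A * (bdryConst C β * 2 ^ β)) (α + β) :=
  (h.2.2 K hK hKD).almostClosed hf.1 hf.2.1 hαβ fun p hp q hq =>
    hf.2.2 p q ((convexHull_pair_subset hK hp hq).trans hKD)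

theorem triSize_le_diam (S : Simp 2 D) : triSize (S.1 0, S.1 1, S.1 2) ≤ 2 * S.diam := by
  have h1 := S.norm_sub_le_diam 1 0
  have h2 := S.norm_sub_le_diam 2 0
  simp only [triSize]
  linarith

/-- The constant which bounds the distance of the Züst germ from `f ∪ δ(g₁ dg₂)`. -/
noncomputable def zustConst (A C α β : ℝ) : ℝ :=
  triConst (A * (bdryConst C β * 2 ^ β)) (α + β) * 2 ^ (α + β)

theorem zustConst_nonneg (h : YoungOn D g₁ g₂ C β) (hf : HolderOnSegs D f A α)
    (hαβ : 2 < α + β) : 0 ≤ zustConst A C α β := by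
  have := bdryConst_nonneg h.2.1 h.1
  have := hf.1
  have := triConst_nonneg (C := A * (bdryConst C β * 2 ^ β)) (by positivity) hαβ
  unfold zustConst
  positivity

theorem YoungOn.abs_sub_zustInt_le (h : YoungOn D g₁ g₂ C β) (hf : HolderOnSegs D f A α)
    (hαβ : 2 < α + β) (S : Simp 2 D) :
    |f (S.1 0) * youngBdry g₁ g₂ (S.1 0) (S.1 1) (S.1 2) -
      zustInt f g₁ g₂ (S.1 0) (S.1 1) (S.1 2)| ≤ zustConst A C α β * S.diam ^ (α + β) := by
  have hb := bdryConst_nonneg h.2.1 h.1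
  have hA := hf.1
  have hc := triConst_nonneg (C := A * (bdryConst C β * 2 ^ β)) (by positivity) hαβ
  obtain ⟨hp, hq, hr⟩ := triple_mem_hull (S.1 0) (S.1 1) (S.1 2)
  have := (h.almostClosed hf hαβ (convex_convexHull ℝ _) S.hull_two).abs_sub_sewTri_le hp hq hr
  refine this.trans ?_
  rw [zustConst, mul_assoc, ← Real.mul_rpow (by norm_num) S.diam_nonneg]
  exact mul_le_mul_of_nonneg_left
    (Real.rpow_le_rpow (triSize_nonneg _) (triSize_le_diam S) (by linarith)) hc

/-- Closedness on planes is reduced by `MidpointSewn.comp` to triangles in `Euc 2`, where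
`MidpointSewn.dTri_eq_zero` applies. -/
theorem YoungOn.isSew_zust (h : YoungOn D g₁ g₂ C β) (hf : HolderOnSegs D f A α)
    (hαβ : 2 < α + β) :
    IsSew (preZust D f g₁ g₂) fun S => zustInt f g₁ g₂ (S.1 0) (S.1 1) (S.1 2) := by
  refine ⟨isRegular_of_tri (fun p q r hs hcol => ?_) fun B x hx => ?_, diamPow (α + β),
    isDini_diamPow (by simpa), near_of_le (zustConst_nonneg h hf hαβ) fun S => ?_⟩
  · obtain ⟨hp, hq, hr⟩ := triple_mem_hull p q r
    exact (h.almostClosed hf hαβ (convex_convexHull ℝ _) hs).sewTri_of_collinear hp hq hr hcol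
  · exact ((h.almostClosed hf hαβ (convex_convexHull ℝ _) hx).midpointSewn.comp B).dTri_eq_zero
      (by simp) fun i => subset_convexHull ℝ _ ⟨i, rfl⟩
  · rw [h.preZust_apply, diamPow]
    exact h.abs_sub_zustInt_le hf hαβ S

theorem YoungOn.zust_apply (h : YoungOn D g₁ g₂ C β) (hf : HolderOnSegs D f A α)
    (hαβ : 2 < α + β) (S : Simp 2 D) :
    zust D f g₁ g₂ S = zustInt f g₁ g₂ (S.1 0) (S.1 1) (S.1 2) := by
  rw [zust, (h.isSew_zust hf hαβ).sew_eq_two]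

end Integrals

end RoughForms

namespace RoughForms

/-! ### The side compensator and comparison of the pull-backs. -/

section Compensator

variable {d : ℕ} {D : Set (Euc d)} {I : Set (Euc 2)} {φ : Euc 2 → Euc d} {f g₁ g₂ : Euc d → ℝ}
  {A A' C C' α β σ B : ℝ}

theorem Simp.edge_hull (S : Simp 2 D) (i j : Fin 3) : convexHull ℝ {S.1 i, S.1 j} ⊆ D :=
  (S.edge i j).hull_one

theorem Simp.diam_push_le (S : Simp 2 I) (hφ : MapsSimp 2 φ I D) (hB : 0 ≤ B) (hσ : 0 ≤ σ)
    (h : ∀ p q, convexHull ℝ {p, q} ⊆ I → ‖φ q - φ p‖ ≤ B * ‖q - p‖ ^ σ) :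
    (S.push φ hφ).diam ≤ B * S.diam ^ σ :=
  Simp.diam_le _ fun i j => (h _ _ (S.edge_hull j i)).trans (mul_le_mul_of_nonneg_left
    (Real.rpow_le_rpow (norm_nonneg _) (S.norm_sub_le_diam i j) hσ) hB)

/-- Quantitative hypotheses on `f`, `g₁`, `g₂` in `D`, on their compositions with `φ` in `I`, and
on the map `φ`. -/
structure PullData (D : Set (Euc d)) (I : Set (Euc 2)) (φ : Euc 2 → Euc d) (f g₁ g₂ : Euc d → ℝ)
    (A A' C C' α β σ B : ℝ) : Prop where
  young : YoungOn D g₁ g₂ C β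
  holder : HolderOnSegs D f A α
  young' : YoungOn I (g₁ ∘ φ) (g₂ ∘ φ) C' (β * σ)
  holder' : HolderOnSegs I (f ∘ φ) A' (α * σ)
  maps : MapsSimp 2 φ I D
  nonneg : 0 ≤ B
  norm_le : ∀ p q, convexHull ℝ {p, q} ⊆ I → ‖φ q - φ p‖ ≤ B * ‖q - p‖ ^ σ
  pos : 0 < σ
  lt : 2 < α + β
  lt' : 2 < α * σ + β * σ

/-- The defect on segments between the algebraic pull-back of `g₁ dg₂` and the Young germ of the
compositions. -/
noncomputable def pullDefect (φ : Euc 2 → Euc d) (g₁ g₂ : Euc d → ℝ) (p q : Euc 2) : ℝ :=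
  youngInt g₁ g₂ (φ p) (φ q) - youngInt (g₁ ∘ φ) (g₂ ∘ φ) p q

namespace PullData

variable (h : PullData D I φ f g₁ g₂ A A' C C' α β σ B)

include h

theorem hull_triple {p q r : Euc 2} (hs : convexHull ℝ {p, q, r} ⊆ I) :
    convexHull ℝ {φ p, φ q, φ r} ⊆ D :=
  ((mkTri p q r hs).push φ h.maps).hull_two

theorem hull_pair {p q : Euc 2} (hs : convexHull ℝ {p, q} ⊆ I) :
    convexHull ℝ {φ p, φ q} ⊆ D := by
  have := h.hull_triple (p := p) (q := q) (r := q) (by simpa using hs)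
  simpa using this

theorem pullback_apply (S : Simp 2 I) : pullback φ h.maps (zust D f g₁ g₂) S =
    zustInt f g₁ g₂ (φ (S.1 0)) (φ (S.1 1)) (φ (S.1 2)) :=
  h.young.zust_apply h.holder h.lt (S.push φ h.maps)

theorem zust_apply (S : Simp 2 I) : zust I (f ∘ φ) (g₁ ∘ φ) (g₂ ∘ φ) S =
    zustInt (f ∘ φ) (g₁ ∘ φ) (g₂ ∘ φ) (S.1 0) (S.1 1) (S.1 2) :=
  h.young'.zust_apply h.holder' h.lt' S

theorem diam_push_le (S : Simp 2 I) : (S.push φ h.maps).diam ≤ B * S.diam ^ σ :=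
  S.diam_push_le h.maps h.nonneg h.pos.le h.norm_le

theorem exists_abs_pullDefect_le : ∃ Z, 0 ≤ Z ∧ ∀ p q, convexHull ℝ {p, q} ⊆ I →
    |pullDefect φ g₁ g₂ p q| ≤ Z * ‖q - p‖ ^ (β * σ) := by
  have hβ := h.young.1
  have s1 := segConst_nonneg h.young.2.1 h.young.1
  have s2 := segConst_nonneg h.young'.2.1 h.young'.1
  have hB := h.nonneg
  refine ⟨segConst C β * B ^ β + segConst C' (β * σ), by positivity, fun p q hs => ?_⟩
  obtain ⟨hp, hq⟩ := pair_mem_hull p q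
  obtain ⟨hp', hq'⟩ := pair_mem_hull (φ p) (φ q)
  have k1 := (h.young.2.2 _ (convex_convexHull ℝ _) (h.hull_pair hs)).abs_youngInt_sub_le hp' hq'
  have k2 := (h.young'.2.2 _ (convex_convexHull ℝ _) hs).abs_youngInt_sub_le hp hq
  have k3 : segConst C β * ‖φ q - φ p‖ ^ β ≤ segConst C β * (B ^ β * ‖q - p‖ ^ (β * σ)) := by
    refine mul_le_mul_of_nonneg_left ?_ s1
    rw [mul_comm β σ, Real.rpow_mul (norm_nonneg _), ← Real.mul_rpow hB (by positivity)]
    exact Real.rpow_le_rpow (norm_nonneg _) (h.norm_le p q hs) (by linarith)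
  rw [pullDefect, add_mul, mul_assoc]
  simp only [Function.comp_apply] at k2
  rw [abs_le] at *
  constructor <;> linarith [k1.1, k1.2, k2.1, k2.2]

/-- Each Züst integral is replaced by the germ from which it is sewn; both have the factor `f (φ
(S.1 0))`, and the difference of the boundary Young integrals is `δ` of `pullDefect`. -/
theorem exists_abs_compare_le : ∃ E, 0 ≤ E ∧ ∀ S : Simp 2 I,
    |zustInt f g₁ g₂ (φ (S.1 0)) (φ (S.1 1)) (φ (S.1 2)) -
      zustInt (f ∘ φ) (g₁ ∘ φ) (g₂ ∘ φ) (S.1 0) (S.1 1) (S.1 2) -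
      f (φ (S.1 0)) * (pullDefect φ g₁ g₂ (S.1 1) (S.1 2) - pullDefect φ g₁ g₂ (S.1 0) (S.1 2) +
        pullDefect φ g₁ g₂ (S.1 0) (S.1 1))| ≤ E * S.diam ^ (α * σ + β * σ) := by
  have z1 := zustConst_nonneg h.young h.holder h.lt
  have z2 := zustConst_nonneg h.young' h.holder' h.lt'
  have hB := h.nonneg
  have hlt := h.lt
  refine ⟨zustConst A C α β * B ^ (α + β) + zustConst A' C' (α * σ) (β * σ), by positivity,
    fun S => ?_⟩
  have k1 := h.young.abs_sub_zustInt_le h.holder h.lt (S.push φ h.maps)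
  have k2 := h.young'.abs_sub_zustInt_le h.holder' h.lt' S
  have k3 : zustConst A C α β * (S.push φ h.maps).diam ^ (α + β) ≤
      zustConst A C α β * (B ^ (α + β) * S.diam ^ (α * σ + β * σ)) := by
    refine mul_le_mul_of_nonneg_left ?_ z1
    rw [← add_mul, mul_comm (α + β) σ, Real.rpow_mul S.diam_nonneg,
      ← Real.mul_rpow hB (Real.rpow_nonneg S.diam_nonneg _)]
    exact Real.rpow_le_rpow (Simp.diam_nonneg _) (h.diam_push_le S) (by linarith)
  have k1' := k1.trans k3
  simp only [Simp.push, youngBdry, Function.comp_apply] at k1' k2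
  simp only [pullDefect]
  rw [add_mul, mul_assoc]
  rw [abs_le] at k1' k2 ⊢
  constructor <;> linarith [k1'.1, k1'.2, k2.1, k2.2]

omit h in
/-- The degenerate triangle `[p m q]`, where `m` is the midpoint of `[p q]`. -/
noncomputable def midTri (S : Simp 1 I) : Simp 2 I :=
  mkTri (S.1 0) (midpoint ℝ (S.1 0) (S.1 1)) (S.1 1) (by
    have hp := pair_mem_hull (S.1 0) (S.1 1)
    exact (convexHull_triple_subset (convex_convexHull ℝ _) hp.1
      (midpoint_mem_of_convex (convex_convexHull ℝ _) hp.1 hp.2) hp.2).trans S.hull_one)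

omit h in
theorem extd_midTri (η : Germ 1 I) (S : Simp 1 I) :
    extd η (midTri S) = η (segHalf false S) - η S + η (segHalf true S) := by
  have e0 : (midTri S).edge 1 2 = segHalf false S := by
    apply Subtype.ext; ext1 j; fin_cases j <;> rfl
  have e1 : (midTri S).edge 0 2 = S := by apply Subtype.ext; ext1 j; fin_cases j <;> rfl
  have e2 : (midTri S).edge 0 1 = segHalf true S := by
    apply Subtype.ext; ext1 j; fin_cases j <;> rfl
  rw [extd_one_apply, e0, e1, e2]

omit h in
theorem diam_midTri (S : Simp 1 I) : (midTri S).diam = S.diam := by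
  have hm : ‖midpoint ℝ (S.1 0) (S.1 1) - S.1 0‖ = ‖S.1 1 - S.1 0‖ / 2 :=
    norm_segChild true (S.1 0, S.1 1)
  have hm' : ‖S.1 1 - midpoint ℝ (S.1 0) (S.1 1)‖ = ‖S.1 1 - S.1 0‖ / 2 :=
    norm_segChild false (S.1 0, S.1 1)
  have h0 := norm_nonneg (S.1 1 - S.1 0)
  rw [S.diam_one]
  refine le_antisymm (Simp.diam_le _ fun i j => ?_) ((midTri S).norm_sub_le_diam 2 0)
  simp only [midTri, mkTri]
  generalize midpoint ℝ (S.1 0) (S.1 1) = m at *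
  have hm1 := norm_sub_rev m (S.1 0)
  have hm2 := norm_sub_rev m (S.1 1)
  have hm3 := norm_sub_rev (S.1 1) (S.1 0)
  fin_cases i <;> fin_cases j <;> simp <;> linarith

/-- The condition on a compensator, read as a recursion: the value on a segment is determined by
those on its halves and by the Züst integral of the image of the midpoint triangle. -/
theorem compensator_midTri {η : Germ 1 I}
    (hη : IsSideCompensator (pullback φ h.maps (zust D f g₁ g₂)) η) (S : Simp 1 I) :
    zustInt f g₁ g₂ (φ (S.1 0)) (φ (midpoint ℝ (S.1 0) (S.1 1))) (φ (S.1 1)) =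
      η (segHalf false S) - η S + η (segHalf true S) := by
  have := hη.2 (midTri S) rfl
  rw [Pi.sub_apply, h.pullback_apply, extd_midTri, sub_eq_zero] at this
  exact this

theorem zustInt_midTri (S : Simp 1 I) : zustInt (f ∘ φ) (g₁ ∘ φ) (g₂ ∘ φ) (S.1 0)
    (midpoint ℝ (S.1 0) (S.1 1)) (S.1 1) = 0 := by
  obtain ⟨hp, hq⟩ := pair_mem_hull (S.1 0) (S.1 1)
  exact (h.young'.almostClosed h.holder' h.lt' (convex_convexHull ℝ _)
    S.hull_one).sewTri_of_collinear hp (midpoint_mem_of_convex (convex_convexHull ℝ _) hp hq) hq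
    (wbtw_midpoint ℝ _ _).collinear

omit h in
/-- The halves of a segment with end points in a convex set have their end points in it. -/
theorem segHalf_mem {K : Set (Euc 2)} (hK : Convex ℝ K) (i : Bool) (S : Simp 1 I)
    (hS : S.1 0 ∈ K ∧ S.1 1 ∈ K) : (segHalf i S).1 0 ∈ K ∧ (segHalf i S).1 1 ∈ K :=
  segChild_mem_of_convex hK i (x := (S.1 0, S.1 1)) hS

/-- The side compensator is close to `(f ∘ φ) ∪ ζ`, where `ζ` is the defect of the pull-backs
of `g₁ dg₂`. -/
theorem exists_abs_compensator_sub_le {η : Germ 1 I}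
    (hη : IsSideCompensator (pullback φ h.maps (zust D f g₁ g₂)) η) :
    ∃ E, 0 ≤ E ∧ ∀ S : Simp 1 I, |η S - f (φ (S.1 0)) * pullDefect φ g₁ g₂ (S.1 0) (S.1 1)| ≤
      E * S.diam ^ (α * σ + β * σ) := by
  obtain ⟨Z, hZ0, hZ⟩ := h.exists_abs_pullDefect_le
  obtain ⟨E, hE0, hE⟩ := h.exists_abs_compare_le
  obtain ⟨u, hu, hun⟩ := hη.1
  obtain ⟨c, hc0, hc⟩ := hun.exists_le
  have hA' := h.holder'.1
  have hασ := h.holder'.2.1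
  have hβσ := h.young'.1
  have hlt := h.lt'
  have hk1 : (2 : ℝ) ^ (((1 : ℕ) : ℝ) - (α * σ + β * σ)) < 1 :=
    Real.rpow_lt_one_of_one_lt_of_neg (by norm_num) (by push_cast; linarith)
  refine ⟨(E + A' * Z) / (1 - 2 ^ (((1 : ℕ) : ℝ) - (α * σ + β * σ))),
    div_nonneg (by positivity) (by linarith), fun S₀ => ?_⟩
  -- This bound of `f ∘ φ` depends on the segment `S₀`, but it enters only the qualitative Dini
  -- domination, whose constant is absent from the conclusion of `abs_le_of_children`. Hence no
  -- global bound of `f ∘ φ` is needed.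
  obtain ⟨M, hM⟩ : ∃ M, |f (φ (S₀.1 0))| + A' * ‖S₀.1 1 - S₀.1 0‖ ^ (α * σ) = M := ⟨_, rfl⟩
  have hM0 : 0 ≤ M := by rw [← hM]; positivity
  have hMle : ∀ x ∈ convexHull ℝ {S₀.1 0, S₀.1 1}, |f (φ x)| ≤ M := by
    intro x hx
    have k1 := h.holder'.2.2 (S₀.1 0) x ((convexHull_pair_subset (convex_convexHull ℝ _)
      (pair_mem_hull _ _).1 hx).trans S₀.hull_one)
    have k2 : ‖x - S₀.1 0‖ ≤ ‖S₀.1 1 - S₀.1 0‖ := by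
      rw [convexHull_pair] at hx
      exact norm_sub_le_of_mem_segment hx
    have k3 : A' * ‖x - S₀.1 0‖ ^ (α * σ) ≤ A' * ‖S₀.1 1 - S₀.1 0‖ ^ (α * σ) :=
      mul_le_mul_of_nonneg_left (Real.rpow_le_rpow (norm_nonneg _) k2 hασ.le) hA'
    have k4 := abs_sub_abs_le_abs_sub (f (φ x)) (f (φ (S₀.1 0)))
    simp only [Function.comp_apply] at k1
    linarith
  refine abs_le_of_children (k := 1) (by simp) segHalf segHalf_isometric
    (P := fun S => S.1 0 ∈ convexHull ℝ {S₀.1 0, S₀.1 1} ∧ S.1 1 ∈ convexHull ℝ {S₀.1 0, S₀.1 1})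
    (fun i S hS => segHalf_mem (convex_convexHull ℝ _) i S hS)
    (E := fun S => η S - f (φ (S.1 0)) * pullDefect φ g₁ g₂ (S.1 0) (S.1 1))
    (u := u + diamPow (β * σ)) (c := c + M * Z)
    (IsDini.add (by simpa using hu) (isDini_diamPow (by simpa using hβσ)))
    (fun S hS => ?_) (by push_cast; linarith) (by positivity) (fun S hS => ?_) (pair_mem_hull _ _)
  · have k1 := hc S
    rw [Pi.zero_apply, sub_zero] at k1
    have k2 : |f (φ (S.1 0)) * pullDefect φ g₁ g₂ (S.1 0) (S.1 1)| ≤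
        M * Z * diamPow (β * σ) S := by
      rw [abs_mul, mul_assoc, diamPow, S.diam_one]
      exact mul_le_mul (hMle _ hS.1) (hZ _ _ S.hull_one) (abs_nonneg _) hM0
    have k3 := mul_nonneg hc0 (Real.rpow_nonneg S.diam_nonneg (β * σ))
    have k4 := mul_nonneg (mul_nonneg hM0 hZ0) (hu.nonneg S)
    rw [Pi.add_apply, add_mul, mul_add, mul_add]
    refine (abs_sub _ _).trans ?_
    have k5 : diamPow (β * σ) S = S.diam ^ (β * σ) := rfl
    rw [← k5] at k3
    linarith
  · have k1 := hE (midTri S)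
    have k2 := h.compensator_midTri hη S
    have k3 := h.zustInt_midTri S
    rw [diam_midTri] at k1
    have e0 : (midTri S).1 0 = S.1 0 := rfl
    have e1 : (midTri S).1 1 = midpoint ℝ (S.1 0) (S.1 1) := rfl
    have e2 : (midTri S).1 2 = S.1 1 := rfl
    rw [e0, e1, e2, k2, k3, sub_zero] at k1
    have hd : ‖midpoint ℝ (S.1 0) (S.1 1) - S.1 0‖ ≤ S.diam := by
      rw [← diam_midTri]; exact (midTri S).norm_sub_le_diam 1 0
    have hd' : ‖S.1 1 - midpoint ℝ (S.1 0) (S.1 1)‖ ≤ S.diam := by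
      rw [← diam_midTri]; exact (midTri S).norm_sub_le_diam 2 1
    have k4 : |(f (φ (midpoint ℝ (S.1 0) (S.1 1))) - f (φ (S.1 0))) *
        pullDefect φ g₁ g₂ (midpoint ℝ (S.1 0) (S.1 1)) (S.1 1)| ≤
        A' * Z * S.diam ^ (α * σ + β * σ) := by
      rw [abs_mul, Real.rpow_add_of_nonneg S.diam_nonneg hασ.le (by linarith)]
      have m1 : |f (φ (midpoint ℝ (S.1 0) (S.1 1))) - f (φ (S.1 0))| ≤ A' * S.diam ^ (α * σ) :=
        (h.holder'.2.2 _ _ (segHalf true S).hull_one).trans (mul_le_mul_of_nonneg_left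
          (Real.rpow_le_rpow (norm_nonneg _) hd hασ.le) hA')
      have m2 : |pullDefect φ g₁ g₂ (midpoint ℝ (S.1 0) (S.1 1)) (S.1 1)| ≤
          Z * S.diam ^ (β * σ) :=
        (hZ _ _ (segHalf false S).hull_one).trans (mul_le_mul_of_nonneg_left
          (Real.rpow_le_rpow (norm_nonneg _) hd' (by linarith)) hZ0)
      calc _ ≤ (A' * S.diam ^ (α * σ)) * (Z * S.diam ^ (β * σ)) :=
            mul_le_mul m1 m2 (abs_nonneg _) (mul_nonneg hA' (Real.rpow_nonneg S.diam_nonneg _))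
        _ = _ := by ring
    have f0 : (segHalf true S).1 0 = S.1 0 := rfl
    have f1 : (segHalf true S).1 1 = midpoint ℝ (S.1 0) (S.1 1) := rfl
    have f2 : (segHalf false S).1 0 = midpoint ℝ (S.1 0) (S.1 1) := rfl
    have f3 : (segHalf false S).1 1 = S.1 1 := rfl
    simp only [Fintype.sum_bool, f0, f1, f2, f3]
    generalize pullDefect φ g₁ g₂ (midpoint ℝ (S.1 0) (S.1 1)) (S.1 1) = ζ₁ at *
    generalize pullDefect φ g₁ g₂ (S.1 0) (S.1 1) = ζ at *
    generalize pullDefect φ g₁ g₂ (S.1 0) (midpoint ℝ (S.1 0) (S.1 1)) = ζ₂ at *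
    generalize f (φ (midpoint ℝ (S.1 0) (S.1 1))) = fm at *
    generalize f (φ (S.1 0)) = fp at *
    -- The two halves, the comparison error on the midpoint triangle, and the Leibniz term `δ(f ∘ φ)
    -- ∪ ζ`; the last two have order `(α + β) * σ`.
    have e : η S - fp * ζ = (η (segHalf true S) - fp * ζ₂) + (η (segHalf false S) - fm * ζ₁) +
        -(η (segHalf false S) - η S + η (segHalf true S) - fp * (ζ₁ - ζ + ζ₂)) +
        (fm - fp) * ζ₁ := by ring
    rw [e, add_mul]
    refine (abs_add_le _ _).trans ?_
    have n1 := abs_add_le ((η (segHalf true S) - fp * ζ₂) + (η (segHalf false S) - fm * ζ₁))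
      (-(η (segHalf false S) - η S + η (segHalf true S) - fp * (ζ₁ - ζ + ζ₂)))
    have n2 := abs_add_le (η (segHalf true S) - fp * ζ₂) (η (segHalf false S) - fm * ζ₁)
    rw [abs_neg] at n1
    linarith

/-- Up to the exterior derivative of a side compensator, the two pull-backs are close. -/
theorem near_extd {η : Germ 1 I}
    (hη : IsSideCompensator (pullback φ h.maps (zust D f g₁ g₂)) η) :
    Near (diamPow ((α + β) * σ)) (pullback φ h.maps (zust D f g₁ g₂) -
      zust I (f ∘ φ) (g₁ ∘ φ) (g₂ ∘ φ)) (extd η) := by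
  obtain ⟨Z, hZ0, hZ⟩ := h.exists_abs_pullDefect_le
  obtain ⟨E, hE0, hE⟩ := h.exists_abs_compare_le
  obtain ⟨E', hE'0, hE'⟩ := h.exists_abs_compensator_sub_le hη
  have hA' := h.holder'.1
  have hασ := h.holder'.2.1
  have hβσ := h.young'.1
  have hlt := h.lt'
  refine near_of_le (c := E + 3 * E' + A' * Z) (by positivity) fun S => ?_
  rw [Pi.sub_apply, h.pullback_apply, h.zust_apply, extd_one_apply, diamPow, add_mul α β σ]
  have k0 := hE S
  have hedge : ∀ i j, (S.edge i j).diam ^ (α * σ + β * σ) ≤ S.diam ^ (α * σ + β * σ) := by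
    intro i j
    refine Real.rpow_le_rpow (Simp.diam_nonneg _) ?_ (by linarith)
    rw [Simp.diam_one]
    exact S.norm_sub_le_diam j i
  have k1 := (hE' (S.edge 1 2)).trans (mul_le_mul_of_nonneg_left (hedge 1 2) hE'0)
  have k2 := (hE' (S.edge 0 2)).trans (mul_le_mul_of_nonneg_left (hedge 0 2) hE'0)
  have k3 := (hE' (S.edge 0 1)).trans (mul_le_mul_of_nonneg_left (hedge 0 1) hE'0)
  have e : ∀ i j, (S.edge i j).1 0 = S.1 i ∧ (S.edge i j).1 1 = S.1 j := fun i j => ⟨rfl, rfl⟩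
  simp only [e] at k1 k2 k3
  -- The difference between `(f ∘ φ) ∪ δζ`, which occurs in the comparison, and `δ((f ∘ φ) ∪ ζ)`,
  -- which approximates `δη`.
  have k4 : |(f (φ (S.1 1)) - f (φ (S.1 0))) * pullDefect φ g₁ g₂ (S.1 1) (S.1 2)| ≤
      A' * Z * S.diam ^ (α * σ + β * σ) := by
    rw [abs_mul, Real.rpow_add_of_nonneg S.diam_nonneg hασ.le (by linarith)]
    have m1 : |f (φ (S.1 1)) - f (φ (S.1 0))| ≤ A' * S.diam ^ (α * σ) :=
      (h.holder'.2.2 _ _ (S.edge_hull 0 1)).trans (mul_le_mul_of_nonneg_left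
        (Real.rpow_le_rpow (norm_nonneg _) (S.norm_sub_le_diam 1 0) hασ.le) hA')
    have m2 : |pullDefect φ g₁ g₂ (S.1 1) (S.1 2)| ≤ Z * S.diam ^ (β * σ) :=
      (hZ _ _ (S.edge_hull 1 2)).trans (mul_le_mul_of_nonneg_left
        (Real.rpow_le_rpow (norm_nonneg _) (S.norm_sub_le_diam 2 1) (by linarith)) hZ0)
    calc _ ≤ (A' * S.diam ^ (α * σ)) * (Z * S.diam ^ (β * σ)) :=
          mul_le_mul m1 m2 (abs_nonneg _) (mul_nonneg hA' (Real.rpow_nonneg S.diam_nonneg _))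
      _ = _ := by ring
  rw [add_mul, add_mul]
  rw [abs_le] at *
  constructor <;> linarith [k0.1, k0.2, k1.1, k1.2, k2.1, k2.2, k3.1, k3.2, k4.1, k4.2]

/-- The prescribed midpoint defects cancel in `η - η'`, which is then midpoint additive and
dominated by a Dini gauge. -/
theorem compensator_unique {η η' : Germ 1 I}
    (hη : IsSideCompensator (pullback φ h.maps (zust D f g₁ g₂)) η)
    (hη' : IsSideCompensator (pullback φ h.maps (zust D f g₁ g₂)) η') : η = η' := by
  obtain ⟨u, hu, hun⟩ := hη.1
  obtain ⟨u', hu', hun'⟩ := hη'.1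
  obtain ⟨c, hc0, hc⟩ := hun.exists_le
  obtain ⟨c', hc0', hc'⟩ := hun'.exists_le
  funext S
  have := abs_le_of_children (k := 1) (by simp) segHalf segHalf_isometric
    (P := fun _ => True) (fun _ _ _ => trivial) (E := η - η') (u := u + u') (c := c + c')
    (by simpa using hu.add hu') (fun S _ => by
      have a1 := hc S
      have a2 := hc' S
      have b1 := mul_nonneg hc0 (hu'.nonneg S)
      have b2 := mul_nonneg hc0' (hu.nonneg S)
      rw [Pi.zero_apply, sub_zero] at a1 a2
      rw [Pi.sub_apply, Pi.add_apply, add_mul, mul_add, mul_add]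
      refine (abs_sub _ _).trans ?_
      linarith) (κ := 2) (C := 0) (by norm_num) le_rfl
    (fun S _ => by
      have k1 := h.compensator_midTri hη S
      have k2 := h.compensator_midTri hη' S
      rw [zero_mul, add_zero, Fintype.sum_bool]
      refine le_trans (le_of_eq ?_) (abs_add_le _ _)
      congr 1
      simp only [Pi.sub_apply]
      linarith) (S := S) trivial
  rw [zero_div, zero_mul] at this
  exact sub_eq_zero.1 (abs_eq_zero.1 (le_antisymm this (abs_nonneg _)))

/-- The recursion of `compensator_midTri` is solved by starting from zero and adding the source over
dyadic refinements. The global bound of `f ∘ φ` makes the source uniformly of order `β * σ > 1`, so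
that the sums converge and the limit is dominated by a Dini gauge. -/
theorem exists_compensator (hb : ∃ M : ℝ, ∀ x ∈ I, |f (φ x)| ≤ M) :
    ∃ η, IsSideCompensator (pullback φ h.maps (zust D f g₁ g₂)) η := by
  obtain ⟨M, hM⟩ := hb
  have hβσ := h.young'.1
  have hασ := h.holder'.2.1
  have hlt := h.lt
  have hβ := h.young.1
  have hB := h.nonneg
  have hbd := bdryConst_nonneg h.young.2.1 h.young.1
  have hz := zustConst_nonneg h.young h.holder h.lt
  obtain ⟨c₁, hc₁, hc₁0⟩ : ∃ c, |M| * (bdryConst C β * B ^ β) = c ∧ 0 ≤ c :=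
    ⟨_, rfl, by positivity⟩
  obtain ⟨c₂, hc₂, hc₂0⟩ : ∃ c, zustConst A C α β * B ^ (α + β) = c ∧ 0 ≤ c :=
    ⟨_, rfl, by positivity⟩
  let s : Euc 2 × Euc 2 → ℝ := fun x => -zustInt f g₁ g₂ (φ x.1) (φ (midpoint ℝ x.1 x.2)) (φ x.2)
  -- The first summand bounds `f ∪ δ(g₁ dg₂)` on the image triangle, the second its distance from
  -- the Züst germ. Both shrink at least by `2 ^ (-(β * σ))`.
  let b : Euc 2 × Euc 2 → ℝ := fun x =>
    c₁ * ‖x.2 - x.1‖ ^ (β * σ) + c₂ * ‖x.2 - x.1‖ ^ (α * σ + β * σ)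
  let P : Euc 2 × Euc 2 → Prop := fun x => convexHull ℝ {x.1, x.2} ⊆ I
  have hθ := two_mul_two_rpow_neg_lt_one hβσ
  have hT : Contracts segChild P b (2 ^ (-(β * σ))) := by
    refine ⟨fun i x hx => (segHalf i (mkSeg x.1 x.2 hx)).hull_one, fun x _ => by positivity,
      by positivity, by simpa using hθ, fun i x _ => ?_⟩
    have h1 : (2 : ℝ) ^ (-(α * σ + β * σ)) ≤ 2 ^ (-(β * σ)) :=
      Real.rpow_le_rpow_of_exponent_le (by norm_num) (by linarith)
    have h2 : 0 ≤ c₂ * ‖x.2 - x.1‖ ^ (α * σ + β * σ) := by positivity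
    simp only [b]
    rw [norm_segChild, div_two_rpow (norm_nonneg _), div_two_rpow (norm_nonneg _)]
    nlinarith
  have hw : ∀ x, P x → |(0 : Euc 2 × Euc 2 → ℝ) x -
      (∑ i, (0 : Euc 2 × Euc 2 → ℝ) (segChild i x) + s x)| ≤ b x := by
    intro x hx
    have hS := hx
    obtain ⟨S, hS⟩ : ∃ S : Simp 1 I, S = mkSeg x.1 x.2 hx := ⟨_, rfl⟩
    have e0 : x.1 = S.1 0 := by rw [hS]; rfl
    have e1 : x.2 = S.1 1 := by rw [hS]; rfl
    have k1 := h.young.abs_sub_zustInt_le h.holder h.lt ((midTri S).push φ h.maps)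
    have hd := h.diam_push_le (midTri S)
    rw [diam_midTri, S.diam_one] at hd
    have k2 : zustConst A C α β * ((midTri S).push φ h.maps).diam ^ (α + β) ≤
        c₂ * ‖S.1 1 - S.1 0‖ ^ (α * σ + β * σ) := by
      rw [← hc₂, mul_assoc]
      refine mul_le_mul_of_nonneg_left ?_ hz
      rw [← add_mul, mul_comm (α + β) σ, Real.rpow_mul (norm_nonneg _),
        ← Real.mul_rpow hB (by positivity)]
      exact Real.rpow_le_rpow (Simp.diam_nonneg _) hd (by linarith)
    obtain ⟨hp, hq, hr⟩ := triple_mem_hull (((midTri S).push φ h.maps).1 0)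
      (((midTri S).push φ h.maps).1 1) (((midTri S).push φ h.maps).1 2)
    have k3 := (h.young.2.2 _ (convex_convexHull ℝ _)
      ((midTri S).push φ h.maps).hull_two).abs_youngBdry_le hp hq hr
      (((midTri S).push φ h.maps).norm_sub_le_diam 1 0)
      (((midTri S).push φ h.maps).norm_sub_le_diam 2 0)
    have k4 : bdryConst C β * ((midTri S).push φ h.maps).diam ^ β ≤
        bdryConst C β * B ^ β * ‖S.1 1 - S.1 0‖ ^ (β * σ) := by
      rw [mul_assoc]
      refine mul_le_mul_of_nonneg_left ?_ hbd
      rw [mul_comm β σ, Real.rpow_mul (norm_nonneg _), ← Real.mul_rpow hB (by positivity)]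
      exact Real.rpow_le_rpow (Simp.diam_nonneg _) hd (by linarith)
    have k5 : |f (φ (S.1 0))| ≤ |M| := (hM _ (S.vertex_mem 0)).trans (le_abs_self M)
    have k6 := mul_le_mul k5 (k3.trans k4) (abs_nonneg _) (abs_nonneg _)
    rw [← abs_mul, ← mul_assoc, hc₁] at k6
    have v0 : ((midTri S).push φ h.maps).1 0 = φ (S.1 0) := rfl
    have v1 : ((midTri S).push φ h.maps).1 1 = φ (midpoint ℝ (S.1 0) (S.1 1)) := rfl
    have v2 : ((midTri S).push φ h.maps).1 2 = φ (S.1 1) := rfl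
    have k7 := k1.trans k2
    rw [v0, v1, v2] at k6 k7
    simp only [Pi.zero_apply, Finset.sum_const_zero, zero_add, zero_sub, s, b, neg_neg, e0, e1]
    rw [abs_le] at *
    constructor <;> linarith [k6.1, k6.2, k7.1, k7.2]
  have hlim : ∀ S : Simp 1 I, selfSimLim segChild s 0 (S.1 0, S.1 1) =
      selfSimLim segChild s 0 (S.1 0, midpoint ℝ (S.1 0) (S.1 1)) +
      selfSimLim segChild s 0 (midpoint ℝ (S.1 0) (S.1 1), S.1 1) + s (S.1 0, S.1 1) := fun S => by
    have := hT.lim_eq hw (x := (S.1 0, S.1 1)) S.hull_one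
    rw [Fintype.sum_bool] at this
    exact this
  refine ⟨fun S => selfSimLim segChild s 0 (S.1 0, S.1 1),
    ⟨diamPow (β * σ) + diamPow (α * σ + β * σ),
      (isDini_diamPow hβσ).add (isDini_diamPow (by linarith)),
      near_of_le (c := (c₁ + c₂) / (1 - 2 * 2 ^ (-(β * σ)))) (div_nonneg (by positivity)
        (by linarith)) fun S => ?_⟩, fun S hS => ?_⟩
  · have k1 := hT.abs_sub_lim_le hw (x := (S.1 0, S.1 1)) S.hull_one
    rw [Pi.zero_apply, zero_sub, abs_neg] at k1
    rw [Pi.zero_apply, sub_zero, Pi.add_apply, diamPow, diamPow, S.diam_one, div_mul_eq_mul_div]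
    refine k1.trans ?_
    rw [Fintype.card_bool]
    push_cast
    refine div_le_div_of_nonneg_right ?_ (by linarith)
    have m1 := mul_nonneg hc₁0 (Real.rpow_nonneg (norm_nonneg (S.1 1 - S.1 0)) (α * σ + β * σ))
    have m2 := mul_nonneg hc₂0 (Real.rpow_nonneg (norm_nonneg (S.1 1 - S.1 0)) (β * σ))
    simp only [b]
    linarith
  · rw [Pi.sub_apply, h.pullback_apply, extd_one_apply]
    have := hlim (S.edge 0 2)
    have e0 : (S.edge 0 2).1 0 = S.1 0 := rfl
    have e1 : (S.edge 0 2).1 1 = S.1 2 := rfl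
    rw [e0, e1, ← hS] at this
    simp only [s, ← hS] at this
    have f1 : (S.edge 1 2).1 0 = S.1 1 := rfl
    have f2 : (S.edge 1 2).1 1 = S.1 2 := rfl
    have f3 : (S.edge 0 1).1 0 = S.1 0 := rfl
    have f4 : (S.edge 0 1).1 1 = S.1 1 := rfl
    rw [e0, e1, f1, f2, f3, f4]
    linarith

end PullData

end Compensator

end RoughForms

namespace RoughForms

/-! ### Vanishing of small closed functions of triangles. -/

section ClosedTri

variable {V : Type*} [NormedAddCommGroup V] [NormedSpace ℝ V]

/-- A closed function of triangles in a convex set which vanishes on the triangles `[p m q]` with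
`m` the midpoint of `[p q]`, and is smaller than the square of the diameter, is zero. -/
theorem eq_zero_of_dTri_eq_zero {K : Set V} (hK : Convex ℝ K) {r : V → V → V → ℝ} {c κ : ℝ}
    (hc : 0 ≤ c) (hκ : 2 < κ)
    (hd : ∀ x ∈ K, ∀ y ∈ K, ∀ z ∈ K, ∀ t ∈ K, dTri r x y z t = 0)
    (hmid : ∀ x ∈ K, ∀ y ∈ K, r x (midpoint ℝ x y) y = 0)
    (hr : ∀ x ∈ K, ∀ y ∈ K, ∀ z ∈ K, |r x y z| ≤ c * triSize (x, y, z) ^ κ) {x y z : V}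
    (hx : x ∈ K) (hy : y ∈ K) (hz : z ∈ K) : r x y z = 0 := by
  have h0 : ∀ x ∈ K, r x x x = 0 := fun x hx => by simpa using hmid x hx x hx
  have hll : ∀ x ∈ K, ∀ y ∈ K, r x x y = 0 := fun x hx y hy => by
    have := hd x hx x hx y hy x hx
    have := h0 x hx
    simp only [dTri] at *
    linarith
  have hrr : ∀ x ∈ K, ∀ y ∈ K, r x y y = 0 := fun x hx y hy => by
    have := hd y hy x hx y hy y hy
    have := h0 y hy
    simp only [dTri] at *
    linarith
  -- Unlike the other repetitions of a vertex, this one does not follow at once from closedness. The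
  -- value is additive over the two halves of `[x y]` and of order `κ`, so it vanishes by
  -- contraction.
  have hlr : ∀ x ∈ K, ∀ y ∈ K, r x y x = 0 := fun x hx y hy => by
    refine (contracts_segChild (P := fun x : V × V => x.1 ∈ K ∧ x.2 ∈ K)
      (fun i _ hx => segChild_mem_of_convex hK i hx) (β := κ) (by linarith) hc).eq_zero
      (E := fun x => r x.1 x.2 x.1) ?_ ?_ (x := (x, y)) ⟨hx, hy⟩
    · rintro ⟨p, q⟩ ⟨hp, hq⟩
      have hm := midpoint_mem_of_convex hK hp hq
      have m1 := hmid p hp q hq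
      have m2 := hmid q hq p hp
      rw [midpoint_comm] at m2
      have d1 := hd p hp _ hm q hq p hp
      have d2 := hd q hq _ hm q hq p hp
      have d3 := hd q hq _ hm q hq _ hm
      have l1 := hll q hq p hp
      have l2 := hll q hq _ hm
      have l3 := hrr q hq _ hm
      rw [Fintype.sum_bool]
      refine le_trans (le_of_eq ?_) (abs_add_le _ _)
      congr 1
      simp only [segChild, dTri, if_true, Bool.false_eq_true, if_false] at *
      linarith
    · rintro ⟨p, q⟩ ⟨hp, hq⟩
      simpa [triSize] using hr p hp q hq p hp
  refine (contracts_triChild (P := fun x : V × V × V => x.1 ∈ K ∧ x.2.1 ∈ K ∧ x.2.2 ∈ K)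
    (fun i _ hx => triChild_mem_of_convex hK i hx) hκ hc).eq_zero
    (E := fun x => r x.1 x.2.1 x.2.2) (fun x hx => ?_) (fun x hx => hr _ hx.1 _ hx.2.1 _ hx.2.2)
    (x := (x, y, z)) ⟨hx, hy, hz⟩
  -- Closedness with constant `0` turns the approximate additivity into an exact one; only midpoint
  -- triangles and repeated vertices must be degenerate for this.
  have := abs_sub_sum_triChild_le hK hmid hlr hrr (C := 0) (γ := κ)
    (fun x hx y hy z hz t ht L _ _ _ => by rw [hd x hx y hy z hz t ht]; simp) x hx
  rw [mul_zero, zero_mul] at this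
  have := sub_eq_zero.1 (abs_eq_zero.1 (le_antisymm this (abs_nonneg _)))
  rw [this]
  exact Finset.abs_sum_le_sum_abs _ _

end ClosedTri

/-- In the plane, a set contains the convex hull of `s` if it contains all triangles with vertices
in `s`. -/
theorem convexHull_subset_of_triples {s D : Set (Euc 2)}
    (h : ∀ p ∈ s, ∀ q ∈ s, ∀ r ∈ s, convexHull ℝ {p, q, r} ⊆ D) : convexHull ℝ s ⊆ D := by
  intro x hx
  rw [convexHull_eq_union] at hx
  simp only [Set.mem_iUnion] at hx
  obtain ⟨t, hts, hi, hxt⟩ := hx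
  have h1 := hi.card_le_finrank_succ
  have h2 := Submodule.finrank_le (vectorSpan ℝ (Set.range ((↑) : t → Euc 2)))
  have hc : t.card ≤ 3 := by
    rw [Fintype.card_coe] at h1
    rw [finrank_euclideanSpace_fin] at h2
    omega
  obtain ⟨k, hk⟩ : ∃ k, t.card = k := ⟨_, rfl⟩
  rw [hk] at hc
  interval_cases k
  · rw [Finset.card_eq_zero] at hk
    simp [hk] at hxt
  · obtain ⟨a, rfl⟩ := Finset.card_eq_one.1 hk
    have ha := hts (by simp : a ∈ _)
    exact h a ha a ha a ha (by simpa using hxt)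
  · obtain ⟨a, b, -, rfl⟩ := Finset.card_eq_two.1 hk
    have ha := hts (by simp : a ∈ _)
    have hb := hts (by simp : b ∈ _)
    exact h a ha b hb b hb (by simpa using hxt)
  · obtain ⟨a, b, c, -, -, -, rfl⟩ := Finset.card_eq_three.1 hk
    have ha := hts (by simp : a ∈ _)
    have hb := hts (by simp : b ∈ _)
    have hc := hts (by simp : c ∈ _)
    exact h a ha b hb c hc (by simpa using hxt)

theorem triSize_ge_diam {d : ℕ} {D : Set (Euc d)} (S : Simp 2 D) :
    S.diam ≤ triSize (S.1 0, S.1 1, S.1 2) := by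
  have h1 := norm_nonneg (S.1 1 - S.1 0)
  have h2 := norm_nonneg (S.1 2 - S.1 0)
  have h3 := norm_sub_rev (S.1 1) (S.1 0)
  have h4 := norm_sub_rev (S.1 2) (S.1 0)
  have h5 := norm_sub_rev (S.1 2) (S.1 1)
  have h6 := norm_sub_le (S.1 2 - S.1 0) (S.1 1 - S.1 0)
  rw [sub_sub_sub_cancel_right] at h6
  refine S.diam_le fun i j => ?_
  simp only [triSize]
  fin_cases i <;> fin_cases j <;> simp <;> linarith

namespace PullData

/-! ### Edges that are mapped into segments. -/

section Edges

variable {d : ℕ} {D : Set (Euc d)} {I : Set (Euc 2)} {φ : Euc 2 → Euc d} {f g₁ g₂ : Euc d → ℝ}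
  {A A' C C' α β σ B : ℝ} (h : PullData D I φ f g₁ g₂ A A' C C' α β σ B)

include h

/-- The side compensator vanishes on segments which are mapped into segments. -/
theorem compensator_eq_zero {η : Germ 1 I}
    (hη : IsSideCompensator (pullback φ h.maps (zust D f g₁ g₂)) η) (S : Simp 1 I)
    (hS : φ '' segment ℝ (S.1 0) (S.1 1) ⊆ segment ℝ (φ (S.1 0)) (φ (S.1 1))) : η S = 0 := by
  obtain ⟨u, hu, hun⟩ := hη.1
  obtain ⟨c, hc0, hc⟩ := hun.exists_le
  have hconv := convex_segment (𝕜 := ℝ) (S.1 0) (S.1 1)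
  have := abs_le_of_children (k := 1) (by simp) segHalf segHalf_isometric
    (P := fun T => T.1 0 ∈ segment ℝ (S.1 0) (S.1 1) ∧ T.1 1 ∈ segment ℝ (S.1 0) (S.1 1))
    (fun i T hT => segHalf_mem hconv i T hT) (E := η) (u := u) (by simpa using hu)
    (c := c) (fun T _ => by simpa using hc T) (κ := 2) (C := 0) (by norm_num) le_rfl
    (fun T hT => by
      have k1 := h.compensator_midTri hη T
      -- Subsegments need not be mapped into the segment between the images of their end points, but
      -- collinearity of the images is inherited and makes the Züst integral vanish.
      have hl : ∀ x ∈ segment ℝ (S.1 0) (S.1 1), φ x ∈ line[ℝ, φ (S.1 0), φ (S.1 1)] :=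
        fun x hx => by
          have := hS ⟨x, hx, rfl⟩
          rw [← convexHull_pair] at this
          exact convexHull_subset_affineSpan _ this
      have hm := midpoint_mem_of_convex hconv hT.1 hT.2
      obtain ⟨t0, t1, t2⟩ := triple_mem_hull (φ (T.1 0)) (φ (midpoint ℝ (T.1 0) (T.1 1)))
        (φ (T.1 1))
      have hz : zustInt f g₁ g₂ (φ (T.1 0)) (φ (midpoint ℝ (T.1 0) (T.1 1))) (φ (T.1 1)) = 0 :=
        (h.young.almostClosed h.holder h.lt (convex_convexHull ℝ _)
          (h.hull_triple (midTri T).hull_two)).sewTri_of_collinear t0 t1 t2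
          (collinear_triple_of_mem_affineSpan_pair (hl _ hT.1) (hl _ hm) (hl _ hT.2))
      rw [zero_mul, add_zero, Fintype.sum_bool]
      refine le_trans (le_of_eq ?_) (abs_add_le _ _)
      congr 1
      linarith) (S := S) ⟨left_mem_segment ℝ _ _, right_mem_segment ℝ _ _⟩
  rw [zero_div, zero_mul] at this
  exact abs_eq_zero.1 (le_antisymm this (abs_nonneg _))

/-- The hypotheses are inherited by subsets of `I`. -/
theorem mono {J : Set (Euc 2)} (hJ : J ⊆ I) : PullData D J φ f g₁ g₂ A A' C C' α β σ B where
  young := h.young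
  holder := h.holder
  young' := ⟨h.young'.1, h.young'.2.1, fun K hK hKJ => h.young'.2.2 K hK (hKJ.trans hJ)⟩
  holder' := ⟨h.holder'.1, h.holder'.2.1, fun p q hpq => h.holder'.2.2 p q (hpq.trans hJ)⟩
  maps S := h.maps ⟨S.1, S.2.trans hJ⟩
  nonneg := h.nonneg
  norm_le p q hpq := h.norm_le p q (hpq.trans hJ)
  pos := h.pos
  lt := h.lt
  lt' := h.lt'

end Edges

/-! ### Change of variables in the plane. -/

section Plane

variable {D I : Set (Euc 2)} {φ : Euc 2 → Euc 2} {f g₁ g₂ : Euc 2 → ℝ}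
  {A A' C C' α β σ B : ℝ} (h : PullData D I φ f g₁ g₂ A A' C C' α β σ B)

include h

/-- Change of variables in the plane, with a boundary term. -/
theorem zustInt_eq_add_extd {η : Germ 1 I}
    (hη : IsSideCompensator (pullback φ h.maps (zust D f g₁ g₂)) η) (S : Simp 2 I) :
    zustInt f g₁ g₂ (φ (S.1 0)) (φ (S.1 1)) (φ (S.1 2)) =
      zustInt (f ∘ φ) (g₁ ∘ φ) (g₂ ∘ φ) (S.1 0) (S.1 1) (S.1 2) + extd η S := by
  obtain ⟨E, hE0, hE⟩ := (h.near_extd hη).exists_le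
  have hlt := h.lt'
  have hK := convex_convexHull ℝ {S.1 0, S.1 1, S.1 2}
  obtain ⟨s0, s1, s2⟩ := triple_mem_hull (S.1 0) (S.1 1) (S.1 2)
  have eT : ∀ T : Simp 2 I, extd η T = evalSeg η (T.1 1) (T.1 2) - evalSeg η (T.1 0) (T.1 2) +
      evalSeg η (T.1 0) (T.1 1) := fun T => by
    rw [extd_one_apply, ← evalSeg_vertices η, ← evalSeg_vertices η, ← evalSeg_vertices η]
    rfl
  -- The remainder is closed because the target is a plane, vanishes on midpoint triangles by the
  -- choice of `η`, and has order `α * σ + β * σ > 2` by `near_extd`.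
  have key := eq_zero_of_dTri_eq_zero hK (r := fun x y z => zustInt f g₁ g₂ (φ x) (φ y) (φ z) -
    zustInt (f ∘ φ) (g₁ ∘ φ) (g₂ ∘ φ) x y z -
      (evalSeg η y z - evalSeg η x z + evalSeg η x y)) (κ := α * σ + β * σ) hE0 hlt
    (fun x hx y hy z hz t ht => by
      have hs : ∀ i, ![x, y, z, t] i ∈ convexHull ℝ {S.1 0, S.1 1, S.1 2} := fun i => by
        fin_cases i <;> assumption
      -- Closedness on the four images needs their whole hull in `D`, while `φ` is only known to
      -- respect triples; Carathéodory's theorem in the plane closes the gap.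
      have hD : convexHull ℝ (Set.range fun i => φ (![x, y, z, t] i)) ⊆ D := by
        refine convexHull_subset_of_triples ?_
        rintro _ ⟨i, rfl⟩ _ ⟨j, rfl⟩ _ ⟨k, rfl⟩
        exact h.hull_triple ((convexHull_triple_subset hK (hs i) (hs j) (hs k)).trans S.hull_two)
      have k1 : dTri (zustInt f g₁ g₂) (φ x) (φ y) (φ z) (φ t) = 0 :=
        (h.young.almostClosed h.holder h.lt (convex_convexHull ℝ _) hD).midpointSewn.dTri_eq_zero
          (by simp) (x := fun i => φ (![x, y, z, t] i))
          fun i => subset_convexHull ℝ _ ⟨i, rfl⟩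
      have k2 : dTri (zustInt (f ∘ φ) (g₁ ∘ φ) (g₂ ∘ φ)) x y z t = 0 :=
        (h.young'.almostClosed h.holder' h.lt' hK S.hull_two).midpointSewn.dTri_eq_zero
          (by simp) (x := ![x, y, z, t]) hs
      simp only [dTri] at *
      linarith)
    (fun x hx y hy => by
      have hs := (convexHull_pair_subset hK hx hy).trans S.hull_two
      have k1 := h.compensator_midTri hη (mkSeg x y hs)
      have k2 := h.zustInt_midTri (mkSeg x y hs)
      rw [← extd_midTri, eT] at k1
      rw [sub_eq_zero]
      exact (congrArg₂ (· - ·) k1 k2).trans (sub_zero _))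
    (fun x hx y hy z hz => by
      have hs := (convexHull_triple_subset hK hx hy hz).trans S.hull_two
      have k1 := hE (mkTri x y z hs)
      rw [Pi.sub_apply, h.pullback_apply, h.zust_apply, eT, diamPow, add_mul α β σ] at k1
      exact k1.trans (mul_le_mul_of_nonneg_left (Real.rpow_le_rpow (Simp.diam_nonneg _)
        (triSize_ge_diam (mkTri x y z hs)) (by linarith)) hE0)) s0 s1 s2
  rw [eT]
  linarith

/-- Change of variables in the plane, if the edges are mapped into the corresponding segments. -/
theorem zustInt_eq (S : Simp 2 I) (hS : ∀ i j : Fin 3, φ '' segment ℝ (S.1 i) (S.1 j) ⊆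
      segment ℝ (φ (S.1 i)) (φ (S.1 j))) :
    zustInt f g₁ g₂ (φ (S.1 0)) (φ (S.1 1)) (φ (S.1 2)) =
      zustInt (f ∘ φ) (g₁ ∘ φ) (g₂ ∘ φ) (S.1 0) (S.1 1) (S.1 2) := by
  -- On the triangle itself `f ∘ φ` is bounded, so a compensator exists there. Since `zustInt` does
  -- not refer to the ambient set, the identity obtained there is the required one.
  have h' := h.mono S.2
  obtain ⟨S', hS'⟩ : ∃ S' : Simp 2 (convexHull ℝ (Set.range S.1)), S'.1 = S.1 :=
    ⟨⟨S.1, subset_rfl⟩, rfl⟩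
  have hb : ∃ M : ℝ, ∀ x ∈ convexHull ℝ (Set.range S.1), |f (φ x)| ≤ M := by
    have hbd : Bornology.IsBounded (convexHull ℝ (Set.range S.1)) :=
      isBounded_convexHull.2 (Set.finite_range _).isBounded
    have hp := subset_convexHull ℝ _ (Set.mem_range_self (f := S.1) 0)
    refine ⟨|f (φ (S.1 0))| + A' * Metric.diam (convexHull ℝ (Set.range S.1)) ^ (α * σ),
      fun x hx => ?_⟩
    have k1 := h'.holder'.2.2 (S.1 0) x (convexHull_pair_subset (convex_convexHull ℝ _) hp hx)
    have k2 : A' * ‖x - S.1 0‖ ^ (α * σ) ≤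
        A' * Metric.diam (convexHull ℝ (Set.range S.1)) ^ (α * σ) := by
      refine mul_le_mul_of_nonneg_left (Real.rpow_le_rpow (norm_nonneg _) ?_ h'.holder'.2.1.le)
        h'.holder'.1
      rw [← dist_eq_norm]
      exact Metric.dist_le_diam_of_mem hbd hx hp
    have k3 := abs_sub_abs_le_abs_sub (f (φ x)) (f (φ (S.1 0)))
    simp only [Function.comp_apply] at k1
    linarith
  obtain ⟨η, hη⟩ := h'.exists_compensator hb
  have key := h'.zustInt_eq_add_extd hη S'
  have h0 : ∀ i j, η (S'.edge i j) = 0 := fun i j =>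
    h'.compensator_eq_zero hη (S'.edge i j) (by
      have := hS i j
      rw [← hS'] at this
      exact this)
  rw [extd_one_apply, h0, h0, h0, sub_zero, add_zero, add_zero, hS'] at key
  exact key

end Plane

end PullData

end RoughForms

namespace RoughForms

/-! ### Quantitative form of the hypotheses. -/

section Hypotheses

variable {d : ℕ} {D : Set (Euc d)} {I : Set (Euc 2)} {φ : Euc 2 → Euc d} {f g₁ g₂ : Euc d → ℝ}
  {α β σ B c : ℝ}

theorem diam_mkTri_le {p q r : Euc d} (hs : convexHull ℝ {p, q, r} ⊆ D) {L : ℝ}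
    (hq : ‖q - p‖ ≤ L) (hr : ‖r - p‖ ≤ L) : (mkTri p q r hs).diam ≤ 2 * L := by
  have h1 := norm_nonneg (q - p)
  have h3 := norm_sub_rev q p
  have h4 := norm_sub_rev r p
  have h5 := norm_sub_rev r q
  have h6 := norm_sub_le (r - p) (q - p)
  rw [sub_sub_sub_cancel_right] at h6
  refine Simp.diam_le _ fun i j => ?_
  fin_cases i <;> fin_cases j <;> simp [mkTri] <;> linarith

theorem holderOnSegs_of_le (hα : 0 < α) (hc : 0 ≤ c)
    (h : ∀ S : Simp 1 D, |extd (germ0 D f) S| ≤ c * diamPow α S) : HolderOnSegs D f c α := by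
  refine ⟨hc, hα, fun p q hs => ?_⟩
  have := h (mkSeg p q hs)
  rw [extd_zero_apply, diamPow, Simp.diam_one] at this
  exact this

/-- The factor `2 ^ β` passes from the diameter to the two sides at the first vertex. -/
theorem youngOn_of_le (hβ : 1 < β) (hc : 0 ≤ c)
    (h : ∀ S : Simp 2 D,
      |(g₁ (S.1 1) - g₁ (S.1 0)) * (g₂ (S.1 2) - g₂ (S.1 1))| ≤ c * S.diam ^ β) :
    YoungOn D g₁ g₂ (c * 2 ^ β) β := by
  refine ⟨hβ, by positivity, fun K hK hKD => ⟨hK, hβ, by positivity,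
    fun p hp q hq r hr L h1 h2 => ?_⟩⟩
  have hs := (convexHull_triple_subset hK hp hq hr).trans hKD
  refine (h (mkTri p q r hs)).trans ?_
  rw [mul_assoc, ← Real.mul_rpow (by norm_num) ((norm_nonneg _).trans h1)]
  exact mul_le_mul_of_nonneg_left (Real.rpow_le_rpow (Simp.diam_nonneg _)
    (diam_mkTri_le hs h1 h2) (by linarith)) hc

/-- Composition with `φ` multiplies all exponents by `σ`. From `2 / σ < α + β` one gets `(α + β) * σ
> 2` for sewing in `I`, and `α + β > 2` for sewing in `D` because `σ ≤ 1`. -/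
theorem exists_pullData (hσ : 0 < σ) (hσ1 : σ ≤ 1) (hα : 0 < α) (hβ : 1 < β)
    (hγ : 2 / σ < α + β) (hβσ : 1 < β * σ)
    (hfα : gaugeSize (extd (germ0 D f)) (diamPow α) < ⊤)
    (hgβ : gaugeSize (cup (extd (germ0 D g₁)) (extd (germ0 D g₂))) (diamPow β) < ⊤)
    (hφ : MapsSimp 2 φ I D)
    (hφσ : gaugeSize (fun S : Simp 1 I => ‖φ (S.1 1) - φ (S.1 0)‖) (diamPow σ) < ⊤) :
    ∃ A A' C C' B, PullData D I φ f g₁ g₂ A A' C C' α β σ B := by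
  obtain ⟨⟨A, hA0⟩, hA⟩ := (gaugeSize_lt_top_iff _ _).1 hfα
  obtain ⟨⟨C, hC0⟩, hC⟩ := (gaugeSize_lt_top_iff _ _).1 hgβ
  obtain ⟨⟨B, hB0⟩, hB⟩ := (gaugeSize_lt_top_iff _ _).1 hφσ
  have hC' : ∀ S : Simp 2 D,
      |(g₁ (S.1 1) - g₁ (S.1 0)) * (g₂ (S.1 2) - g₂ (S.1 1))| ≤ C * S.diam ^ β := fun S => by
    have := hC S
    rwa [cup_extd_apply] at this
  have hB' : ∀ p q, convexHull ℝ {p, q} ⊆ I → ‖φ q - φ p‖ ≤ B * ‖q - p‖ ^ σ := fun p q hs => by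
    have := hB (mkSeg p q hs)
    rw [abs_norm, diamPow, Simp.diam_one] at this
    exact this
  have hf := holderOnSegs_of_le hα hA0 hA
  have hlt' : 2 < (α + β) * σ := (div_lt_iff₀ hσ).1 hγ
  refine ⟨A, A * B ^ α, C * 2 ^ β, C * B ^ β * 2 ^ (β * σ), B, youngOn_of_le hβ hC0 hC', hf,
    youngOn_of_le hβσ (by positivity) fun S => ?_, ⟨by positivity, by positivity,
    fun p q hs => ?_⟩, hφ, hB0, hB', hσ, by nlinarith, by linarith⟩
  · refine (hC' (S.push φ hφ)).trans ?_
    rw [mul_assoc, mul_comm β σ, Real.rpow_mul S.diam_nonneg, ← Real.mul_rpow hB0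
      (Real.rpow_nonneg S.diam_nonneg _)]
    exact mul_le_mul_of_nonneg_left (Real.rpow_le_rpow (Simp.diam_nonneg _)
      (S.diam_push_le hφ hB0 hσ.le hB') (by linarith)) hC0
  · have hD : convexHull ℝ {φ p, φ q} ⊆ D := by
      have := ((mkTri p q q (by simpa using hs)).push φ hφ).edge_hull 0 1
      exact this
    refine (hf.2.2 _ _ hD).trans ?_
    rw [mul_assoc, mul_comm α σ, Real.rpow_mul (norm_nonneg _), ← Real.mul_rpow hB0
      (by positivity)]
    exact mul_le_mul_of_nonneg_left (Real.rpow_le_rpow (norm_nonneg _) (hB' p q hs) hα.le) hA0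

end Hypotheses

end RoughForms

/-! ### The main theorem. -/

theorem mainTheorem11 (d : ℕ) (D : Set (RoughForms.Euc d)) (I : Set (RoughForms.Euc 2))
    (α β σ : ℝ) (hσ : 0 < σ) (hσ1 : σ ≤ 1) (hα : 0 < α) (hβ : 1 < β)
    (hγ : 2 / σ < α + β) (hβσ : 1 < β * σ)
    (f g₁ g₂ : RoughForms.Euc d → ℝ)
    (hf : ContinuousOn f D) (hg₁ : ContinuousOn g₁ D) (hg₂ : ContinuousOn g₂ D)
    (hfα : RoughForms.gaugeSize (RoughForms.extd (RoughForms.germ0 D f))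
      (RoughForms.diamPow α) < ⊤)
    (hgβ : RoughForms.gaugeSize
      (RoughForms.cup (RoughForms.extd (RoughForms.germ0 D g₁))
        (RoughForms.extd (RoughForms.germ0 D g₂)))
      (RoughForms.diamPow β) < ⊤)
    (φ : RoughForms.Euc 2 → RoughForms.Euc d) (hφ : RoughForms.MapsSimp 2 φ I D)
    (hφσ : RoughForms.gaugeSize (fun S : RoughForms.Simp 1 I => ‖φ (S.1 1) - φ (S.1 0)‖)
      (RoughForms.diamPow σ) < ⊤) :
    -- the germs `f dg₁ ∧ dg₂` in `D` and `(f ∘ φ) d(g₁ ∘ φ) ∧ d(g₂ ∘ φ)` in `I` are well defined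
    (RoughForms.Sewable (RoughForms.preYoung D g₁ g₂) ∧
      RoughForms.Sewable (RoughForms.preZust D f g₁ g₂) ∧
      RoughForms.Sewable (RoughForms.preYoung I (g₁ ∘ φ) (g₂ ∘ φ)) ∧
      RoughForms.Sewable (RoughForms.preZust I (f ∘ φ) (g₁ ∘ φ) (g₂ ∘ φ))) ∧
    -- existence and uniqueness of the side compensator
    ((∃ M : ℝ, ∀ x ∈ I, |f (φ x)| ≤ M) →
      ∃! η : RoughForms.Germ 1 I, RoughForms.IsSideCompensator
        (RoughForms.pullback φ hφ (RoughForms.zust D f g₁ g₂)) η) ∧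
    -- comparison of the two pull-backs, and change of variables in the plane
    (∀ η : RoughForms.Germ 1 I,
      RoughForms.IsSideCompensator (RoughForms.pullback φ hφ (RoughForms.zust D f g₁ g₂)) η →
      RoughForms.Near (RoughForms.diamPow ((α + β) * σ))
        (RoughForms.pullback φ hφ (RoughForms.zust D f g₁ g₂) -
          RoughForms.zust I (f ∘ φ) (g₁ ∘ φ) (g₂ ∘ φ))
        (RoughForms.extd η) ∧
      (d = 2 → ∀ S : RoughForms.Simp 2 I,
        RoughForms.zust D f g₁ g₂ (S.push φ hφ) =
          RoughForms.zust I (f ∘ φ) (g₁ ∘ φ) (g₂ ∘ φ) S + RoughForms.extd η S ∧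
        ((∀ i j : Fin 3, φ '' segment ℝ (S.1 i) (S.1 j) ⊆
            segment ℝ (φ (S.1 i)) (φ (S.1 j))) →
          ∀ i j : Fin 3, η (S.edge i j) = 0))) ∧
    -- no boundary term if the edges are mapped into the corresponding segments
    (d = 2 → ∀ S : RoughForms.Simp 2 I,
      (∀ i j : Fin 3, φ '' segment ℝ (S.1 i) (S.1 j) ⊆
        segment ℝ (φ (S.1 i)) (φ (S.1 j))) →
      RoughForms.zust D f g₁ g₂ (S.push φ hφ) =
        RoughForms.zust I (f ∘ φ) (g₁ ∘ φ) (g₂ ∘ φ) S) := by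
  obtain ⟨A, A', C, C', B, h⟩ :=
    RoughForms.exists_pullData hσ hσ1 hα hβ hγ hβσ hfα hgβ hφ hφσ
  refine ⟨⟨⟨_, h.young.isSew⟩, ⟨_, h.young.isSew_zust h.holder h.lt⟩, ⟨_, h.young'.isSew⟩,
    ⟨_, h.young'.isSew_zust h.holder' h.lt'⟩⟩, fun hb => ?_, fun η hη => ⟨h.near_extd hη, ?_⟩, ?_⟩
  · obtain ⟨η, hη⟩ := h.exists_compensator hb
    exact ⟨η, hη, fun η' hη' => h.compensator_unique hη' hη⟩
  · rintro rfl S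
    refine ⟨?_, fun hS i j => h.compensator_eq_zero hη _ (hS i j)⟩
    rw [h.young.zust_apply h.holder h.lt, h.zust_apply]
    exact h.zustInt_eq_add_extd hη S
  · rintro rfl S hS
    rw [h.young.zust_apply h.holder h.lt, h.zust_apply]
    exact h.zustInt_eq S hS
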